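/- Let $M$ be a smooth manifold of dimension $n\ge 2$ and let $\nabla_a$ be a special connection on $M$, i.e. a smooth torsion-free connection on $TM$ with $\nabla\epsilon=0$ for some volume form $\epsilon$. Write its curvature as $$(\nabla_a\nabla_b-\nabla_b\nabla_a)X^c=W_{ab}{}^c{}_dX^d+\delta_a{}^c\mathrm P_{bd}X^d-\delta_b{}^c\mathrm P_{ad}X^d,$$ with $(n-1)\mathrm P_{bd}$ the Ricci tensor $R_{ab}{}^a{}_d$ (which is symmetric) and $W_{ab}{}^c{}_d$ the trace-free Weyl curvature, and put $Y_{abc}=\frac12(\nabla_a\mathrm P_{bc}-\nabla_b\mathrm P_{ac})$ (the Cotton–York tensor). The prolonged connection on the bundle $\mathcal T=\bigodot^2TM\oplus TM\oplus\mathbb R$ is $$\begin{pmatrix}\sigma^{bc}\\ \mu^b\\ \rho\end{pmatrix}\longmapsto\begin{pmatrix}\nabla_a\sigma^{bc}-\delta_a{}^b\mu^c-\delta_a{}^c\mu^b\\ \nabla_a\mu^b-\delta_a{}^b\rho+\mathrm P_{ac}\sigma^{bc}-\frac1nW_{ac}{}^b{}_d\sigma^{cd}\\ \nabla_a\rho+2\mathrm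 P_{ab}\mu^b-\frac4nY_{abc}\sigma^{bc}\end{pmatrix}.$$ Torsion-free connections $\nabla,\hat\nabla$ are projectively equivalent if $\hat\nabla_aX^b=\nabla_aX^b+\Upsilon_aX^b+\delta_a{}^b\Upsilon_cX^c$ for some smooth 1-form $\Upsilon_a$. The projective structure of $\nabla$ is flat if every point of $M$ lies in the domain of a smooth chart $(x^1,\dots,x^n)$ on which $\nabla$ is projectively equivalent to the coordinate connection $\partial/\partial x^a$. The degree of mobility of $\nabla$ is the dimension of the real vector space of smooth symmetric tensor fields $\sigma^{bc}$ on $M$ with $\nabla_a\sigma^{bc}=\delta_a{}^b\mu^c+\delta_a{}^c\mu^b$ for some smooth vector field $\mu^a$. Then: 1. The curvature of the prolonged connection on $\mathcal T$ vanishes identically if and only if the projective structure of $\nabla$ is flat. 2. If $M$ is connected, then the degree of mobility of $\nabla$ is finite and at most $(n+1)(n+2)/2$, and if it equals $(n+1)(n+2)/2$, then the projective structure of $\nabla$ is flat. 3. The value $(n+1)(n+2)/2$ is attained: the flat connection $\partial/\partial x^a$ on $\mathbb R^n$ is special and has degree of mobility $(n+1)(n+2)/2$. -/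

import Mathlib

open Bundle Set
open scoped Manifold ContDiff

noncomputable section

namespace ProjGeom

/-- The model space `ℝⁿ` of `n`-dimensional manifolds. -/
abbrev Model (n : ℕ) : Type := EuclideanSpace ℝ (Fin n)

section Manifold

variable {n : ℕ} {M : Type*} [TopologicalSpace M] [ChartedSpace (Model n) M]

/-- The tangent space of `M` at `x`. -/
abbrev Tangent (n : ℕ) {M : Type*} [TopologicalSpace M] [ChartedSpace (Model n) M] (x : M) :
    Type := TangentSpace (𝓡 n) x

/-- The cotangent space of `M` at `x`. -/
abbrev Cotangent (n : ℕ) {M : Type*} [TopologicalSpace M] [ChartedSpace (Model n) M] (x : M) :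
    Type := TangentSpace (𝓡 n) x →L[ℝ] ℝ

/-- The fibre at `x` of `⊙² TM`: a contravariant 2-tensor `σ^{bc}` is a linear map
`β_c ↦ σ^{bc} β_c` from the cotangent space to the tangent space, and it is symmetric when
`σ^{bc} α_b β_c` is symmetric in the covectors `α` and `β`. -/
def SymTensor (n : ℕ) {M : Type*} [TopologicalSpace M] [ChartedSpace (Model n) M] (x : M) :
    Submodule ℝ (Cotangent n x →ₗ[ℝ] Tangent n x) where
  carrier := {s | ∀ α β : Cotangent n x, α (s β) = β (s α)}
  add_mem' {s t} hs ht α β := by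
    rw [LinearMap.add_apply, LinearMap.add_apply, map_add, map_add, hs α β, ht α β]
  zero_mem' α β := by simp
  smul_mem' c s hs α β := by
    rw [LinearMap.smul_apply, LinearMap.smul_apply, map_smul, map_smul, hs α β]

/-- The number `σ^{bc} α_b β_c`. -/
def SymTensor.eval {x : M} (s : SymTensor n x) (α β : Cotangent n x) : ℝ := α (s.1 β)

/-- The symmetric tensor `u ⊙ v = u ⊗ v + v ⊗ u`, with components `u^b v^c + u^c v^b`. -/
def symProd {x : M} (u v : Tangent n x) : SymTensor n x :=
  ⟨{ toFun := fun β => β v • u + β u • v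
     map_add' := fun β β' => by simp only [add_apply]; module
     map_smul' := fun c β => by
      simp only [smul_apply, smul_eq_mul, RingHom.id_apply]; module }, fun α β => by
    simp only [LinearMap.coe_mk, AddHom.coe_mk, map_add, map_smul, smul_eq_mul]; ring⟩

theorem symProd_add_right {x : M} (u v w : Tangent n x) :
    symProd u (v + w) = symProd u v + symProd u w := by
  apply Subtype.ext
  apply LinearMap.ext
  intro β
  change β (v + w) • u + β u • (v + w) = (β v • u + β u • v) + (β w • u + β u • w)
  rw [map_add]
  module

theorem symProd_smul_right {x : M} (c : ℝ) (u v : Tangent n x) :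
    symProd u (c • v) = c • symProd u v := by
  apply Subtype.ext
  apply LinearMap.ext
  intro β
  change β (c • v) • u + β u • (c • v) = c • (β v • u + β u • v)
  rw [map_smul, smul_eq_mul]
  module

/-! ### Smooth sections -/

variable [IsManifold (𝓡 n) ∞ M]

/-- Smooth vector fields. -/
def SmoothVF (X : Π x : M, Tangent n x) : Prop :=
  ContMDiff (𝓡 n) ((𝓡 n).prod 𝓘(ℝ, Model n)) ∞ fun x => TotalSpace.mk' (Model n) x (X x)

/-- 1-forms that are smooth at `x`. -/
def SmoothFormAt (α : Π x : M, Cotangent n x) (x : M) : Prop :=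
  ContMDiffAt (𝓡 n) ((𝓡 n).prod 𝓘(ℝ, Model n →L[ℝ] ℝ)) ∞
    (fun y => TotalSpace.mk' (Model n →L[ℝ] ℝ) y (α y)) x

/-- Smooth symmetric contravariant 2-tensor fields: the function `σ^{bc} α_b β_c` is smooth
wherever the 1-forms `α` and `β` are. -/
def SmoothSym (σ : Π x : M, SymTensor n x) : Prop :=
  ∀ (α β : Π x : M, Cotangent n x) (x : M), SmoothFormAt α x → SmoothFormAt β x →
    ContMDiffAt (𝓡 n) 𝓘(ℝ, ℝ) ∞ (fun y => SymTensor.eval (σ y) (α y) (β y)) x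

/-! ### Frames -/

/-- The `i`-th standard basis vector of the tangent space at `x`. -/
def e (x : M) (i : Fin n) : Tangent n x := EuclideanSpace.basisFun (Fin n) ℝ i

/-- The dual basis of `e x`. -/
def eDual (x : M) (i : Fin n) : Cotangent n x := EuclideanSpace.proj (𝕜 := ℝ) i

/-- The coordinate vector fields `∂_i` of the preferred chart at `x`; they are smooth near `x`. -/
def frame (x : M) (i : Fin n) : Π y : M, Tangent n y := FiberBundle.extend (Model n) (e x i)

/-- The coordinate 1-forms of the preferred chart at `x`, dual to `frame x` near `x`. -/
def coframe (x : M) (i : Fin n) : Π y : M, Cotangent n y :=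
  FiberBundle.extend (E := fun y : M => Cotangent n y) (Model n →L[ℝ] ℝ) (eDual x i)

/-! ### Connections on the tangent bundle and their curvature -/

/-- Connections `∇` on the tangent bundle; `∇_v X` at `x` is `D X x v`. -/
abbrev Connection (n : ℕ) (M : Type*) [TopologicalSpace M] [ChartedSpace (Model n) M]
    [IsManifold (𝓡 n) ∞ M] : Type _ :=
  CovariantDerivative (𝓡 n) (Model n) (TangentSpace (𝓡 n) : M → Type _)

/-- `ε` is a volume form (a smooth, nowhere vanishing `n`-form) with `∇ε = 0`. -/
structure IsParallelVolume (D : Connection n M)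
    (ε : Π x : M, Tangent n x [⋀^Fin n]→ₗ[ℝ] ℝ) : Prop where
  ne_zero : ∀ x, ε x ≠ 0
  smooth : ∀ X : Fin n → Π x : M, Tangent n x, (∀ i, SmoothVF (X i)) →
    ContMDiff (𝓡 n) 𝓘(ℝ, ℝ) ∞ fun x => ε x fun i => X i x
  parallel : ∀ X : Fin n → Π x : M, Tangent n x, (∀ i, SmoothVF (X i)) →
    ∀ (x : M) (v : Tangent n x), mvfderiv (𝓡 n) (fun y => ε y fun i => X i y) x v =
      ∑ i, ε x (Function.update (fun j => X j x) i (D (X i) x v))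

/-- Special connections: smooth, torsion-free, and preserving some volume form. -/
structure IsSpecial (D : Connection n M) : Prop where
  smooth : ContMDiffCovariantDerivativeOn (Model n) ∞ D.toFun univ
  torsion_free : D.torsion = 0
  volume : ∃ ε : Π x : M, Tangent n x [⋀^Fin n]→ₗ[ℝ] ℝ, IsParallelVolume D ε

variable (D : Connection n M)

/-- The curvature `R(u,v)w = (∇_U ∇_V - ∇_V ∇_U - ∇_[U,V]) W` at `x`, where `U`, `V`, `W` are
vector fields, smooth near `x`, that extend `u`, `v`, `w`. In index notation this is
`R_{ab}{}^c{}_d u^a v^b w^d`. -/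
def curv (x : M) (u v w : Tangent n x) : Tangent n x :=
  let U : Π y : M, Tangent n y := FiberBundle.extend (Model n) u
  let V : Π y : M, Tangent n y := FiberBundle.extend (Model n) v
  let W : Π y : M, Tangent n y := FiberBundle.extend (Model n) w
  D (fun y => D W y (V y)) x u - D (fun y => D W y (U y)) x v
    - D W x (VectorField.mlieBracket (𝓡 n) U V x)

/-- The Ricci tensor `R_{bd} = R_{ab}{}^a{}_d`. -/
def ric (x : M) (v w : Tangent n x) : ℝ := ∑ i, eDual x i (curv D x (e x i) v w)

/-- The Schouten tensor `P_{bd}`, for `n ≥ 2`. -/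
def schouten (x : M) (v w : Tangent n x) : ℝ := ric D x v w / ((n : ℝ) - 1)

/-- The Weyl curvature `W_{ab}{}^c{}_d = R_{ab}{}^c{}_d - δ_a{}^c P_{bd} + δ_b{}^c P_{ad}`. -/
def weyl (x : M) (u v w : Tangent n x) : Tangent n x :=
  curv D x u v w - schouten D x v w • u + schouten D x u w • v

/-- The covariant derivative `∇_a P_{bc}` of the Schouten tensor. -/
def nablaSchouten (x : M) (u v w : Tangent n x) : ℝ :=
  let V : Π y : M, Tangent n y := FiberBundle.extend (Model n) v
  let W : Π y : M, Tangent n y := FiberBundle.extend (Model n) w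
  mvfderiv (𝓡 n) (fun y => schouten D y (V y) (W y)) x u
    - schouten D x (D V x u) w - schouten D x v (D W x u)

/-- The Cotton–York tensor `Y_{abc} = (∇_a P_{bc} - ∇_b P_{ac}) / 2`. -/
def cotton (x : M) (u v w : Tangent n x) : ℝ :=
  (nablaSchouten D x u v w - nablaSchouten D x v u w) / 2

/-! ### Projective equivalence and flatness -/

/-- The operators `D₁` and `D₂` are projectively equivalent on `U`: for some smooth 1-form `Υ`
on `U`, `D₂_v X = D₁_v X + Υ(v) X + Υ(X) v` for all smooth vector fields `X`. -/
def ProjEquivOn (D₁ D₂ : (Π x : M, Tangent n x) → Π x : M, Tangent n x →L[ℝ] Tangent n x)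
    (U : Set M) : Prop :=
  ∃ Υ : Π x : M, Cotangent n x, (∀ x ∈ U, SmoothFormAt Υ x) ∧
    ∀ X : Π x : M, Tangent n x, SmoothVF X → ∀ x ∈ U, ∀ v : Tangent n x,
      D₂ X x v = D₁ X x v + Υ x v • X x + Υ x (X x) • v

/-- The flat connection `∂/∂x^a` of a coordinate chart `φ` (meaningful on `φ.source`):
differentiate the components in the chart of a vector field. -/
def chartConnection (φ : OpenPartialHomeomorph M (Model n)) (X : Π x : M, Tangent n x) (x : M) :
    Tangent n x →L[ℝ] Tangent n x :=
  (mfderiv (𝓡 n) (𝓡 n) φ x).inverse ∘L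
    mvfderiv (F := Model n) (𝓡 n) (fun y => mfderiv (𝓡 n) (𝓡 n) φ y (X y)) x

/-- The projective structure of `D` is flat: near every point there is a smooth chart whose
coordinate connection is projectively equivalent to `D`. -/
def IsProjFlat : Prop :=
  ∀ x : M, ∃ φ ∈ IsManifold.maximalAtlas (𝓡 n) ∞ M, x ∈ φ.source ∧
    ProjEquivOn D.toFun (chartConnection φ) φ.source

/-! ### The bundle `⊙² TM ⊕ TM ⊕ ℝ` and its connection -/

/-- Components of a symmetric contravariant 2-tensor at `x`. -/
def comp {x : M} (s : SymTensor n x) (i j : Fin n) : ℝ := SymTensor.eval s (eDual x i) (eDual x j)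

/-- The covariant derivative `∇_v σ` at `x` of a symmetric contravariant 2-tensor field. Near `x`,
`σ = ∑ σ^{ij} ∂_i ⊗ ∂_j`, so that by the Leibniz rule and the symmetry of `σ^{ij}`
`∇_v σ = ∑ dσ^{ij}(v) ∂_i ⊗ ∂_j + ∑ σ^{ij} (∇_v ∂_i ⊗ ∂_j + ∂_j ⊗ ∇_v ∂_i)`. -/
def nablaSym (σ : Π x : M, SymTensor n x) (x : M) (v : Tangent n x) : SymTensor n x :=
  ∑ i, ∑ j, ((mvfderiv (𝓡 n) (fun y => SymTensor.eval (σ y) (coframe x i y) (coframe x j y)) x v / 2) •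
      symProd (e x i) (e x j) +
    comp (σ x) i j • symProd (D (frame x i) x v) (e x j))

/-- The fibre at `x` of `𝒯 = ⊙² TM ⊕ TM ⊕ ℝ`. -/
abbrev TFibre (n : ℕ) {M : Type*} [TopologicalSpace M] [ChartedSpace (Model n) M] (x : M) :
    Type := SymTensor n x × Tangent n x × ℝ

/-- Smooth sections of `𝒯`. -/
structure SmoothT (s : Π x : M, TFibre n x) : Prop where
  sym : SmoothSym fun x => (s x).1
  vec : SmoothVF fun x => (s x).2.1
  fn : ContMDiff (𝓡 n) 𝓘(ℝ, ℝ) ∞ fun x => (s x).2.2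

/-- The prolonged connection on `𝒯`, in the direction `v` at `x`: the section `(σ, μ, ρ)` goes to
the triple with entries `∇_a σ^{bc} - δ_a{}^b μ^c - δ_a{}^c μ^b`,
`∇_a μ^b - δ_a{}^b ρ + P_{ac} σ^{bc} - (1/n) W_{ac}{}^b{}_d σ^{cd}` and
`∇_a ρ + 2 P_{ab} μ^b - (4/n) Y_{abc} σ^{bc}`. -/
def prolonged (s : Π x : M, TFibre n x) (x : M) (v : Tangent n x) : TFibre n x :=
  let σ : Π y : M, SymTensor n y := fun y => (s y).1
  let μ : Π y : M, Tangent n y := fun y => (s y).2.1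
  let ρ : M → ℝ := fun y => (s y).2.2
  (nablaSym D σ x v - symProd v (μ x),
   D μ x v - ρ x • v + ∑ i, ∑ j, (comp (σ x) i j * schouten D x v (e x j)) • e x i
    - (1 / (n : ℝ)) • ∑ i, ∑ j, comp (σ x) i j • weyl D x v (e x i) (e x j),
   mvfderiv (𝓡 n) ρ x v + 2 * schouten D x v (μ x)
    - (4 / (n : ℝ)) * ∑ i, ∑ j, comp (σ x) i j * cotton D x v (e x i) (e x j))

/-- The curvature of the prolonged connection vanishes: the operators of covariant
differentiation satisfy `[𝒟_X, 𝒟_Y] = 𝒟_[X,Y]` on smooth sections of `𝒯`. -/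
def ProlongedCurvatureVanishes : Prop :=
  ∀ X Y : Π x : M, Tangent n x, SmoothVF X → SmoothVF Y →
    ∀ s : Π x : M, TFibre n x, SmoothT s → ∀ x : M,
      prolonged D (fun y => prolonged D s y (Y y)) x (X x)
        - prolonged D (fun y => prolonged D s y (X y)) x (Y x)
        - prolonged D s x (VectorField.mlieBracket (𝓡 n) X Y x) = 0

/-! ### The metrisability equation and the degree of mobility -/

/-- `σ` is a smooth solution of `∇_a σ^{bc} = δ_a{}^b μ^c + δ_a{}^c μ^b` for some vector
field `μ`. -/
def IsSolution (σ : Π x : M, SymTensor n x) : Prop :=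
  SmoothSym σ ∧ ∃ μ : Π x : M, Tangent n x, SmoothVF μ ∧
    ∀ (x : M) (v : Tangent n x), nablaSym D σ x v = symProd v (μ x)

theorem smoothFormAt_coframe (x : M) (i : Fin n) : SmoothFormAt (coframe x i) x :=
  FiberBundle.contMDiffAt_extend (V := fun y : M => Cotangent n y) (𝓡 n) (Model n →L[ℝ] ℝ)
    (eDual x i)

theorem SmoothSym.mdifferentiableAt {σ : Π x : M, SymTensor n x} (hσ : SmoothSym σ) (x : M)
    (i j : Fin n) : MDifferentiableAt (𝓡 n) 𝓘(ℝ, ℝ)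
      (fun y => SymTensor.eval (σ y) (coframe x i y) (coframe x j y)) x :=
  (hσ _ _ x (smoothFormAt_coframe x i) (smoothFormAt_coframe x j)).mdifferentiableAt (by simp)

theorem nablaSym_add {σ τ : Π x : M, SymTensor n x} (hσ : SmoothSym σ) (hτ : SmoothSym τ)
    (x : M) (v : Tangent n x) :
    nablaSym D (σ + τ) x v = nablaSym D σ x v + nablaSym D τ x v := by
  simp only [nablaSym, ← Finset.sum_add_distrib]
  refine Finset.sum_congr rfl fun i _ => Finset.sum_congr rfl fun j _ => ?_
  have h : mvfderiv (𝓡 n)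
      (fun y => SymTensor.eval ((σ + τ) y) (coframe x i y) (coframe x j y)) x v
      = mvfderiv (𝓡 n) (fun y => SymTensor.eval (σ y) (coframe x i y) (coframe x j y)) x v
      + mvfderiv (𝓡 n) (fun y => SymTensor.eval (τ y) (coframe x i y) (coframe x j y)) x v := by
    rw [← add_apply, ← mvfderiv_add (hσ.mdifferentiableAt x i j) (hτ.mdifferentiableAt x i j)]
    congr 2
    funext y
    exact map_add (coframe x i y) _ _
  have h' : comp ((σ + τ) x) i j = comp (σ x) i j + comp (τ x) i j := map_add (eDual x i) _ _
  rw [h, h']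
  module

theorem nablaSym_smul {σ : Π x : M, SymTensor n x} (hσ : SmoothSym σ) (c : ℝ)
    (x : M) (v : Tangent n x) :
    nablaSym D (c • σ) x v = c • nablaSym D σ x v := by
  simp only [nablaSym, Finset.smul_sum]
  refine Finset.sum_congr rfl fun i _ => Finset.sum_congr rfl fun j _ => ?_
  have h : mvfderiv (𝓡 n)
      (fun y => SymTensor.eval ((c • σ) y) (coframe x i y) (coframe x j y)) x v
      = c * mvfderiv (𝓡 n)
        (fun y => SymTensor.eval (σ y) (coframe x i y) (coframe x j y)) x v := by
    have := mvfderiv_mul (I := 𝓡 n) (mdifferentiableAt_const (c := c))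
      (hσ.mdifferentiableAt x i j)
    rw [mvfderiv_const] at this
    have h2 : (fun y => SymTensor.eval ((c • σ) y) (coframe x i y) (coframe x j y)) =
        (fun _ => c) * fun y => SymTensor.eval (σ y) (coframe x i y) (coframe x j y) := by
      funext y
      exact map_smul (coframe x i y) c _
    rw [h2, this]
    simp
  have h' : comp ((c • σ) x) i j = c * comp (σ x) i j := map_smul (eDual x i) c _
  rw [h, h']
  module

theorem SmoothSym.add {σ τ : Π x : M, SymTensor n x} (hσ : SmoothSym σ) (hτ : SmoothSym τ) :
    SmoothSym (σ + τ) := by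
  intro α β x hα hβ
  refine ((hσ α β x hα hβ).add (hτ α β x hα hβ)).congr_of_eventuallyEq ?_
  exact Filter.Eventually.of_forall fun y => map_add (α y) _ _

theorem SmoothSym.smul {σ : Π x : M, SymTensor n x} (hσ : SmoothSym σ) (c : ℝ) :
    SmoothSym (c • σ) := by
  intro α β x hα hβ
  refine ((contMDiffAt_const (c := c)).mul (hσ α β x hα hβ)).congr_of_eventuallyEq ?_
  exact Filter.Eventually.of_forall fun y => map_smul (α y) c _

theorem smoothVF_zero : SmoothVF (0 : Π x : M, Tangent n x) :=
  contMDiff_zeroSection ℝ (TangentSpace (𝓡 n) : M → Type _)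

/-- The vector space of smooth solutions `σ` of `∇_a σ^{bc} = δ_a{}^b μ^c + δ_a{}^c μ^b`. -/
def solutions : Submodule ℝ (Π x : M, SymTensor n x) where
  carrier := {σ | IsSolution D σ}
  add_mem' {σ τ} hσ hτ := by
    obtain ⟨hσ, μ, hμ, h⟩ := hσ
    obtain ⟨hτ, ν, hν, k⟩ := hτ
    refine ⟨hσ.add hτ, μ + ν, ContMDiff.add_section hμ hν, fun x v => ?_⟩
    rw [nablaSym_add D hσ hτ, h, k]
    exact (symProd_add_right _ _ _).symm
  smul_mem' c σ hσ := by
    obtain ⟨hσ, μ, hμ, h⟩ := hσ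
    refine ⟨hσ.smul c, c • μ, ContMDiff.const_smul_section hμ, fun x v => ?_⟩
    rw [nablaSym_smul D hσ, h]
    exact (symProd_smul_right _ _ _).symm
  zero_mem' := by
    have h0 : SmoothSym (0 : Π x : M, SymTensor n x) := by
      intro α β x _ _
      refine (contMDiffAt_const (c := (0 : ℝ))).congr_of_eventuallyEq ?_
      exact Filter.Eventually.of_forall fun y => map_zero (α y)
    refine ⟨h0, 0, smoothVF_zero, fun x v => ?_⟩
    have h := nablaSym_smul D h0 0 x v
    rw [zero_smul, zero_smul] at h
    have k := symProd_smul_right 0 v (0 : Tangent n x)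
    rw [zero_smul, zero_smul] at k
    exact h.trans k.symm

/-- The degree of mobility: the dimension of the space of solutions. -/
def mobility : ℕ := Module.finrank ℝ (solutions D)

end Manifold

theorem differentiableAt_of_section {n : ℕ} {X : Π x : Model n, Tangent n x} {x : Model n}
    (h : MDifferentiableAt (𝓡 n) ((𝓡 n).prod 𝓘(ℝ, Model n))
      (fun y => TotalSpace.mk' (Model n) (E := (TangentSpace (𝓡 n) : Model n → Type _)) y (X y)) x) :
    DifferentiableAt ℝ (E := Model n) (F := Model n) X x := by
  rw [mdifferentiableAt_section] at h
  exact mdifferentiableAt_iff_differentiableAt.1 (by simpa using h)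

/-- The flat connection `∂/∂x^a` on `ℝⁿ`. -/
def flatConnection (n : ℕ) : Connection n (Model n) where
  toFun X x := fderiv ℝ (E := Model n) (F := Model n) X x
  isCovariantDerivativeOnUniv :=
    { add := fun hσ hσ' _ =>
        fderiv_add (differentiableAt_of_section hσ) (differentiableAt_of_section hσ')
      leibniz := fun {σ g x} hσ hg _ => by
        have h := fderiv_smul (𝕜 := ℝ) (mdifferentiableAt_iff_differentiableAt.1 hg)
          (differentiableAt_of_section hσ)
        rw [mvfderiv, mfderiv_eq_fderiv]
        exact h }

end ProjGeom
end

/-! Everything is reduced to a chart. There the connection becomes a field `Γ` of symmetric bilinear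
maps whose curvature has trace zero (`LSpecial`; the trace vanishes because of the parallel volume
form), and the prolonged connection becomes `d + tcon Γ` on a trivial bundle. Its curvature is the
algebraic expression `fcurv (tcon Γ)`. Both sides of the first claim are compared with the vanishing
of the Weyl tensor W and the Cotton–York tensor Y. The same argument covers n = 2 and n ≥ 3, because
W and Y are both kept throughout.

Prolonged curvature and W, Y. The σ-entry of the curvature is W acting on σ, corrected by a trace
term. Contracted over σ = e_f ⊙ z, it yields (n + 2 - 3/n) W, so its vanishing forces W = 0
(`LSpecial.lweyl_eq_zero`). On (0, w, 0) the ρ-entry is (4 + 12/n) Y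
(`LSpecial.fcurv_tcon_snd_snd`). Conversely, if W and Y vanish on an open set, every entry of the
curvature vanishes there.

Flat projective structures and W, Y. If Γ = θ ⊗ δ + δ ⊗ θ in some chart, vanishing of the trace of
the curvature makes θ closed, and direct computation gives W = Y = 0. Conversely, W = Y = 0 is
exactly what makes the linear system ∇_a ∇_b f + P_ab f = 0 a flat connection on 1-jets. The
Frobenius theorem, proved here by solving along rays and estimating with Grönwall, supplies a
solution f with f = 1, df = 0 at a point and a vector-valued solution g with g = 0, dg = id there.
The quotient g / f is a coordinate system in which the geodesics are straight: its second derivative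
differs from dΦ ∘ Γ only by terms in a = -df / f.

Bound on the mobility. A solution σ determines μ, and then ρ as a trace, giving a section (σ, μ, ρ).
The σ-entry of its covariant derivative vanishes by the equation. Contracting the σ-entry of the
curvature identity kills the μ-entry, and the trace of the μ-entry of that identity bounds the
ρ-entry by the section itself. It is not necessary to know that the section is parallel: it obeys a
linear differential inequality, hence vanishes near any point where it is zero. On a connected
manifold, evaluation at one point is therefore injective into a space of dimension n(n+1)/2 + n + 1.

Equality. If the bound is attained, evaluation is bijective at every point. The σ-entry of the
curvature vanishes on every section coming from a solution, hence on all tensors, so W = 0. The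
ρ-entry of the covariant derivative is then an explicit multiple of Y contracted with σ;
differentiating it at a point where σ = 0 and μ is arbitrary gives Y = 0. On ℝⁿ with the flat
connection the polynomials T + x ⊙ w + (r/2) x ⊙ x realise all initial data. -/

noncomputable section

namespace ProjGeom

set_option linter.unusedSectionVars false

/-! ### Frobenius theorem for linear systems -/

section Frobenius

open Filter Topology Metric
open scoped NNReal

variable {E F : Type*} [NormedAddCommGroup E] [NormedSpace ℝ E] [NormedAddCommGroup F]
  [NormedSpace ℝ F]

local instance : NormedAddCommGroup (F →L[ℝ] F) := ContinuousLinearMap.toNormedAddCommGroup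
local instance : NormedSpace ℝ (F →L[ℝ] F) := ContinuousLinearMap.toNormedSpace
local instance : NormedAddCommGroup (E →L[ℝ] F) := ContinuousLinearMap.toNormedAddCommGroup
local instance : NormedSpace ℝ (E →L[ℝ] F) := ContinuousLinearMap.toNormedSpace
local instance : NormedAddCommGroup (E →L[ℝ] F →L[ℝ] F) :=
  ContinuousLinearMap.toNormedAddCommGroup
local instance : NormedSpace ℝ (E →L[ℝ] F →L[ℝ] F) := ContinuousLinearMap.toNormedSpace
local instance : NormedAddCommGroup (E →L[ℝ] E →L[ℝ] F →L[ℝ] F) :=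
  ContinuousLinearMap.toNormedAddCommGroup
local instance : NormedSpace ℝ (E →L[ℝ] E →L[ℝ] F →L[ℝ] F) := ContinuousLinearMap.toNormedSpace

/-- The bound 1/4 lets Picard–Lindelöf cover the whole of [0, 1] at once: in the closed ball of
radius ‖w‖ about w the velocity is at most ‖w‖ / 2, so the solution cannot leave that ball in unit
time. -/
theorem exists_linear_ode [CompleteSpace F] {A : ℝ → F →L[ℝ] F} (hA : ContinuousOn A (Icc 0 1))
    (hb : ∀ t ∈ Icc (0 : ℝ) 1, ‖A t‖ ≤ 1 / 4) (w : F) : ∃ u : ℝ → F, u 0 = w ∧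
      ∀ t ∈ Icc (0 : ℝ) 1, HasDerivWithinAt u (A t (u t)) (Icc 0 1) t := by
  have h : IsPicardLindelof (fun t x => A t x) (⟨0, by simp⟩ : Icc (0 : ℝ) 1) w ‖w‖₊ 0 ‖w‖₊
      (1 / 4) := by
    refine ⟨fun t ht => ?_, fun x _ => hA.clm_apply continuousOn_const, fun t ht x hx => ?_, ?_⟩
    · refine LipschitzWith.lipschitzOnWith ?_
      refine AddMonoidHomClass.lipschitz_of_bound_nnnorm (A t) _ fun x => ?_
      refine ((A t).le_opNNNorm x).trans (mul_le_mul_left ?_ _)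
      rw [← NNReal.coe_le_coe]
      simpa using hb t ht
    · have h1 : ‖x‖ ≤ ‖w‖ + ‖w‖ := by
        have h2 : dist x w ≤ ‖w‖ := hx
        rw [dist_eq_norm] at h2
        calc ‖x‖ = ‖(x - w) + w‖ := by rw [sub_add_cancel]
          _ ≤ _ := (norm_add_le _ _).trans (by gcongr)
      have h3 := (A t).le_of_opNorm_le (hb t ht) x
      have h4 := norm_nonneg w
      rw [coe_nnnorm]
      linarith
    · simp
  obtain ⟨u, hu, hu'⟩ := h.exists_eq_forall_mem_Icc_hasDerivWithinAt₀
  exact ⟨u, hu, hu'⟩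

/-- The deviation of an approximate variation of a radial parallel section from the radial
parallel section. -/
theorem radial_error {r K L N S : ℝ} (hr1 : r ≤ 1) {p₀ : E}
    {B : E → E →L[ℝ] F →L[ℝ] F} {B' : E → E →L[ℝ] E →L[ℝ] F →L[ℝ] F}
    (hB : ∀ p ∈ ball p₀ r, HasFDerivAt B (B' p) p) (hL : ∀ p ∈ ball p₀ r, ‖B' p‖ ≤ L)
    (hN : ∀ p ∈ ball p₀ r, ∀ q ∈ ball p₀ r, ‖B' q - B' p‖ ≤ N * ‖q - p‖)
    (hK : ∀ p ∈ ball p₀ r, ‖B p‖ ≤ K) (hKr : K * r ≤ 1 / 4)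
    (hflat : ∀ p ∈ ball p₀ r, ∀ u v s,
      B' p u v s + B p v (B p u s) = B' p v u s + B p u (B p v s))
    {x y : E} (hx : ‖x‖ < r) (hy : ‖y‖ < r) {u w : ℝ → F} (h0 : u 0 = w 0)
    (hu : ∀ t ∈ Icc (0 : ℝ) 1, HasDerivWithinAt u (B (p₀ + t • x) x (u t)) (Icc 0 1) t)
    (hw : ∀ t ∈ Icc (0 : ℝ) 1, HasDerivWithinAt w (B (p₀ + t • y) y (w t)) (Icc 0 1) t)
    (hS : ∀ t ∈ Icc (0 : ℝ) 1, ‖u t‖ ≤ S) :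
    ‖w 1 - (u 1 + B (p₀ + x) (y - x) (u 1))‖ ≤
      gronwallBound 0 (1 / 4) ((N + L + (L + K) * K) * S * ‖y - x‖ ^ 2) 1 := by
  have hr : 0 < r := (norm_nonneg x).trans_lt hx
  have hm : ∀ {x : E}, ‖x‖ < r → ∀ t ∈ Icc (0 : ℝ) 1, p₀ + t • x ∈ ball p₀ r := by
    intro x hx t ht
    rw [mem_ball, dist_eq_norm, add_sub_cancel_left, norm_smul, Real.norm_of_nonneg ht.1]
    exact (mul_le_of_le_one_left (norm_nonneg x) ht.2).trans_lt hx
  have hp0 : p₀ ∈ ball p₀ r := mem_ball_self hr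
  have hK0 : 0 ≤ K := (norm_nonneg _).trans (hK _ hp0)
  have hL0 : 0 ≤ L := (norm_nonneg _).trans (hL _ hp0)
  have hS0 : 0 ≤ S := (norm_nonneg _).trans (hS 0 (by simp))
  set h := y - x with hh
  have hxh : y = x + h := by rw [hh]; abel
  -- z carries u from the ray through x to the ray through y to first order in h. It satisfies the
  -- equation of w up to O(‖h‖²), because flatness cancels the terms linear in h; Grönwall then
  -- compares w with z.
  let z : ℝ → F := fun t => u t + t • B (p₀ + t • x) h (u t)
  let z' : ℝ → F := fun t => B (p₀ + t • x) x (u t) + (B (p₀ + t • x) h (u t)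
    + t • (B' (p₀ + t • x) x h (u t) + B (p₀ + t • x) h (B (p₀ + t • x) x (u t))))
  have hz : ∀ t ∈ Icc (0 : ℝ) 1, HasDerivWithinAt z (z' t) (Icc 0 1) t := by
    intro t ht
    have e1 : HasDerivAt (fun t : ℝ => p₀ + t • x) x t := by
      simpa using ((hasDerivAt_id t).smul_const x).const_add p₀
    have e2 : HasDerivAt (fun t : ℝ => B (p₀ + t • x)) (B' (p₀ + t • x) x) t :=
      (hB _ (hm hx t ht)).comp_hasDerivAt t e1
    have e3 : HasDerivWithinAt (fun t : ℝ => B (p₀ + t • x) h (u t))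
        (B' (p₀ + t • x) x h (u t) + B (p₀ + t • x) h (B (p₀ + t • x) x (u t))) (Icc 0 1) t := by
      have e4 := (e2.clm_apply (hasDerivAt_const t h)).hasDerivWithinAt.clm_apply (hu t ht)
      refine e4.congr_deriv ?_
      simp
    have e5 := (hu t ht).add ((hasDerivAt_id t).hasDerivWithinAt.smul e3)
    refine e5.congr_deriv ?_
    simp only [z', id, one_smul]
    abel
  have herr : ∀ t ∈ Icc (0 : ℝ) 1, ‖B (p₀ + t • y) y (z t) - z' t‖ ≤
      (N + L + (L + K) * K) * S * ‖h‖ ^ 2 := by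
    intro t ht
    have hP := hm hx t ht
    have hQ := hm hy t ht
    set P := p₀ + t • x with hPd
    set Q := p₀ + t • y with hQd
    have hPQ : Q - P = t • h := by rw [hQd, hPd, hh, smul_sub]; abel
    have hPQn : ‖Q - P‖ ≤ ‖h‖ := by
      rw [hPQ, norm_smul, Real.norm_of_nonneg ht.1]
      exact mul_le_of_le_one_left (norm_nonneg h) ht.2
    have hN0 : ‖B Q - B P - B' P (Q - P)‖ ≤ N * ‖Q - P‖ * ‖Q - P‖ := by
      have hseg : segment ℝ P Q ⊆ ball p₀ r := (convex_ball p₀ r).segment_subset hP hQ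
      refine (convex_segment P Q).norm_image_sub_le_of_norm_hasFDerivWithin_le'
        (f' := B') (fun q hq => (hB q (hseg hq)).hasFDerivWithinAt) (fun q hq => ?_)
        (left_mem_segment ℝ P Q) (right_mem_segment ℝ P Q)
      refine (hN P hP q (hseg hq)).trans ?_
      have hN' : 0 ≤ N ∨ N < 0 := le_or_gt 0 N
      rcases hN' with hN' | hN'
      · refine mul_le_mul_of_nonneg_left ?_ hN'
        obtain ⟨a, ha, rfl⟩ := (segment_eq_image' ℝ P Q ▸ hq :
          q ∈ (fun θ : ℝ => P + θ • (Q - P)) '' Icc 0 1)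
        rw [add_sub_cancel_left, norm_smul, Real.norm_of_nonneg ha.1]
        exact mul_le_of_le_one_left (norm_nonneg _) ha.2
      · have h1 := (norm_nonneg _).trans (hN P hP Q hQ)
        have h2 : ‖Q - P‖ = 0 := by
          refine le_antisymm ?_ (norm_nonneg _)
          nlinarith [norm_nonneg (Q - P)]
        have h3 : q = P := by
          have : Q = P := sub_eq_zero.1 (norm_eq_zero.1 h2)
          rw [this, segment_same] at hq
          exact hq
        rw [h3, sub_self, norm_zero, h2]
    have hLQ : ‖B Q - B P‖ ≤ L * ‖Q - P‖ :=
      (convex_ball p₀ r).norm_image_sub_le_of_norm_hasFDerivWithin_le (f' := B')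
        (fun q hq => (hB q hq).hasFDerivWithinAt) (fun q hq => hL q hq) hP hQ
    -- After flatness exchanges x and h in the mixed term of z', there remain the Taylor remainder
    -- of B and products with two factors of size ‖h‖.
    have key : B Q y (z t) - z' t = (B Q - B P - B' P (Q - P)) x (u t) + (B Q - B P) h (u t)
        + t • ((B Q - B P) y (B P h (u t)) + B P h (B P h (u t))) := by
      simp only [z, z', ← hPd]
      rw [hflat P hP x h (u t), hPQ, hxh]
      simp only [map_add, add_apply, sub_apply, map_smul, smul_apply]
      module
    have bS := hS t ht
    have bx : ‖x‖ ≤ 1 := hx.le.trans hr1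
    have by' : ‖y‖ ≤ 1 := hy.le.trans hr1
    -- The constant N carries no sign hypothesis; for h ≠ 0 the Lipschitz bound between the two end
    -- points gives N‖h‖ ≥ 0.
    have hNN : 0 ≤ N * ‖h‖ * ‖h‖ ∨ h = 0 := by
      by_cases h0 : h = 0
      · exact Or.inr h0
      · left
        have h1 := (norm_nonneg _).trans (hN (p₀ + (0 : ℝ) • x) (hm hx 0 (by simp))
          (p₀ + (1 : ℝ) • y) (hm hy 1 (by simp)))
        have h2 := (norm_nonneg _).trans (hN (p₀ + (1 : ℝ) • x) (hm hx 1 (by simp))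
          (p₀ + (1 : ℝ) • y) (hm hy 1 (by simp)))
        have h3 : p₀ + (1 : ℝ) • y - (p₀ + (1 : ℝ) • x) = h := by
          rw [hh, one_smul, one_smul]; abel
        rw [h3] at h2
        exact mul_nonneg h2 (norm_nonneg _)
    rcases hNN with hNN | h00
    swap
    · rw [key, h00]
      have : Q - P = 0 := by rw [hPQ, h00, smul_zero]
      rw [this, sub_eq_zero.1 this]
      simp
    have hN00 : N * ‖Q - P‖ * ‖Q - P‖ ≤ N * ‖h‖ * ‖h‖ := by
      rw [hPQ, norm_smul, Real.norm_of_nonneg ht.1]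
      have : N * (t * ‖h‖) * (t * ‖h‖) = (t * t) * (N * ‖h‖ * ‖h‖) := by ring
      rw [this]
      refine mul_le_of_le_one_left hNN ?_
      nlinarith [ht.1, ht.2]
    have t1 : ‖(B Q - B P - B' P (Q - P)) x (u t)‖ ≤ N * ‖h‖ * ‖h‖ * S := by
      refine ((B Q - B P - B' P (Q - P)).le_opNorm₂ x (u t)).trans ?_
      have : ‖B Q - B P - B' P (Q - P)‖ * ‖x‖ ≤ N * ‖h‖ * ‖h‖ := by
        calc _ ≤ (N * ‖h‖ * ‖h‖) * 1 := mul_le_mul (hN0.trans hN00) bx (norm_nonneg _) hNN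
          _ = _ := mul_one _
      exact mul_le_mul this bS (norm_nonneg _) hNN
    have t2' : ‖B Q - B P‖ ≤ L * ‖h‖ := hLQ.trans (mul_le_mul_of_nonneg_left hPQn hL0)
    have t2 : ‖(B Q - B P) h (u t)‖ ≤ L * ‖h‖ * ‖h‖ * S := by
      refine ((B Q - B P).le_opNorm₂ h (u t)).trans ?_
      gcongr
    have t3 : ‖B P h (u t)‖ ≤ K * ‖h‖ * S := by
      refine ((B P).le_opNorm₂ h (u t)).trans ?_
      have := hK P hP
      gcongr
    have t4 : ‖(B Q - B P) y (B P h (u t))‖ ≤ L * ‖h‖ * 1 * (K * ‖h‖ * S) := by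
      refine ((B Q - B P).le_opNorm₂ y _).trans ?_
      gcongr
    have t5 : ‖B P h (B P h (u t))‖ ≤ K * ‖h‖ * (K * ‖h‖ * S) := by
      refine ((B P).le_opNorm₂ h _).trans ?_
      have := hK P hP
      gcongr
    have t6 : ‖t • ((B Q - B P) y (B P h (u t)) + B P h (B P h (u t)))‖ ≤
        L * ‖h‖ * 1 * (K * ‖h‖ * S) + K * ‖h‖ * (K * ‖h‖ * S) := by
      rw [norm_smul, Real.norm_of_nonneg ht.1]
      refine (mul_le_of_le_one_left (norm_nonneg _) ht.2).trans ?_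
      exact (norm_add_le _ _).trans (add_le_add t4 t5)
    rw [key]
    refine (norm_add₃_le).trans ((add_le_add (add_le_add t1 t2) t6).trans (le_of_eq ?_))
    ring
  have hIci : ∀ {f : ℝ → F} {f' : F} {t : ℝ}, t ∈ Ico (0 : ℝ) 1 →
      HasDerivWithinAt f f' (Icc 0 1) t → HasDerivWithinAt f f' (Ici t) t := by
    intro f f' t ht hf
    refine hf.mono_of_mem_nhdsWithin ?_
    exact mem_of_superset (Icc_mem_nhdsGE ht.2) (Icc_subset_Icc_left ht.1)
  have hfin := norm_le_gronwallBound_of_norm_deriv_right_le (f := fun t => w t - z t)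
    (f' := fun t => B (p₀ + t • y) y (w t) - z' t) (δ := 0) (K := 1 / 4)
    (ε := (N + L + (L + K) * K) * S * ‖h‖ ^ 2) (a := 0) (b := 1)
    (fun t ht => ((hw t ht).sub (hz t ht)).continuousWithinAt)
    (fun t ht => hIci ht ((hw t ⟨ht.1, ht.2.le⟩).sub (hz t ⟨ht.1, ht.2.le⟩)))
    (by simp [z, h0]) (fun t ht => by
      have ht' : t ∈ Icc (0 : ℝ) 1 := ⟨ht.1, ht.2.le⟩
      have e1 : B (p₀ + t • y) y (w t) - z' t = B (p₀ + t • y) y (w t - z t) +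
          (B (p₀ + t • y) y (z t) - z' t) := by
        rw [map_sub]; abel
      rw [e1]
      refine (norm_add_le _ _).trans (add_le_add ?_ (herr t ht'))
      refine ((B (p₀ + t • y)).le_opNorm₂ y _).trans ?_
      refine mul_le_mul_of_nonneg_right ?_ (norm_nonneg _)
      refine (mul_le_mul (hK _ (hm hy t ht')) hy.le (norm_nonneg _) hK0).trans hKr)
    1 (by simp)
  simpa [z] using hfin

/-- **Frobenius theorem** for linear systems: a flat connection on a trivial bundle has parallel
sections, near every point, with arbitrary initial values. -/
theorem exists_parallel_section [CompleteSpace F] {U : Set E} (hU : IsOpen U) {p₀ : E}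
    (hp₀ : p₀ ∈ U) {B : E → E →L[ℝ] F →L[ℝ] F} (hB : ∀ p ∈ U, ContDiffAt ℝ ∞ B p)
    (hflat : ∀ p ∈ U, ∀ u v s, fderiv ℝ B p u v s + B p v (B p u s)
      = fderiv ℝ B p v u s + B p u (B p v s)) :
    ∃ r > 0, ball p₀ r ⊆ U ∧ ∀ s₀ : F, ∃ s : E → F, s p₀ = s₀ ∧
      ∀ p ∈ ball p₀ r, HasFDerivAt s ((B p).flip (s p)) p := by
  have hB0 := hB p₀ hp₀
  have hB1 : ContDiffAt ℝ ∞ (fderiv ℝ B) p₀ := hB0.fderiv_right (m := ∞) (by simp)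
  obtain ⟨N, T, hT, hN⟩ := (hB1.of_le (by simp) : ContDiffAt ℝ 1 _ _).exists_lipschitzOnWith
  let K : ℝ := ‖B p₀‖ + 1
  let L : ℝ := ‖fderiv ℝ B p₀‖ + 1
  have hK : 0 < K := by positivity
  have ev1 : ∀ᶠ p in 𝓝 p₀, ‖B p‖ < K :=
    hB0.continuousAt.norm.eventually (gt_mem_nhds (lt_add_one _))
  have ev2 : ∀ᶠ p in 𝓝 p₀, ‖fderiv ℝ B p‖ < L :=
    hB1.continuousAt.norm.eventually (gt_mem_nhds (lt_add_one _))
  obtain ⟨r₁, hr₁, hball⟩ := Metric.eventually_nhds_iff_ball.1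
    ((ev1.and ev2).and ((hU.eventually_mem hp₀).and (Filter.eventually_mem_set.2 hT)))
  -- With r ≤ 1/(4K) the coefficient of every radial equation has norm at most 1/4, as
  -- `exists_linear_ode` and the Grönwall estimate require.
  let r : ℝ := min r₁ (min 1 (1 / (4 * K)))
  have hr : 0 < r := by positivity
  have hsub : ball p₀ r ⊆ ball p₀ r₁ := ball_subset_ball (min_le_left _ _)
  have hr1 : r ≤ 1 := (min_le_right _ _).trans (min_le_left _ _)
  have hKr : K * r ≤ 1 / 4 := by
    have h1 : r ≤ 1 / (4 * K) := (min_le_right _ _).trans (min_le_right _ _)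
    calc K * r ≤ K * (1 / (4 * K)) := mul_le_mul_of_nonneg_left h1 hK.le
      _ = 1 / 4 := by field_simp
  have hBd : ∀ p ∈ ball p₀ r, HasFDerivAt B (fderiv ℝ B p) p := fun p hp =>
    ((hB p (hball p (hsub hp)).2.1).differentiableAt (by simp)).hasFDerivAt
  have hKb : ∀ p ∈ ball p₀ r, ‖B p‖ ≤ K := fun p hp => (hball p (hsub hp)).1.1.le
  have hNb : ∀ p ∈ ball p₀ r, ∀ q ∈ ball p₀ r, ‖fderiv ℝ B q - fderiv ℝ B p‖ ≤ N * ‖q - p‖ :=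
    fun p hp q hq => hN.norm_sub_le (hball q (hsub hq)).2.2 (hball p (hsub hp)).2.2
  refine ⟨r, hr, fun p hp => (hball p (hsub hp)).2.1, fun s₀ => ?_⟩
  have hm : ∀ {x : E}, ‖x‖ < r → ∀ t ∈ Icc (0 : ℝ) 1, p₀ + t • x ∈ ball p₀ r := by
    intro x hx t ht
    rw [mem_ball, dist_eq_norm, add_sub_cancel_left, norm_smul, Real.norm_of_nonneg ht.1]
    exact (mul_le_of_le_one_left (norm_nonneg x) ht.2).trans_lt hx
  have hex : ∀ x : E, ∃ u : ℝ → F, ‖x‖ < r → u 0 = s₀ ∧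
      ∀ t ∈ Icc (0 : ℝ) 1, HasDerivWithinAt u (B (p₀ + t • x) x (u t)) (Icc 0 1) t := by
    intro x
    by_cases hx : ‖x‖ < r
    · obtain ⟨u, hu, hu'⟩ := exists_linear_ode (A := fun t => B (p₀ + t • x) x)
        (fun t ht => by
          have h1 : ContinuousAt (fun t : ℝ => p₀ + t • x) t := by fun_prop
          have h2 : ContinuousAt (fun t : ℝ => B (p₀ + t • x)) t :=
            ContinuousAt.comp (f := fun t : ℝ => p₀ + t • x) (g := B)
              (hBd _ (hm hx t ht)).continuousAt h1
          exact (h2.clm_apply continuousAt_const).continuousWithinAt)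
        (fun t ht => (((B (p₀ + t • x)).le_opNorm x).trans (mul_le_mul (hKb _ (hm hx t ht)) hx.le
          (norm_nonneg _) hK.le)).trans hKr) s₀
      exact ⟨u, fun _ => ⟨hu, hu'⟩⟩
    · exact ⟨0, fun h => absurd h hx⟩
  choose u hu using hex
  refine ⟨fun p => u (p - p₀) 1, ?_, fun p hp => ?_⟩
  -- At the centre the ray is constant and the equation reads u' = 0.
  · obtain ⟨h0, h1⟩ := hu 0 (by simpa using hr)
    have hc := constant_of_has_deriv_right_zero (f := u 0) (a := 0) (b := 1)
      (fun t ht => (h1 t ht).continuousWithinAt) (fun t ht => by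
        have h2 := h1 t ⟨ht.1, ht.2.le⟩
        rw [map_zero] at h2
        refine h2.mono_of_mem_nhdsWithin ?_
        exact mem_of_superset (Icc_mem_nhdsGE ht.2) (Icc_subset_Icc_left ht.1)) 1 (by simp)
    simp only [sub_self]
    rw [hc, h0]
  · have hx : ‖p - p₀‖ < r := by rwa [← dist_eq_norm]
    obtain ⟨hx0, hx1⟩ := hu (p - p₀) hx
    obtain ⟨S, hS⟩ := isCompact_Icc.exists_bound_of_continuousOn
      (f := u (p - p₀)) (fun t ht => (hx1 t ht).continuousWithinAt)
    -- A quadratic error relative to an affine function identifies the derivative at p, in all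
    -- directions and not only the radial one.
    have hO : (fun q => u (q - p₀) 1 - (u (p - p₀) 1 + (B p).flip (u (p - p₀) 1) (q - p)))
        =O[𝓝 p] fun q => ‖q - p‖ ^ 2 := by
      refine Asymptotics.IsBigO.of_bound (((N + L + (L + K) * K) * S) / (1 / 4) *
        (Real.exp (1 / 4 * 1) - 1)) ?_
      filter_upwards [isOpen_ball.mem_nhds hp] with q hq
      have hy : ‖q - p₀‖ < r := by rwa [← dist_eq_norm]
      obtain ⟨hy0, hy1⟩ := hu (q - p₀) hy
      have := radial_error hr1 hBd (fun p hp => (hball p (hsub hp)).1.2.le) hNb hKb hKr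
        (fun p hp => hflat p (hball p (hsub hp)).2.1) hx hy (hx0.trans hy0.symm) hx1 hy1 hS
      rw [gronwallBound_of_K_ne_0 (by norm_num), add_sub_cancel, sub_sub_sub_cancel_right] at this
      rw [norm_pow, norm_norm]
      refine this.trans (le_of_eq ?_)
      ring
    have h1 := hO.hasFDerivAt (𝕜 := ℝ) (by norm_num)
    have h2 : HasFDerivAt (fun q => u (p - p₀) 1 + (B p).flip (u (p - p₀) 1) (q - p))
        ((B p).flip (u (p - p₀) 1)) p := by
      have h4 : HasFDerivAt (fun q : E => q - p) (ContinuousLinearMap.id ℝ E) p :=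
        (hasFDerivAt_id p).sub_const p
      have h5 := (((B p).flip (u (p - p₀) 1)).hasFDerivAt (x := p - p)).comp
        (f := fun q : E => q - p) p h4
      rw [ContinuousLinearMap.comp_id] at h5
      exact h5.const_add _
    have h3 := h1.add h2
    rw [zero_add] at h3
    refine h3.congr_of_eventuallyEq (Eventually.of_forall fun q => ?_)
    simp

/-- Bootstrapping: the derivative of s is an expression in B and s, so it has as many derivatives as
s. -/
theorem contDiffAt_parallel_section [FiniteDimensional ℝ E] {U : Set E} (hU : IsOpen U)
    {B : E → E →L[ℝ] F →L[ℝ] F} (hB : ∀ p ∈ U, ContDiffAt ℝ ∞ B p) {s : E → F}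
    (hs : ∀ p ∈ U, HasFDerivAt s ((B p).flip (s p)) p) : ∀ p ∈ U, ContDiffAt ℝ ∞ s p := by
  have hB' : ContDiffOn ℝ ∞ B U := fun p hp => (hB p hp).contDiffWithinAt
  have key : ∀ k : ℕ, ContDiffOn ℝ k s U := by
    intro k
    induction k with
    | zero =>
      exact contDiffOn_zero.2 fun p hp => (hs p hp).continuousAt.continuousWithinAt
    | succ k ih =>
      refine (contDiffOn_succ_iff_fderiv_of_isOpen (n := k) hU).2
        ⟨fun p hp => (hs p hp).differentiableAt.differentiableWithinAt, by simp, ?_⟩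
      have h1 : ContDiffOn ℝ k (fun p => (B p).flip (s p)) U := contDiffOn_clm_apply.2 fun v =>
        ((contDiffOn_infty.1 hB' k).clm_apply contDiffOn_const).clm_apply ih
      exact h1.congr fun p hp => (hs p hp).fderiv
  intro p hp
  exact (contDiffOn_infty.2 key).contDiffAt (hU.mem_nhds hp)

end Frobenius

/-! ### Vector fields in charts -/

section Charts

open Filter Topology

variable {n : ℕ} {M : Type*} [TopologicalSpace M] [ChartedSpace (Model n) M]

/-- The derivative of a chart. -/
def tm (φ : OpenPartialHomeomorph M (Model n)) (y : M) : Tangent n y →L[ℝ] Model n :=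
  mfderiv (𝓡 n) (𝓡 n) φ y

/-- The inverse of the derivative of a chart. -/
def ti (φ : OpenPartialHomeomorph M (Model n)) (y : M) : Model n →L[ℝ] Tangent n y :=
  (mfderiv (𝓡 n) (𝓡 n) φ y).inverse

/-- The components of a vector field in a chart. -/
def rep (φ : OpenPartialHomeomorph M (Model n)) (X : Π x : M, Tangent n x) (p : Model n) :
    Model n := tm φ (φ.symm p) (X (φ.symm p))

/-- The vector field with given components in a chart. -/
def cfield (φ : OpenPartialHomeomorph M (Model n)) (V : Model n → Model n) (y : M) :
    Tangent n y := ti φ y (V (φ y))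

/-- Smoothness of class `C^k` of a vector field at a point. -/
abbrev VFAt (k : ℕ∞ω) (X : Π x : M, Tangent n x) [IsManifold (𝓡 n) ∞ M] (y : M) : Prop :=
  ContMDiffAt (𝓡 n) ((𝓡 n).prod 𝓘(ℝ, Model n)) k (fun x => TotalSpace.mk' (Model n) x (X x)) y

variable [IsManifold (𝓡 n) ∞ M] {φ : OpenPartialHomeomorph M (Model n)}

theorem chart_mdifferentiable (hφ : φ ∈ IsManifold.maximalAtlas (𝓡 n) ∞ M) :
    φ.MDifferentiable (𝓡 n) (𝓡 n) :=
  ⟨(contMDiffOn_of_mem_maximalAtlas hφ).mdifferentiableOn (by simp),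
    (contMDiffOn_symm_of_mem_maximalAtlas hφ).mdifferentiableOn (by simp)⟩

theorem chart_contMDiffAt (hφ : φ ∈ IsManifold.maximalAtlas (𝓡 n) ∞ M) {y : M}
    (hy : y ∈ φ.source) : ContMDiffAt (𝓡 n) (𝓡 n) ∞ φ y :=
  contMDiffAt_of_mem_maximalAtlas hφ hy

theorem chart_symm_contMDiffAt (hφ : φ ∈ IsManifold.maximalAtlas (𝓡 n) ∞ M) {p : Model n}
    (hp : p ∈ φ.target) : ContMDiffAt (𝓡 n) (𝓡 n) ∞ φ.symm p :=
  contMDiffAt_symm_of_mem_maximalAtlas hφ hp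

theorem chart_isInvertible (hφ : φ ∈ IsManifold.maximalAtlas (𝓡 n) ∞ M) {y : M}
    (hy : y ∈ φ.source) : (mfderiv (𝓡 n) (𝓡 n) φ y).IsInvertible :=
  ⟨(chart_mdifferentiable hφ).mfderiv hy, rfl⟩

theorem ti_tm (hφ : φ ∈ IsManifold.maximalAtlas (𝓡 n) ∞ M) {y : M}
    (hy : y ∈ φ.source) (v : Tangent n y) : ti φ y (tm φ y v) = v :=
  (chart_isInvertible hφ hy).inverse_apply_self v

theorem tm_ti (hφ : φ ∈ IsManifold.maximalAtlas (𝓡 n) ∞ M) {y : M}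
    (hy : y ∈ φ.source) (v : Model n) : tm φ y (ti φ y v) = v :=
  (chart_isInvertible hφ hy).self_apply_inverse v

theorem ti_eq (hφ : φ ∈ IsManifold.maximalAtlas (𝓡 n) ∞ M) {y : M}
    (hy : y ∈ φ.source) : ti φ y = mfderiv (𝓡 n) (𝓡 n) φ.symm (φ y) := by
  ext1 v
  have h := (chart_mdifferentiable hφ).symm_comp_deriv hy
  have h2 := congrArg (fun L => L (ti φ y v)) h
  refine h2.symm.trans ?_
  change mfderiv (𝓡 n) (𝓡 n) φ.symm (φ y) (tm φ y (ti φ y v)) = _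
  rw [tm_ti hφ hy]
  rfl

theorem tm_symm_eq (hφ : φ ∈ IsManifold.maximalAtlas (𝓡 n) ∞ M) {p : Model n}
    (hp : p ∈ φ.target) : tm φ (φ.symm p) = (mfderiv (𝓡 n) (𝓡 n) φ.symm p).inverse := by
  have h1 := ti_eq hφ (φ.map_target hp)
  rw [φ.right_inv hp] at h1
  have h2 := (chart_isInvertible hφ (φ.map_target hp)).inverse_inverse
  rw [← h1]
  exact h2.symm

theorem rep_apply {X : Π x : M, Tangent n x} {y : M} (hy : y ∈ φ.source) :
    rep φ X (φ y) = tm φ y (X y) := by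
  rw [rep, φ.left_inv hy]

theorem rep_cfield (hφ : φ ∈ IsManifold.maximalAtlas (𝓡 n) ∞ M) {p : Model n}
    (hp : p ∈ φ.target) (V : Model n → Model n) : rep φ (cfield φ V) p = V p := by
  rw [rep, cfield, tm_ti hφ (φ.map_target hp), φ.right_inv hp]

theorem cfield_rep (hφ : φ ∈ IsManifold.maximalAtlas (𝓡 n) ∞ M) {y : M}
    (hy : y ∈ φ.source) (X : Π x : M, Tangent n x) : cfield φ (rep φ X) y = X y := by
  rw [cfield, rep_apply hy, ti_tm hφ hy]

/-- The components are the pullback of the field by the inverse chart, so regularity follows from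
that of pullbacks; `vfAt_cfield` is the same argument with the chart itself. -/
theorem contDiffAt_rep (hφ : φ ∈ IsManifold.maximalAtlas (𝓡 n) ∞ M) {k : ℕ∞ω}
    (hk : k + 1 ≤ ∞) {y : M} (hy : y ∈ φ.source) {X : Π x : M, Tangent n x} (hX : VFAt k X y) :
    ContDiffAt ℝ k (rep φ X) (φ y) := by
  have hp := φ.map_source hy
  have h1 : ContMDiffAt (𝓡 n) ((𝓡 n).prod 𝓘(ℝ, Model n)) k
      (fun p => TotalSpace.mk' (Model n) (E := (TangentSpace (𝓡 n) : Model n → Type _)) p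
        (VectorField.mpullback (𝓡 n) (𝓡 n) φ.symm X p)) (φ y) := by
    refine ContMDiffAt.mpullback_vectorField_preimage (n := ∞) ?_ (chart_symm_contMDiffAt hφ hp)
      ?_ hk
    · rw [φ.left_inv hy]; exact hX
    · exact ⟨(chart_mdifferentiable hφ).symm.mfderiv hp, rfl⟩
  have h2 := contMDiffAt_vectorSpace_iff_contDiffAt.1 h1
  refine h2.congr_of_eventuallyEq ?_
  filter_upwards [φ.open_target.mem_nhds hp] with q hq
  rw [rep, tm_symm_eq hφ hq]
  rfl

theorem vfAt_cfield (hφ : φ ∈ IsManifold.maximalAtlas (𝓡 n) ∞ M) {k : ℕ∞ω}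
    (hk : k + 1 ≤ ∞) {y : M} (hy : y ∈ φ.source) {V : Model n → Model n}
    (hV : ContDiffAt ℝ k V (φ y)) : VFAt k (cfield φ V) y := by
  have h1 := contMDiffAt_vectorSpace_iff_contDiffAt.2 hV
  exact ContMDiffAt.mpullback_vectorField_preimage (n := ∞) (I := 𝓡 n) (I' := 𝓡 n) (f := φ)
    (V := V) h1 (chart_contMDiffAt hφ hy) (chart_isInvertible hφ hy) hk

theorem mdifferentiableAt_comp_chart (hφ : φ ∈ IsManifold.maximalAtlas (𝓡 n) ∞ M)
    {G : Type*} [NormedAddCommGroup G] [NormedSpace ℝ G] {h : Model n → G} {y : M}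
    (hy : y ∈ φ.source) (hh : DifferentiableAt ℝ h (φ y)) :
    MDifferentiableAt (𝓡 n) 𝓘(ℝ, G) (h ∘ φ) y :=
  hh.mdifferentiableAt.comp y ((chart_contMDiffAt hφ hy).mdifferentiableAt (by simp))

theorem mvfderiv_eq_fderiv (hφ : φ ∈ IsManifold.maximalAtlas (𝓡 n) ∞ M)
    {G : Type*} [NormedAddCommGroup G] [NormedSpace ℝ G] {g : M → G} {h : Model n → G}
    {y : M} (hy : y ∈ φ.source) (hh : DifferentiableAt ℝ h (φ y))
    (hg : ∀ᶠ z in 𝓝 y, g z = h (φ z)) (v : Tangent n y) :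
    mvfderiv (𝓡 n) g y v = fderiv ℝ h (φ y) (tm φ y v) := by
  have e : mfderiv (𝓡 n) 𝓘(ℝ, G) g y = mfderiv (𝓡 n) 𝓘(ℝ, G) (h ∘ φ) y :=
    Filter.EventuallyEq.mfderiv_eq hg
  have e2 := mfderiv_comp (I := 𝓡 n) (I' := 𝓡 n) (I'' := 𝓘(ℝ, G)) y hh.mdifferentiableAt
    ((chart_contMDiffAt hφ hy).mdifferentiableAt (by simp))
  rw [mfderiv_eq_fderiv] at e2
  have e3 := congrArg (fun L => L v) (e.trans e2)
  exact e3

theorem eventually_source {y : M} (hy : y ∈ φ.source) : ∀ᶠ z in 𝓝 y, z ∈ φ.source :=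
  φ.open_source.mem_nhds hy

theorem eventually_chart {y : M} (hy : y ∈ φ.source) {q : Model n → Prop}
    (hq : ∀ᶠ p in 𝓝 (φ y), q p) : ∀ᶠ z in 𝓝 y, q (φ z) :=
  (φ.continuousAt hy).eventually hq

theorem eventually_symm {y : M} (hy : y ∈ φ.source) {q : M → Prop}
    (hq : ∀ᶠ z in 𝓝 y, q z) : ∀ᶠ p in 𝓝 (φ y), p ∈ φ.target ∧ q (φ.symm p) := by
  have hp := φ.map_source hy
  have ht : ∀ᶠ p in 𝓝 (φ y), p ∈ φ.target := φ.open_target.mem_nhds hp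
  refine ht.and ?_
  have := φ.symm.continuousAt hp
  refine this.eventually ?_
  rwa [φ.left_inv hy]

theorem VFAt.mdifferentiableAt {k : ℕ∞ω} {X : Π x : M, Tangent n x} {y : M} (h : VFAt k X y)
    (hk : k ≠ 0) : MDifferentiableAt (𝓡 n) ((𝓡 n).prod 𝓘(ℝ, Model n))
      (fun x => TotalSpace.mk' (Model n) x (X x)) y :=
  ContMDiffAt.mdifferentiableAt h hk

end Charts

/-! ### Christoffel symbols -/

section Connection

open Filter Topology

theorem contDiffAt_clm_of_apply {E F G : Type*} [NormedAddCommGroup E] [NormedSpace ℝ E]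
    [NormedAddCommGroup F] [NormedSpace ℝ F] [FiniteDimensional ℝ F]
    [NormedAddCommGroup G] [NormedSpace ℝ G] {k : ℕ∞ω} {f : E → F →L[ℝ] G} {x : E}
    (h : ∀ y, ContDiffAt ℝ k (fun x => f x y) x) : ContDiffAt ℝ k f x := by
  let d := Module.finrank ℝ F
  have hd : d = Module.finrank ℝ (Fin d → ℝ) := (Module.finrank_fin_fun ℝ).symm
  let e₁ := ContinuousLinearEquiv.ofFinrankEq hd
  let e₂ := (e₁.arrowCongr (1 : G ≃L[ℝ] G)).trans (ContinuousLinearEquiv.piRing (Fin d))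
  rw [← Function.id_comp f, ← e₂.symm_comp_self]
  exact e₂.symm.contDiff.contDiffAt.comp x (contDiffAt_pi.mpr fun i => h _)

variable {n : ℕ} {M : Type*} [TopologicalSpace M] [ChartedSpace (Model n) M]
  [IsManifold (𝓡 n) ∞ M] {φ : OpenPartialHomeomorph M (Model n)}

theorem infty_add_one_le : (∞ : ℕ∞ω) + 1 ≤ ∞ := by simp

theorem sum_coord_smul (w : Model n) : ∑ j, w j • EuclideanSpace.basisFun (Fin n) ℝ j = w := by
  have := (EuclideanSpace.basisFun (Fin n) ℝ).sum_repr w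
  simpa using this

/-- A vector field that is smooth on an open set agrees near each point of that set with a
vector field that is smooth everywhere. -/
theorem exists_smoothVF_eventuallyEq [T2Space M] {U : Set M} (hU : IsOpen U)
    {Z : Π x : M, Tangent n x} (hZ : ∀ x ∈ U, VFAt ∞ Z x) {y : M} (hy : y ∈ U) :
    ∃ X : Π x : M, Tangent n x, SmoothVF X ∧ ∀ᶠ z in 𝓝 y, X z = Z z := by
  obtain ⟨f, hf, -⟩ := (SmoothBumpFunction.nhds_basis_support (I := 𝓡 n)
    (hU.mem_nhds hy)).mem_iff.1 (univ_mem : (univ : Set M) ∈ 𝓝 y)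
  refine ⟨(f : M → ℝ) • Z, ?_, ?_⟩
  · exact ContMDiffOn.smul_section_of_tsupport f.contMDiff.contMDiffOn hU hf
      fun x hx => (hZ x hx).contMDiffWithinAt
  · filter_upwards [f.eventuallyEq_one] with z hz
    have : f z = 1 := hz
    change f z • Z z = Z z
    rw [this, one_smul]

/-- Smoothness of a connection, parallelism of a volume form and projective equivalence are only
tested on globally smooth fields, while coordinate fields live on the chart domain. A cut-off
supplies global fields with the same germ. -/
theorem exists_smoothVF_cfield [T2Space M] (hφ : φ ∈ IsManifold.maximalAtlas (𝓡 n) ∞ M) {y : M}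
    (hy : y ∈ φ.source) (w : Model n) :
    ∃ X : Π x : M, Tangent n x, SmoothVF X ∧ ∀ᶠ z in 𝓝 y, X z = cfield φ (fun _ => w) z :=
  exists_smoothVF_eventuallyEq φ.open_source
    (fun _ hx => vfAt_cfield hφ infty_add_one_le hx contDiffAt_const) hy

variable (D : Connection n M)

theorem conn_congr {X X' : Π x : M, Tangent n x} {y : M} {k : ℕ∞ω} (hk : k ≠ 0)
    (hX : VFAt k X y) (h : ∀ᶠ z in 𝓝 y, X z = X' z) : D X y = D X' y := by
  have hX' : VFAt k X' y := by
    refine ContMDiffAt.congr_of_eventuallyEq hX ?_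
    filter_upwards [h] with z hz
    rw [hz]
  exact D.isCovariantDerivativeOnUniv.congr_of_eventuallyEq (hX.mdifferentiableAt hk)
    (hX'.mdifferentiableAt hk) univ_mem h

theorem conn_sum {ι : Type*} (s : Finset ι) {X : ι → Π x : M, Tangent n x} {y : M}
    (hX : ∀ i, MDifferentiableAt (𝓡 n) ((𝓡 n).prod 𝓘(ℝ, Model n))
      (fun x => TotalSpace.mk' (Model n) x (X i x)) y) :
    D (fun x => ∑ i ∈ s, X i x) y = ∑ i ∈ s, D (X i) y := by
  classical
  induction s using Finset.induction_on with
  | empty =>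
    simp only [Finset.sum_empty]
    exact congrFun D.zero y
  | insert a s ha ih =>
    simp only [Finset.sum_insert ha]
    rw [← ih]
    exact D.isCovariantDerivativeOnUniv.add (hX a)
      (MDifferentiableAt.sum_section fun i _ => hX i)

/-- The Christoffel symbols of a connection in a chart; the first argument is the direction. -/
def gam (φ : OpenPartialHomeomorph M (Model n)) (p : Model n) :
    Model n →L[ℝ] Model n →L[ℝ] Model n :=
  (∑ j, (EuclideanSpace.proj (𝕜 := ℝ) j : Model n →L[ℝ] ℝ).smulRight
    (tm φ (φ.symm p) ∘L D (cfield φ fun _ => EuclideanSpace.basisFun (Fin n) ℝ j) (φ.symm p)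
      ∘L ti φ (φ.symm p))).flip

theorem gam_apply (p v w : Model n) : gam D φ p v w = ∑ j, w j • tm φ (φ.symm p)
    (D (cfield φ fun _ => EuclideanSpace.basisFun (Fin n) ℝ j) (φ.symm p) (ti φ (φ.symm p) v)) := by
  simp [gam]

/-- Near y the field is Σ X^j ∂_j; locality, additivity and the Leibniz rule split the derivative
into derivatives of components and derivatives of coordinate fields. -/
theorem tm_conn (hφ : φ ∈ IsManifold.maximalAtlas (𝓡 n) ∞ M) {y : M} (hy : y ∈ φ.source)
    {X : Π x : M, Tangent n x} {k : ℕ∞ω} (hk : k ≠ 0) (hk' : k + 1 ≤ ∞) (hX : VFAt k X y)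
    (v : Tangent n y) : tm φ y (D X y v) =
      fderiv ℝ (rep φ X) (φ y) (tm φ y v) + gam D φ (φ y) (tm φ y v) (rep φ X (φ y)) := by
  have hrep := (contDiffAt_rep hφ hk' hy hX).differentiableAt hk
  let b := fun j => EuclideanSpace.basisFun (Fin n) ℝ j
  let C : Fin n → Π x : M, Tangent n x := fun j => cfield φ fun _ => b j
  let g : Fin n → M → ℝ := fun j z => rep φ X (φ z) j
  have hC : ∀ j, VFAt ∞ (C j) y := fun j => vfAt_cfield hφ infty_add_one_le hy contDiffAt_const
  have hC' := fun j => (hC j).mdifferentiableAt (by simp)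
  have hgd : ∀ j, DifferentiableAt ℝ (fun p => rep φ X p j) (φ y) := fun j =>
    (EuclideanSpace.proj (𝕜 := ℝ) j : Model n →L[ℝ] ℝ).differentiableAt.comp (φ y) hrep
  have hg : ∀ j, MDifferentiableAt (𝓡 n) 𝓘(ℝ, ℝ) (g j) y := fun j =>
    mdifferentiableAt_comp_chart hφ hy (hgd j)
  have h1 : D X y = D (fun z => ∑ j, (g j • C j) z) y := by
    refine conn_congr D hk hX ?_
    filter_upwards [eventually_source hy] with z hz
    calc X z = cfield φ (rep φ X) z := (cfield_rep hφ hz X).symm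
      _ = ti φ z (∑ j, g j z • b j) := by
        rw [cfield]; congr 1; exact (sum_coord_smul _).symm
      _ = _ := by rw [map_sum]; simp only [map_smul]; rfl
  rw [h1, conn_sum D _ fun j => (hg j).smul_section (hC' j), sum_apply, map_sum]
  have h2 : ∀ j, tm φ y (D (g j • C j) y v) =
      (fderiv ℝ (rep φ X) (φ y) (tm φ y v)) j • b j + g j y • tm φ y (D (C j) y v) := by
    intro j
    have e1 := D.isCovariantDerivativeOnUniv.leibniz (hC' j) (hg j) (x := y)
    have e2 : D (g j • C j) y v = g j y • D (C j) y v + mvfderiv (𝓡 n) (g j) y v • C j y := by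
      have := congrArg (fun L => L v) e1
      exact this
    have e3 : mvfderiv (𝓡 n) (g j) y v = (fderiv ℝ (rep φ X) (φ y) (tm φ y v)) j := by
      rw [mvfderiv_eq_fderiv hφ hy (hgd j) (Eventually.of_forall fun _ => rfl)]
      have := ((EuclideanSpace.proj (𝕜 := ℝ) j : Model n →L[ℝ] ℝ).hasFDerivAt.comp (φ y)
        hrep.hasFDerivAt).fderiv
      exact congrArg (fun L => L (tm φ y v)) this
    have e4 : tm φ y (C j y) = b j := tm_ti hφ hy _
    rw [e2, map_add, map_smul, map_smul, e3, e4, add_comm]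
  rw [Finset.sum_congr rfl fun j _ => h2 j, Finset.sum_add_distrib, gam_apply]
  congr 1
  · exact sum_coord_smul _
  · rw [φ.left_inv hy, ti_tm hφ hy]

theorem gam_eq (hφ : φ ∈ IsManifold.maximalAtlas (𝓡 n) ∞ M) {y : M} (hy : y ∈ φ.source)
    (v w : Model n) :
    gam D φ (φ y) v w = tm φ y (D (cfield φ fun _ => w) y (ti φ y v)) := by
  have h := tm_conn D hφ hy (k := ∞) (by simp) infty_add_one_le
    (vfAt_cfield hφ infty_add_one_le hy (V := fun _ => w) contDiffAt_const) (ti φ y v)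
  rw [h, tm_ti hφ hy, rep_cfield hφ (φ.map_source hy)]
  have e : fderiv ℝ (rep φ (cfield φ fun _ => w)) (φ y) = 0 := by
    have : rep φ (cfield φ fun _ => w) =ᶠ[𝓝 (φ y)] fun _ => w := by
      filter_upwards [φ.open_target.mem_nhds (φ.map_source hy)] with p hp
      exact rep_cfield hφ hp _
    rw [this.fderiv_eq]
    simp
  rw [e]
  simp

variable {D}

theorem vfAt_conn (hD : ContMDiffCovariantDerivativeOn (Model n) ∞ D.toFun univ)
    {X Z : Π x : M, Tangent n x} (hX : SmoothVF X) {y : M} (hZ : VFAt ∞ Z y) :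
    VFAt ∞ (fun z => D X z (Z z)) y := by
  have h := hD.contMDiff (σ := X) (by
    rw [show (∞ : ℕ∞ω) + 1 = ∞ from rfl]; exact ContMDiff.contMDiffOn hX)
  exact ContMDiffAt.clm_bundle_apply (b := fun z : M => z)
    ((h y (mem_univ y)).contMDiffAt univ_mem) hZ

theorem contDiffAt_gam [T2Space M] (hD : ContMDiffCovariantDerivativeOn (Model n) ∞ D.toFun univ)
    (hφ : φ ∈ IsManifold.maximalAtlas (𝓡 n) ∞ M) {p : Model n} (hp : p ∈ φ.target) :
    ContDiffAt ℝ ∞ (gam D φ) p := by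
  refine contDiffAt_clm_of_apply fun v => contDiffAt_clm_of_apply fun w => ?_
  have hy := φ.map_target hp
  obtain ⟨X, hX, hXe⟩ := exists_smoothVF_cfield hφ hy w
  have h := contDiffAt_rep hφ infty_add_one_le hy
    (vfAt_conn hD hX (vfAt_cfield hφ infty_add_one_le hy (V := fun _ => v) contDiffAt_const))
  rw [φ.right_inv hp] at h
  refine h.congr_of_eventuallyEq ?_
  have h2 := eventually_symm hy (hXe.eventually_nhds)
  rw [φ.right_inv hp] at h2
  filter_upwards [h2] with q hq
  have e := gam_eq D hφ (φ.map_target hq.1) v w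
  rw [φ.right_inv hq.1] at e
  rw [e, rep, ← conn_congr D (k := ∞) (by simp) (hX _) hq.2]
  simp only [cfield]

/-- Coordinate fields are pullbacks of constant fields, so they commute, and vanishing torsion then
says ∇_v ∂_w = ∇_w ∂_v. -/
theorem gam_symm (hD : D.torsion = 0)
    (hφ : φ ∈ IsManifold.maximalAtlas (𝓡 n) ∞ M) {p : Model n} (hp : p ∈ φ.target)
    (v w : Model n) : gam D φ p v w = gam D φ p w v := by
  have hy := φ.map_target hp
  have h := fun u : Model n => (vfAt_cfield hφ (k := ∞) infty_add_one_le hy (V := fun _ => u)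
    contDiffAt_const).mdifferentiableAt (by simp)
  have ht := (D.torsion_eq_zero_iff.1 hD) (h v) (h w)
  have hb : VectorField.mlieBracket (𝓡 n) (cfield φ fun _ => v) (cfield φ fun _ => w)
      (φ.symm p) = 0 := by
    have hc : ∀ u : Model n, MDifferentiableAt (𝓡 n) ((𝓡 n).prod 𝓘(ℝ, Model n))
        (fun x => TotalSpace.mk' (Model n) (E := (TangentSpace (𝓡 n) : Model n → Type _)) x u)
        (φ (φ.symm p)) := fun u =>
      ContMDiffAt.mdifferentiableAt (n := ∞)
        (contMDiffAt_vectorSpace_iff_contDiffAt.2 contDiffAt_const) (by simp)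
    have : IsManifold (𝓡 n) (minSmoothness ℝ 2) M := by
      rw [minSmoothness_of_isRCLikeNormedField]
      exact IsManifold.of_le (n := ∞) (by norm_cast)
    have e := VectorField.mpullback_mlieBracket (I := 𝓡 n) (I' := 𝓡 n) (f := φ) (n := ∞)
      (hc v) (hc w) (chart_contMDiffAt hφ hy) (by
        rw [minSmoothness_of_isRCLikeNormedField]; norm_cast)
    refine e.symm.trans ?_
    rw [VectorField.mpullback_apply]
    have e2 : VectorField.mlieBracket (𝓡 n) (fun _ : Model n => v) (fun _ : Model n => w)
        (φ (φ.symm p)) = 0 := by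
      refine (congrFun (VectorField.mlieBracketWithin_eq_lieBracketWithin (𝕜 := ℝ)
        (V := fun _ : Model n => v) (W := fun _ : Model n => w) (s := univ)) _).trans ?_
      simp [VectorField.lieBracketWithin]
      rfl
    exact (congrArg _ e2).trans (map_zero _)
  rw [hb] at ht
  have e1 := gam_eq D hφ hy v w
  have e2 := gam_eq D hφ hy w v
  rw [φ.right_inv hp] at e1 e2
  rw [e1, e2, ← sub_eq_zero, ← map_sub]
  exact (congrArg _ ht).trans (map_zero _)

end Connection

/-! ### Curvature tensors in coordinates -/

section LocalTensors

open Filter Topology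

variable {n : ℕ}

instance : NormedAddCommGroup (Model n →L[ℝ] ℝ) := inferInstance
instance : NormedSpace ℝ (Model n →L[ℝ] ℝ) := inferInstance
instance : NormedAddCommGroup (Model n →L[ℝ] Model n) := inferInstance
instance : NormedSpace ℝ (Model n →L[ℝ] Model n) := inferInstance
instance : NormedAddCommGroup (Model n →L[ℝ] Model n →L[ℝ] ℝ) := inferInstance
instance : NormedSpace ℝ (Model n →L[ℝ] Model n →L[ℝ] ℝ) := inferInstance
instance : NormedAddCommGroup (Model n →L[ℝ] Model n →L[ℝ] Model n) := inferInstance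
instance : NormedSpace ℝ (Model n →L[ℝ] Model n →L[ℝ] Model n) := inferInstance
instance : NormedAddCommGroup (Model n →L[ℝ] Model n →L[ℝ] Model n →L[ℝ] Model n) :=
  ContinuousLinearMap.toNormedAddCommGroup
instance : NormedSpace ℝ (Model n →L[ℝ] Model n →L[ℝ] Model n →L[ℝ] Model n) :=
  ContinuousLinearMap.toNormedSpace

/-- The standard basis of the model space. -/
abbrev bs (i : Fin n) : Model n := EuclideanSpace.basisFun (Fin n) ℝ i

/-- The standard coordinates on the model space. -/
abbrev pr (i : Fin n) : Model n →L[ℝ] ℝ := EuclideanSpace.proj i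

theorem pr_bs (i j : Fin n) : pr i (bs j) = if i = j then 1 else 0 := by
  simp [pr, bs]

theorem sum_pr_smul (w : Model n) : ∑ j, pr j w • bs j = w := sum_coord_smul w

theorem sum_apply_bs (α : Model n →L[ℝ] ℝ) : ∑ j, α (bs j) • pr j = α := by
  ext1 w
  conv_rhs => rw [← sum_pr_smul w, map_sum]
  simp [mul_comm]

/-- Families of bilinear maps in coordinates. -/
abbrev Christoffel (n : ℕ) : Type := Model n → Model n →L[ℝ] Model n →L[ℝ] Model n

/-- The curvature of the connection on the model space with Christoffel symbols `Γ`. -/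
def lcurv (Γ : Christoffel n) (p : Model n) :
    Model n →L[ℝ] Model n →L[ℝ] Model n →L[ℝ] Model n :=
  fderiv ℝ Γ p - (fderiv ℝ Γ p).flip
    + (ContinuousLinearMap.compL ℝ (Model n) (Model n) (Model n)).bilinearComp (Γ p) (Γ p)
    - ((ContinuousLinearMap.compL ℝ (Model n) (Model n) (Model n)).bilinearComp (Γ p) (Γ p)).flip

theorem lcurv_apply (Γ : Christoffel n) (p u v w : Model n) : lcurv Γ p u v w =
    fderiv ℝ Γ p u v w - fderiv ℝ Γ p v u w + Γ p u (Γ p v w) - Γ p v (Γ p u w) := by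
  simp [lcurv]

/-- The Ricci tensor in coordinates. -/
def lric (Γ : Christoffel n) (p : Model n) : Model n →L[ℝ] Model n →L[ℝ] ℝ :=
  ∑ i, (ContinuousLinearMap.compL ℝ (Model n) (Model n) ℝ (pr i)) ∘L lcurv Γ p (bs i)

theorem lric_apply (Γ : Christoffel n) (p v w : Model n) :
    lric Γ p v w = ∑ i, pr i (lcurv Γ p (bs i) v w) := by
  simp [lric]

/-- The Schouten tensor in coordinates. -/
def lsch (Γ : Christoffel n) (p : Model n) : Model n →L[ℝ] Model n →L[ℝ] ℝ :=
  ((n : ℝ) - 1)⁻¹ • lric Γ p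

theorem lsch_apply (Γ : Christoffel n) (p v w : Model n) :
    lsch Γ p v w = lric Γ p v w / ((n : ℝ) - 1) := by
  simp [lsch, div_eq_inv_mul]

/-- The Weyl curvature in coordinates. -/
def lweyl (Γ : Christoffel n) (p u v w : Model n) : Model n :=
  lcurv Γ p u v w - lsch Γ p v w • u + lsch Γ p u w • v

/-- The covariant derivative of the Schouten tensor in coordinates. -/
def lnablaSch (Γ : Christoffel n) (p u v w : Model n) : ℝ :=
  fderiv ℝ (lsch Γ) p u v w - lsch Γ p (Γ p u v) w - lsch Γ p v (Γ p u w)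

/-- The Cotton–York tensor in coordinates. -/
def lcotton (Γ : Christoffel n) (p u v w : Model n) : ℝ :=
  (lnablaSch Γ p u v w - lnablaSch Γ p v u w) / 2

theorem contDiffAt_fderiv {E F : Type*} [NormedAddCommGroup E] [NormedSpace ℝ E]
    [NormedAddCommGroup F] [NormedSpace ℝ F] {f : E → F} {p : E} (h : ContDiffAt ℝ ∞ f p) :
    ContDiffAt ℝ ∞ (fderiv ℝ f) p :=
  h.fderiv_right (m := ∞) infty_add_one_le

theorem contDiffAt_lcurv {Γ : Christoffel n} {p : Model n} (h : ContDiffAt ℝ ∞ Γ p) :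
    ContDiffAt ℝ ∞ (lcurv Γ) p := by
  refine contDiffAt_clm_of_apply fun u => contDiffAt_clm_of_apply fun v =>
    contDiffAt_clm_of_apply fun w => ?_
  simp only [lcurv_apply]
  have h' := contDiffAt_fderiv h
  have c := fun u : Model n => contDiffAt_const (𝕜 := ℝ) (n := ∞) (x := p) (c := u)
  have g := fun u v => (h.clm_apply (c u)).clm_apply (c v)
  have g' := fun u v w => ((h'.clm_apply (c u)).clm_apply (c v)).clm_apply (c w)
  exact (((g' u v w).sub (g' v u w)).add ((h.clm_apply (c u)).clm_apply (g v w))).sub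
    ((h.clm_apply (c v)).clm_apply (g u w))

theorem contDiffAt_lsch {Γ : Christoffel n} {p : Model n} (h : ContDiffAt ℝ ∞ Γ p) :
    ContDiffAt ℝ ∞ (lsch Γ) p := by
  refine contDiffAt_clm_of_apply fun v => contDiffAt_clm_of_apply fun w => ?_
  simp only [lsch_apply, lric_apply]
  have h' := contDiffAt_lcurv h
  have c := fun u : Model n => contDiffAt_const (𝕜 := ℝ) (n := ∞) (x := p) (c := u)
  refine ContDiffAt.div_const (ContDiffAt.sum fun i _ => ?_) _
  exact (pr i).contDiff.contDiffAt.comp p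
    (((h'.clm_apply (c (bs i))).clm_apply (c v)).clm_apply (c w))

end LocalTensors

/-! ### Curvature of the manifold in a chart -/

section CurvatureTransfer

open Filter Topology

variable {n : ℕ} {M : Type*} [TopologicalSpace M] [ChartedSpace (Model n) M]
  [IsManifold (𝓡 n) ∞ M] {φ : OpenPartialHomeomorph M (Model n)} {D : Connection n M}

theorem sum_eDual_smul_e {y : M} (v : Tangent n y) : ∑ j, eDual y j v • e y j = v :=
  sum_coord_smul (n := n) v

/-- The canonical element of T*⊗T does not depend on the basis. The basis `e` has no relation to the
chart φ, so every contraction taken in it has to be moved to the frame of φ. -/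
theorem sum_eDual_e {G : Type*} [AddCommGroup G] [Module ℝ G]
    (hφ : φ ∈ IsManifold.maximalAtlas (𝓡 n) ∞ M) {y : M} (hy : y ∈ φ.source)
    (f : Cotangent n y →ₗ[ℝ] Tangent n y →ₗ[ℝ] G) :
    ∑ j, f (eDual y j) (e y j) = ∑ j, f (pr j ∘L tm φ y) (ti φ y (bs j)) := by
  have h1 : ∀ j, f (pr j ∘L tm φ y) = ∑ k, pr j (tm φ y (e y k)) • f (eDual y k) := by
    intro j
    have : (pr j ∘L tm φ y : Cotangent n y) = ∑ k, pr j (tm φ y (e y k)) • eDual y k := by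
      ext1 v
      refine (congrArg (fun v => pr j (tm φ y v)) (sum_eDual_smul_e v)).symm.trans ?_
      simp only [map_sum, map_smul, sum_apply, smul_apply, smul_eq_mul]
      exact Finset.sum_congr rfl fun k _ => mul_comm _ _
    rw [this, map_sum]
    simp only [map_smul]
  have h2 : ∀ k, ∑ j, pr j (tm φ y (e y k)) • ti φ y (bs j) = e y k := by
    intro k
    simp only [← map_smul, ← map_sum]
    rw [sum_pr_smul, ti_tm hφ hy]
  simp only [h1, LinearMap.sum_apply, LinearMap.smul_apply]
  rw [Finset.sum_comm]
  refine Finset.sum_congr rfl fun k _ => ?_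
  conv_lhs => rw [← h2 k]
  simp only [map_sum, map_smul]

theorem vfAt_extend {y : M} (v : Tangent n y) (k : ℕ∞ω) :
    VFAt k (FiberBundle.extend (Model n) v) y :=
  FiberBundle.contMDiffAt_extend (𝓡 n) (Model n) v

variable [T2Space M]

/-- Iterated covariant derivatives need the coordinate formula on a neighbourhood and not only at y,
since it gets differentiated again; smoothness at y alone gives C¹ near y, which suffices for the
formula. -/
theorem conn_along (hD : IsSpecial D) (hφ : φ ∈ IsManifold.maximalAtlas (𝓡 n) ∞ M) {y : M}
    (hy : y ∈ φ.source) {X Z : Π x : M, Tangent n x} (hX : VFAt ∞ X y) (hZ : VFAt ∞ Z y) :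
    VFAt ∞ (fun z => D X z (Z z)) y ∧
    ∀ᶠ p in 𝓝 (φ y), rep φ (fun z => D X z (Z z)) p =
      fderiv ℝ (rep φ X) p (rep φ Z p) + gam D φ p (rep φ Z p) (rep φ X p) := by
  have hX' := contDiffAt_rep hφ infty_add_one_le hy hX
  have hZ' := contDiffAt_rep hφ infty_add_one_le hy hZ
  have hΓ := contDiffAt_gam hD.smooth hφ (φ.map_source hy)
  have h1 : ∀ᶠ z in 𝓝 y, VFAt 1 X z := by
    have : VFAt 1 X y := ContMDiffAt.of_le hX (by simp)
    exact (contMDiffAt_iff_contMDiffAt_nhds (by simp)).1 this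
  have h2 : ∀ᶠ p in 𝓝 (φ y), rep φ (fun z => D X z (Z z)) p =
      fderiv ℝ (rep φ X) p (rep φ Z p) + gam D φ p (rep φ Z p) (rep φ X p) := by
    filter_upwards [eventually_symm hy h1] with p hp
    have := tm_conn D hφ (φ.map_target hp.1) (k := 1) (by simp) (by norm_cast) hp.2
      (Z (φ.symm p))
    rw [φ.right_inv hp.1] at this
    exact this
  refine ⟨?_, h2⟩
  have h3 := vfAt_cfield hφ infty_add_one_le hy (((contDiffAt_fderiv hX').clm_apply hZ').add
    ((hΓ.clm_apply hZ').clm_apply hX'))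
  refine ContMDiffAt.congr_of_eventuallyEq h3 ?_
  filter_upwards [eventually_source hy, eventually_chart hy h2] with z hz hz2
  rw [← cfield_rep hφ hz (fun z => D X z (Z z)), cfield, hz2]
  rfl

/-- The bracket is rewritten as ∇_U V - ∇_V U. The derivatives of U and V then cancel, the second
derivatives of W cancel by symmetry, and the first derivatives of W cancel in the commutator. -/
theorem tm_curv (hD : IsSpecial D) (hφ : φ ∈ IsManifold.maximalAtlas (𝓡 n) ∞ M) {y : M}
    (hy : y ∈ φ.source) (u v w : Tangent n y) : tm φ y (curv D y u v w) =
      lcurv (gam D φ) (φ y) (tm φ y u) (tm φ y v) (tm φ y w) := by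
  set U := FiberBundle.extend (Model n) u with hU
  set V := FiberBundle.extend (Model n) v with hV
  set W := FiberBundle.extend (Model n) w with hW
  have sU : VFAt ∞ U y := vfAt_extend u ∞
  have sV : VFAt ∞ V y := vfAt_extend v ∞
  have sW : VFAt ∞ W y := vfAt_extend w ∞
  have eU : U y = u := FiberBundle.extend_apply_self (Model n) u
  have eV : V y = v := FiberBundle.extend_apply_self (Model n) v
  have eW : W y = w := FiberBundle.extend_apply_self (Model n) w
  have hb := D.torsion_eq_zero_iff.1 hD.torsion_free (sU.mdifferentiableAt (by simp))
    (sV.mdifferentiableAt (by simp))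
  have hc : curv D y u v w = D (fun z => D W z (V z)) y u - D (fun z => D W z (U z)) y v
      - D W y (VectorField.mlieBracket (𝓡 n) U V y) := rfl
  rw [hc, ← hb]
  have rU := contDiffAt_rep hφ infty_add_one_le hy sU
  have rV := contDiffAt_rep hφ infty_add_one_le hy sV
  have rW := contDiffAt_rep hφ infty_add_one_le hy sW
  have hΓ := contDiffAt_gam hD.smooth hφ (φ.map_source hy)
  have hs : IsSymmSndFDerivAt ℝ (rep φ W) (φ y) := rW.isSymmSndFDerivAt (by simp; norm_cast)
  have T := fun {X : Π x : M, Tangent n x} (h : VFAt ∞ X y) =>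
    tm_conn D hφ hy (k := ∞) (by simp) infty_add_one_le h
  have main : ∀ {Z : Π x : M, Tangent n x} (_ : VFAt ∞ Z y) (a : Tangent n y),
      tm φ y (D (fun z => D W z (Z z)) y a) =
      fderiv ℝ (fderiv ℝ (rep φ W)) (φ y) (tm φ y a) (tm φ y (Z y))
      + fderiv ℝ (rep φ W) (φ y) (fderiv ℝ (rep φ Z) (φ y) (tm φ y a))
      + (fderiv ℝ (gam D φ) (φ y) (tm φ y a) (tm φ y (Z y)) (tm φ y (W y))
      + gam D φ (φ y) (fderiv ℝ (rep φ Z) (φ y) (tm φ y a)) (tm φ y (W y))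
      + gam D φ (φ y) (tm φ y (Z y)) (fderiv ℝ (rep φ W) (φ y) (tm φ y a)))
      + gam D φ (φ y) (tm φ y a) (fderiv ℝ (rep φ W) (φ y) (tm φ y (Z y))
        + gam D φ (φ y) (tm φ y (Z y)) (tm φ y (W y))) := by
    intro Z sZ a
    have rZ := contDiffAt_rep hφ infty_add_one_le hy sZ
    obtain ⟨h1, h2⟩ := conn_along hD hφ hy sW sZ
    rw [T h1, h2.self_of_nhds, Filter.EventuallyEq.fderiv_eq h2]
    have dW := (contDiffAt_fderiv rW).differentiableAt (by simp)
    have dZ := rZ.differentiableAt (by simp)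
    have dW0 := rW.differentiableAt (by simp)
    have dΓ := hΓ.differentiableAt (by simp)
    have e1 := (dW.hasFDerivAt.clm_apply dZ.hasFDerivAt).add
      ((dΓ.hasFDerivAt.clm_apply dZ.hasFDerivAt).clm_apply dW0.hasFDerivAt)
    have e2 := e1.fderiv
    have e3 := congrArg (fun L => L (tm φ y a)) e2
    simp only [add_apply, ContinuousLinearMap.coe_comp, Function.comp,
      ContinuousLinearMap.flip_apply] at e3
    rw [rep_apply hy, rep_apply hy] at e3 ⊢
    congr 1
    refine Eq.trans e3 ?_
    abel
  rw [map_sub, map_sub, main sV u, main sU v, T sW, map_sub, T sV, T sU, rep_apply hy,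
    rep_apply hy, rep_apply hy, eU, eV, eW, hs.eq (tm φ y u) (tm φ y v),
    gam_symm hD.torsion_free hφ (φ.map_source hy) (tm φ y u) (tm φ y v), lcurv_apply]
  simp only [map_add, map_sub, sub_apply, add_apply]
  abel

end CurvatureTransfer

/-! ### Schouten, Weyl and Cotton–York tensors in a chart -/

section TensorTransfer

open Filter Topology

variable {n : ℕ} {M : Type*} [TopologicalSpace M] [ChartedSpace (Model n) M]
  [IsManifold (𝓡 n) ∞ M] {φ : OpenPartialHomeomorph M (Model n)} {D : Connection n M}
  [T2Space M]

theorem curv_eq (hD : IsSpecial D) (hφ : φ ∈ IsManifold.maximalAtlas (𝓡 n) ∞ M) {y : M}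
    (hy : y ∈ φ.source) (u v w : Tangent n y) : curv D y u v w =
      ti φ y (lcurv (gam D φ) (φ y) (tm φ y u) (tm φ y v) (tm φ y w)) := by
  rw [← tm_curv hD hφ hy, ti_tm hφ hy]

theorem ric_eq (hD : IsSpecial D) (hφ : φ ∈ IsManifold.maximalAtlas (𝓡 n) ∞ M) {y : M}
    (hy : y ∈ φ.source) (v w : Tangent n y) :
    ric D y v w = lric (gam D φ) (φ y) (tm φ y v) (tm φ y w) := by
  let f : Cotangent n y →ₗ[ℝ] Tangent n y →ₗ[ℝ] ℝ := LinearMap.mk₂ ℝ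
    (fun α u => α (ti φ y (lcurv (gam D φ) (φ y) (tm φ y u) (tm φ y v) (tm φ y w))))
    (fun _ _ _ => rfl) (fun _ _ _ => rfl) (fun _ _ _ => by simp only [map_add, add_apply])
    (fun _ _ _ => by simp only [map_smul, smul_apply])
  have h := sum_eDual_e hφ hy f
  simp only [ric, curv_eq hD hφ hy]
  refine h.trans ?_
  rw [lric_apply]
  refine Finset.sum_congr rfl fun j _ => ?_
  change pr j (tm φ y (ti φ y (lcurv (gam D φ) (φ y) (tm φ y (ti φ y (bs j))) _ _))) = _
  rw [tm_ti hφ hy, tm_ti hφ hy]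

theorem schouten_eq (hD : IsSpecial D) (hφ : φ ∈ IsManifold.maximalAtlas (𝓡 n) ∞ M) {y : M}
    (hy : y ∈ φ.source) (v w : Tangent n y) :
    schouten D y v w = lsch (gam D φ) (φ y) (tm φ y v) (tm φ y w) := by
  rw [schouten, ric_eq hD hφ hy, lsch_apply]

theorem tm_weyl (hD : IsSpecial D) (hφ : φ ∈ IsManifold.maximalAtlas (𝓡 n) ∞ M) {y : M}
    (hy : y ∈ φ.source) (u v w : Tangent n y) : tm φ y (weyl D y u v w) =
      lweyl (gam D φ) (φ y) (tm φ y u) (tm φ y v) (tm φ y w) := by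
  rw [weyl, map_add, map_sub, map_smul, map_smul, tm_curv hD hφ hy, schouten_eq hD hφ hy,
    schouten_eq hD hφ hy, lweyl]

theorem nablaSchouten_eq (hD : IsSpecial D) (hφ : φ ∈ IsManifold.maximalAtlas (𝓡 n) ∞ M) {y : M}
    (hy : y ∈ φ.source) (u v w : Tangent n y) : nablaSchouten D y u v w =
      lnablaSch (gam D φ) (φ y) (tm φ y u) (tm φ y v) (tm φ y w) := by
  set V := FiberBundle.extend (Model n) v with hV
  set W := FiberBundle.extend (Model n) w with hW
  have sV : VFAt ∞ V y := vfAt_extend v ∞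
  have sW : VFAt ∞ W y := vfAt_extend w ∞
  have eV : V y = v := FiberBundle.extend_apply_self (Model n) v
  have eW : W y = w := FiberBundle.extend_apply_self (Model n) w
  have hc : nablaSchouten D y u v w = mvfderiv (𝓡 n) (fun z => schouten D z (V z) (W z)) y u
      - schouten D y (D V y u) w - schouten D y v (D W y u) := rfl
  have rV := (contDiffAt_rep hφ infty_add_one_le hy sV).differentiableAt (by simp)
  have rW := (contDiffAt_rep hφ infty_add_one_le hy sW).differentiableAt (by simp)
  have rP := (contDiffAt_lsch (contDiffAt_gam hD.smooth hφ (φ.map_source hy))).differentiableAt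
    (by simp)
  have T := fun {X : Π x : M, Tangent n x} (h : VFAt ∞ X y) =>
    tm_conn D hφ hy (k := ∞) (by simp) infty_add_one_le h
  have h1 := mvfderiv_eq_fderiv hφ hy (g := fun z => schouten D z (V z) (W z))
    (h := fun p => lsch (gam D φ) p (rep φ V p) (rep φ W p))
    ((rP.clm_apply rV).clm_apply rW) (by
      filter_upwards [eventually_source hy] with z hz
      rw [schouten_eq hD hφ hz, rep_apply hz, rep_apply hz]) u
  have e := ((rP.hasFDerivAt.clm_apply rV.hasFDerivAt).clm_apply rW.hasFDerivAt).fderiv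
  have e' := congrArg (fun L => L (tm φ y u)) e
  simp only [add_apply, ContinuousLinearMap.coe_comp, Function.comp,
    ContinuousLinearMap.flip_apply] at e'
  rw [hc, h1, schouten_eq hD hφ hy, schouten_eq hD hφ hy, T sV, T sW, lnablaSch]
  rw [rep_apply hy, rep_apply hy, eV, eW] at e' ⊢
  simp only [map_add, add_apply]
  refine (congrArg (fun t => t - _ - _) e').trans ?_
  ring

theorem cotton_eq (hD : IsSpecial D) (hφ : φ ∈ IsManifold.maximalAtlas (𝓡 n) ∞ M) {y : M}
    (hy : y ∈ φ.source) (u v w : Tangent n y) : cotton D y u v w =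
      lcotton (gam D φ) (φ y) (tm φ y u) (tm φ y v) (tm φ y w) := by
  rw [cotton, lcotton, nablaSchouten_eq hD hφ hy, nablaSchouten_eq hD hφ hy]

end TensorTransfer

/-! ### Parallel volume forms and the trace of the curvature -/

section Volume

open Filter Topology

variable {n : ℕ}

/-- The trace of an endomorphism of the model space. -/
def ltr (A : Model n →L[ℝ] Model n) : ℝ := ∑ i, pr i (A (bs i))

theorem ltr_comp_comm (A B : Model n →L[ℝ] Model n) : ltr (A ∘L B) = ltr (B ∘L A) := by
  have h : ∀ A B : Model n →L[ℝ] Model n,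
      ltr (A ∘L B) = ∑ i, ∑ k, pr k (B (bs i)) * pr i (A (bs k)) := by
    intro A B
    refine Finset.sum_congr rfl fun i _ => ?_
    rw [ContinuousLinearMap.comp_apply]
    conv_lhs => rw [← sum_pr_smul (B (bs i))]
    simp only [map_sum, map_smul, smul_eq_mul]
  rw [h, h, Finset.sum_comm]
  exact Finset.sum_congr rfl fun i _ => Finset.sum_congr rfl fun k _ => mul_comm _ _

/-- Christoffel symbols, on an open set, of a torsion-free connection that locally preserves a
volume form. -/
structure LSpecial (U : Set (Model n)) (Γ : Christoffel n) : Prop where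
  isOpen : IsOpen U
  smooth : ∀ p ∈ U, ContDiffAt ℝ ∞ Γ p
  symm : ∀ p ∈ U, ∀ v w, Γ p v w = Γ p w v
  trace : ∀ p ∈ U, ∀ u v, ltr (lcurv Γ p u v) = 0

/-- The hypothesis says tr Γ = d log |f|, so tr Γ is closed. The trace of the curvature is its
exterior derivative, as commutators have no trace. -/
theorem ltr_lcurv_eq_zero {U : Set (Model n)} (hU : IsOpen U) {Γ : Christoffel n}
    (hΓ : ∀ p ∈ U, ContDiffAt ℝ ∞ Γ p) {f : Model n → ℝ} (hf : ∀ p ∈ U, ContDiffAt ℝ ∞ f p)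
    (h0 : ∀ p ∈ U, f p ≠ 0) (hpar : ∀ p ∈ U, ∀ v, fderiv ℝ f p v = ltr (Γ p v) * f p)
    {p : Model n} (hp : p ∈ U) (u v : Model n) : ltr (lcurv Γ p u v) = 0 := by
  have dΓ := (hΓ p hp).differentiableAt (by simp)
  have dtr : ∀ v, HasFDerivAt (fun q => ltr (Γ q v))
      (∑ i, pr i ∘L ((fderiv ℝ Γ p).flip v).flip (bs i)) p := by
    intro v
    refine HasFDerivAt.fun_sum fun i _ => ?_
    have e := (dΓ.hasFDerivAt.clm_apply (hasFDerivAt_const v p)).clm_apply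
      (hasFDerivAt_const (bs i) p)
    refine ((pr i).hasFDerivAt.comp p e).congr_fderiv ?_
    ext1 w
    simp
  have hs := (hf p hp).isSymmSndFDerivAt (by simp; norm_cast)
  have key : ∀ u v, fderiv ℝ (fderiv ℝ f) p u v =
      (∑ i, pr i (fderiv ℝ Γ p u v (bs i))) * f p + ltr (Γ p v) * (ltr (Γ p u) * f p) := by
    intro u v
    have e1 : (fun q => fderiv ℝ f q v) =ᶠ[𝓝 p] fun q => ltr (Γ q v) * f q := by
      filter_upwards [hU.mem_nhds hp] with q hq using hpar q hq v
    have e2 := ((contDiffAt_fderiv (hf p hp)).differentiableAt (by simp)).hasFDerivAt.clm_apply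
      (hasFDerivAt_const v p)
    have e3 := (dtr v).mul ((hf p hp).differentiableAt (by simp)).hasFDerivAt
    have e4 := (e2.fderiv.symm.trans e1.fderiv_eq).trans e3.fderiv
    have e5 := congrArg (fun L => L u) e4
    simp [hpar p hp] at e5
    rw [e5]
    simp
    ring
  have h := key u v
  rw [hs.eq u v, key v u] at h
  have h2 : (∑ i, pr i (fderiv ℝ Γ p v u (bs i))) = ∑ i, pr i (fderiv ℝ Γ p u v (bs i)) := by
    have h3 : ((∑ i, pr i (fderiv ℝ Γ p v u (bs i))) - ∑ i, pr i (fderiv ℝ Γ p u v (bs i)))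
        * f p = 0 := by linear_combination h
    exact sub_eq_zero.1 ((mul_eq_zero.1 h3).resolve_right (h0 p hp))
  have h4 := ltr_comp_comm (Γ p u) (Γ p v)
  simp only [ltr, ContinuousLinearMap.comp_apply] at h4
  simp only [ltr, lcurv_apply, map_add, map_sub, Finset.sum_add_distrib, Finset.sum_sub_distrib]
  rw [h2, h4]
  ring

variable {M : Type*} [TopologicalSpace M] [ChartedSpace (Model n) M]
  [IsManifold (𝓡 n) ∞ M] {φ : OpenPartialHomeomorph M (Model n)} {D : Connection n M}
  [T2Space M]

/-- The function f is the value of the parallel volume form on the coordinate frame; parallelism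
becomes df = (tr Γ) f, and f has no zeros since the frame is a basis. -/
theorem lspecial_gam (hD : IsSpecial D) (hφ : φ ∈ IsManifold.maximalAtlas (𝓡 n) ∞ M) :
    LSpecial φ.target (gam D φ) := by
  refine ⟨φ.open_target, fun p hp => contDiffAt_gam hD.smooth hφ hp,
    fun p hp => gam_symm hD.torsion_free hφ hp, fun p hp u v => ?_⟩
  obtain ⟨ε, hε⟩ := hD.volume
  let C : Fin n → Π z : M, Tangent n z := fun i => cfield φ fun _ => bs i
  let f : Model n → ℝ := fun p => ε (φ.symm p) fun i => C i (φ.symm p)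
  have hX : ∀ p ∈ φ.target, ∃ X : Fin n → Π z : M, Tangent n z, (∀ i, SmoothVF (X i)) ∧
      ∀ᶠ z in 𝓝 (φ.symm p), ∀ i, X i z = C i z := by
    intro p hp
    choose X hX hXe using fun i => exists_smoothVF_cfield hφ (φ.map_target hp) (bs (n := n) i)
    exact ⟨X, hX, eventually_all.2 hXe⟩
  have hfe : ∀ p ∈ φ.target, ∀ X : Fin n → Π z : M, Tangent n z,
      (∀ᶠ z in 𝓝 (φ.symm p), ∀ i, X i z = C i z) →
      f =ᶠ[𝓝 p] (fun z => ε z fun i => X i z) ∘ φ.symm := by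
    intro p hp X h
    have h2 := eventually_symm (φ.map_target hp) h
    rw [φ.right_inv hp] at h2
    filter_upwards [h2] with q hq
    simp only [f, Function.comp, hq.2]
  have hf : ∀ p ∈ φ.target, ContDiffAt ℝ ∞ f p := by
    intro p hp
    obtain ⟨X, hX, hXe⟩ := hX p hp
    refine ContDiffAt.congr_of_eventuallyEq ?_ (hfe p hp X hXe)
    exact ((hε.smooth X hX).contMDiffAt.comp p (chart_symm_contMDiffAt hφ hp)).contDiffAt
  refine ltr_lcurv_eq_zero φ.open_target (fun p hp => contDiffAt_gam hD.smooth hφ hp) hf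
    ?_ ?_ hp u v
  · intro p hp h0
    have hy := φ.map_target hp
    let L : Model n ≃L[ℝ] Tangent n (φ.symm p) := ((chart_mdifferentiable hφ).mfderiv hy).symm
    let b := (EuclideanSpace.basisFun (Fin n) ℝ).toBasis.map L.toLinearEquiv
    refine hε.ne_zero (φ.symm p) ((AlternatingMap.map_basis_eq_zero_iff b _).1 ?_)
    refine (congrArg (ε (φ.symm p)) ?_).trans h0
    funext i
    change L (bs i) = ti φ (φ.symm p) (bs i)
    rw [← ti_tm hφ hy (L (bs i))]
    congr 1
    exact ((chart_mdifferentiable hφ).mfderiv hy).apply_symm_apply (bs i)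
  · intro p hp v
    obtain ⟨X, hX, hXe⟩ := hX p hp
    have hy := φ.map_target hp
    have h1 := hε.parallel X hX (φ.symm p) (ti φ (φ.symm p) v)
    have h2 := mvfderiv_eq_fderiv hφ hy (g := fun z => ε z fun i => X i z) (h := f)
      (by rw [φ.right_inv hp]; exact (hf p hp).differentiableAt (by simp)) (by
        filter_upwards [hXe, eventually_source hy] with z hz hz2
        simp only [f]
        rw [φ.left_inv hz2]
        simp only [hz]) (ti φ (φ.symm p) v)
    rw [h1, tm_ti hφ hy, φ.right_inv hp] at h2
    rw [← h2, ltr, Finset.sum_mul]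
    refine Finset.sum_congr rfl fun i _ => ?_
    have e1 : (fun j => X j (φ.symm p)) = fun j => C j (φ.symm p) := by
      funext j; exact hXe.self_of_nhds j
    have e2 : D (X i) (φ.symm p) (ti φ (φ.symm p) v) =
        ∑ k, pr k (gam D φ p v (bs i)) • C k (φ.symm p) := by
      rw [conn_congr D (k := ∞) (by simp) (hX i _) (hXe.mono fun z hz => hz i)]
      have e3 := gam_eq D hφ hy v (bs i)
      rw [φ.right_inv hp] at e3
      change _ = ∑ k, pr k (gam D φ p v (bs i)) • ti φ (φ.symm p) (bs k)
      simp only [← map_smul, ← map_sum]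
      rw [sum_pr_smul, e3, ti_tm hφ hy]
    -- Only the diagonal coefficient of Γ survives, because any other term repeats a frame vector.
    rw [e1, e2, AlternatingMap.map_update_sum, Finset.sum_eq_single i]
    · rw [AlternatingMap.map_update_smul]
      have : Function.update (fun j => C j (φ.symm p)) i (C i (φ.symm p)) =
        fun j => C j (φ.symm p) := Function.update_eq_self i _
      rw [this]
      rfl
    · intro k _ hk
      rw [AlternatingMap.map_update_smul]
      have := (ε (φ.symm p)).map_update_self (fun j => C j (φ.symm p)) (Ne.symm hk)
      exact (congrArg _ this).trans (smul_zero _)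
    · intro h; exact absurd (Finset.mem_univ i) h

end Volume

/-! ### 1-forms in charts and the dual frames -/

section Forms

open Filter Topology

variable {n : ℕ} {M : Type*} [TopologicalSpace M] [ChartedSpace (Model n) M]
  [IsManifold (𝓡 n) ∞ M] {φ : OpenPartialHomeomorph M (Model n)}

/-- The components of a 1-form in a chart. -/
def frep (φ : OpenPartialHomeomorph M (Model n)) (α : Π x : M, Cotangent n x) (p : Model n) :
    Model n →L[ℝ] ℝ := α (φ.symm p) ∘L ti φ (φ.symm p)

/-- The 1-form with given components in a chart. -/
def cform (φ : OpenPartialHomeomorph M (Model n)) (a : Model n → Model n →L[ℝ] ℝ) (y : M) :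
    Cotangent n y := a (φ y) ∘L tm φ y

theorem contMDiffAt_form_apply {α : Π x : M, Cotangent n x} {X : Π x : M, Tangent n x} {y : M}
    (hα : SmoothFormAt α y) (hX : VFAt ∞ X y) :
    ContMDiffAt (𝓡 n) 𝓘(ℝ, ℝ) ∞ (fun z => α z (X z)) y := by
  have h := ContMDiffAt.clm_bundle_apply (E₂ := fun _ : M => ℝ) (b := fun z : M => z) hα hX
  exact (contMDiffAt_section y).1 h

theorem contDiffAt_of_contMDiffAt (hφ : φ ∈ IsManifold.maximalAtlas (𝓡 n) ∞ M) {y : M}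
    (hy : y ∈ φ.source) {g : M → ℝ} (hg : ContMDiffAt (𝓡 n) 𝓘(ℝ, ℝ) ∞ g y) :
    ContDiffAt ℝ ∞ (g ∘ φ.symm) (φ y) := by
  rw [← φ.left_inv hy] at hg
  exact (hg.comp (φ y) (chart_symm_contMDiffAt hφ (φ.map_source hy))).contDiffAt

theorem contMDiffAt_of_contDiffAt (hφ : φ ∈ IsManifold.maximalAtlas (𝓡 n) ∞ M) {y : M}
    (hy : y ∈ φ.source) {g : M → ℝ} {h : Model n → ℝ} (hh : ContDiffAt ℝ ∞ h (φ y))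
    (hg : ∀ᶠ z in 𝓝 y, g z = h (φ z)) : ContMDiffAt (𝓡 n) 𝓘(ℝ, ℝ) ∞ g y :=
  (hh.contMDiffAt.comp y (chart_contMDiffAt hφ hy)).congr_of_eventuallyEq hg

theorem contDiffAt_frep (hφ : φ ∈ IsManifold.maximalAtlas (𝓡 n) ∞ M) {y : M}
    (hy : y ∈ φ.source) {α : Π x : M, Cotangent n x} (hα : SmoothFormAt α y) :
    ContDiffAt ℝ ∞ (frep φ α) (φ y) := by
  refine contDiffAt_clm_of_apply fun w => ?_
  have h := contDiffAt_of_contMDiffAt hφ hy (contMDiffAt_form_apply hα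
    (vfAt_cfield hφ infty_add_one_le hy (V := fun _ => w) contDiffAt_const))
  exact h

theorem symm_eq_extend {y z : M} (w : Model n) :
    (trivializationAt (Model n) (TangentSpace (𝓡 n) : M → Type _) y).symm z w =
      FiberBundle.extend (Model n) (E := (TangentSpace (𝓡 n) : M → Type _)) (x := y)
        ((trivializationAt (Model n) (TangentSpace (𝓡 n) : M → Type _) y).symm y w) z := by
  rw [FiberBundle.extend]
  congr 1
  rw [Trivialization.apply_mk_symm _ (FiberBundle.mem_baseSet_trivializationAt' y)]

theorem inCoordinates_form (y z : M) (α : Cotangent n z) :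
    ContinuousLinearMap.inCoordinates (Model n) (TangentSpace (𝓡 n) : M → Type _) ℝ
      (fun _ : M => ℝ) y z y z α =
    α ∘L (trivializationAt (Model n) (TangentSpace (𝓡 n) : M → Type _) y).symmL ℝ z := by
  have h : Trivialization.continuousLinearMapAt ℝ (trivializationAt ℝ (fun _ : M => ℝ) y) z =
    ContinuousLinearMap.id ℝ ℝ := Trivial.continuousLinearMapAt_trivialization ℝ M ℝ z
  rw [ContinuousLinearMap.inCoordinates, h]
  rfl

/-- Smoothness of a section of the cotangent bundle is tested in the trivialisation at y. There the
form is evaluated on the images of constant vectors, which are the fields given by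
`FiberBundle.extend` and so have smooth components in φ. -/
theorem smoothFormAt_cform (hφ : φ ∈ IsManifold.maximalAtlas (𝓡 n) ∞ M) {y : M}
    (hy : y ∈ φ.source) {a : Model n → Model n →L[ℝ] ℝ} (ha : ContDiffAt ℝ ∞ a (φ y)) :
    SmoothFormAt (cform φ a) y := by
  refine (contMDiffAt_hom_bundle _).2 ⟨contMDiffAt_id, ?_⟩
  let t := trivializationAt (Model n) (TangentSpace (𝓡 n) : M → Type _) y
  let G : M → Model n →L[ℝ] ℝ := fun z => cform φ a z ∘L t.symmL ℝ z
  have hG : ContDiffAt ℝ ∞ (G ∘ φ.symm) (φ y) := by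
    refine contDiffAt_clm_of_apply fun w => ?_
    have h1 := contDiffAt_rep hφ infty_add_one_le hy (vfAt_extend (t.symm y w) ∞)
    refine (ha.clm_apply h1).congr_of_eventuallyEq ?_
    have hb : ∀ᶠ z in 𝓝 y, z ∈ t.baseSet :=
      t.open_baseSet.mem_nhds (FiberBundle.mem_baseSet_trivializationAt' y)
    filter_upwards [eventually_symm hy hb] with p hp
    change a (φ (φ.symm p)) (tm φ (φ.symm p) (t.symmL ℝ (φ.symm p) w)) = _
    rw [φ.right_inv hp.1, Trivialization.symmL_apply _ hp.2, rep, ← symm_eq_extend]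
  have h2 := hG.contMDiffAt.comp y (chart_contMDiffAt hφ hy)
  refine h2.congr_of_eventuallyEq ?_
  filter_upwards [eventually_source hy] with z hz
  change _ = G (φ.symm (φ z))
  rw [φ.left_inv hz]
  exact inCoordinates_form y z _

/-- Frame and coframe have constant coordinates in the trivialisations at y, and the trivialisation
of the cotangent bundle is the one induced by that of the tangent bundle, so the pairing is constant
near y. -/
theorem coframe_frame (y : M) (i j : Fin n) :
    ∀ᶠ z in 𝓝 y, coframe y i z (frame y j z) = if i = j then 1 else 0 := by
  let t := trivializationAt (Model n) (TangentSpace (𝓡 n) : M → Type _) y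
  let th := trivializationAt (Model n →L[ℝ] ℝ) (fun z : M => Cotangent n z) y
  have key : ∀ z, z ∈ t.baseSet → z ∈ th.baseSet → coframe y i z (frame y j z) =
      (th ⟨y, eDual y i⟩).2 (t ⟨y, e y j⟩).2 := by
    intro z hz hz'
    have h1 : (th ⟨z, coframe y i z⟩).2 = (th ⟨y, eDual y i⟩).2 := by
      change (th ⟨z, th.symm z _⟩).2 = _
      rw [Trivialization.apply_mk_symm _ hz']
    rw [← h1]
    have h2 := hom_trivializationAt_apply (𝕜₁ := ℝ) (𝕜₂ := ℝ) (σ := RingHom.id ℝ) (F₁ := Model n)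
      (E₁ := (TangentSpace (𝓡 n) : M → Type _)) (F₂ := ℝ) (E₂ := fun _ : M => ℝ) y
      ⟨z, coframe y i z⟩
    have h3 : (th ⟨z, coframe y i z⟩).2 = _ := congrArg Prod.snd h2
    rw [h3, inCoordinates_form]
    change _ = coframe y i z (t.symmL ℝ z (t ⟨y, e y j⟩).2)
    rw [Trivialization.symmL_apply _ hz]
    rfl
  have hb : ∀ᶠ z in 𝓝 y, z ∈ t.baseSet :=
    t.open_baseSet.mem_nhds (FiberBundle.mem_baseSet_trivializationAt' y)
  have hb' : ∀ᶠ z in 𝓝 y, z ∈ th.baseSet :=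
    th.open_baseSet.mem_nhds (FiberBundle.mem_baseSet_trivializationAt' y)
  have h0 := key y (FiberBundle.mem_baseSet_trivializationAt' y)
    (FiberBundle.mem_baseSet_trivializationAt' y)
  have e1 : coframe y i y = eDual y i := FiberBundle.extend_apply_self _ _
  have e2 : frame y j y = e y j := FiberBundle.extend_apply_self _ _
  filter_upwards [hb, hb'] with z hz hz'
  rw [key z hz hz', ← h0, e1, e2]
  exact pr_bs i j

theorem frep_apply {α : Π x : M, Cotangent n x} {y : M} (hy : y ∈ φ.source) :
    frep φ α (φ y) = α y ∘L ti φ y := by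
  rw [frep, φ.left_inv hy]

end Forms

/-! ### Symmetric tensors on the model space -/

section SymTensors

open Filter Topology

variable {n : ℕ}

/-- Contravariant 2-tensors on the model space. -/
abbrev LTens (n : ℕ) : Type := (Model n →L[ℝ] ℝ) →L[ℝ] Model n

instance : NormedAddCommGroup (LTens n) := ContinuousLinearMap.toNormedAddCommGroup
instance : NormedSpace ℝ (LTens n) := ContinuousLinearMap.toNormedSpace

/-- The symmetric 2-tensors on the model space. -/
def lsym (n : ℕ) : Submodule ℝ (LTens n) where
  carrier := {S | ∀ α β : Model n →L[ℝ] ℝ, α (S β) = β (S α)}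
  add_mem' {S T} hS hT α β := by
    simp only [add_apply, map_add, hS α β, hT α β]
  zero_mem' α β := by simp
  smul_mem' c S hS α β := by simp only [smul_apply, map_smul, hS α β]

/-- The symmetric product `u ⊗ v + v ⊗ u`. -/
def lsp : Model n →L[ℝ] Model n →L[ℝ] LTens n :=
  LinearMap.toContinuousLinearMap <|
    (LinearMap.toContinuousLinearMap (𝕜 := ℝ) (E := Model n) (F' := LTens n)).toLinearMap ∘ₗ
    LinearMap.mk₂ ℝ (fun u v => (ContinuousLinearMap.apply ℝ ℝ v).smulRight u
        + (ContinuousLinearMap.apply ℝ ℝ u).smulRight v)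
      (fun u u' v => by ext1 β; simp; module) (fun c u v => by ext1 β; simp; module)
      (fun u v v' => by ext1 β; simp; module) (fun c u v => by ext1 β; simp; module)

theorem lsp_apply (u v : Model n) (β : Model n →L[ℝ] ℝ) : lsp u v β = β v • u + β u • v := rfl

theorem lsp_comm (u v : Model n) : lsp u v = lsp v u := by
  ext1 β
  rw [lsp_apply, lsp_apply, add_comm]

theorem lsp_mem (u v : Model n) : lsp u v ∈ lsym n := fun α β => by
  simp only [lsp_apply, map_add, map_smul, smul_eq_mul]
  ring

/-- The action of an endomorphism on 2-tensors. -/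
def act (A : Model n →L[ℝ] Model n) (S : LTens n) : LTens n :=
  A ∘L S + S ∘L (ContinuousLinearMap.compL ℝ (Model n) (Model n) ℝ).flip A

theorem act_apply (A : Model n →L[ℝ] Model n) (S : LTens n) (β : Model n →L[ℝ] ℝ) :
    act A S β = A (S β) + S (β ∘L A) := by
  simp [act]

/-- The derivative of a symmetric tensor in terms of the derivatives of its components in a
moving frame. -/
theorem sum_frame_lsp {f f' : Fin n → Model n} {θ θ' : Fin n → Model n →L[ℝ] ℝ}
    (h1 : ∀ w, ∑ i, θ i w • f i = w) (h2 : ∀ i j, θ' i (f j) + θ i (f' j) = 0)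
    {S S' : LTens n} (hS : S ∈ lsym n) (hS' : S' ∈ lsym n) (A : Model n →L[ℝ] Model n) :
    ∑ i, ∑ j, (((θ' i (S (θ j)) + θ i (S' (θ j)) + θ i (S (θ' j))) / 2) • lsp (f i) (f j) +
      θ i (S (θ j)) • lsp (f' i + A (f i)) (f j)) = S' + act A S := by
  have d1 : ∀ β : Model n →L[ℝ] ℝ, ∑ j, β (f j) • θ j = β := by
    intro β
    ext1 w
    conv_rhs => rw [← h1 w, map_sum]
    simp [mul_comm]
  have d2 : ∀ i, θ' i = -∑ k, θ i (f' k) • θ k := by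
    intro i
    conv_lhs => rw [← d1 (θ' i)]
    rw [← Finset.sum_neg_distrib]
    refine Finset.sum_congr rfl fun k _ => ?_
    rw [eq_neg_of_add_eq_zero_left (h2 i k), neg_smul]
  have d3 : ∀ β : Model n →L[ℝ] ℝ, ∑ i, β (f' i) • θ i = -∑ j, β (f j) • θ' j := by
    intro β
    simp only [d2, smul_neg, Finset.sum_neg_distrib, neg_neg, Finset.smul_sum]
    rw [Finset.sum_comm]
    refine Finset.sum_congr rfl fun i _ => ?_
    simp only [smul_smul, ← Finset.sum_smul]
    congr 1
    conv_lhs => rw [← h1 (f' i), map_sum]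
    exact Finset.sum_congr rfl fun j _ => by rw [map_smul, smul_eq_mul, mul_comm]
  have d4 : ∀ w, ∑ k, θ k w • f' k = -∑ i, θ' i w • f i := by
    intro w
    have e : ∀ k, f' k = -∑ i, θ' i (f k) • f i := by
      intro k
      conv_lhs => rw [← h1 (f' k)]
      rw [← Finset.sum_neg_distrib]
      refine Finset.sum_congr rfl fun i _ => ?_
      rw [eq_neg_of_add_eq_zero_right (h2 i k), neg_smul]
    simp only [e, smul_neg, Finset.sum_neg_distrib, Finset.smul_sum]
    rw [Finset.sum_comm]
    congr 1
    refine Finset.sum_congr rfl fun i _ => ?_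
    simp only [smul_smul, ← Finset.sum_smul]
    congr 1
    conv_rhs => rw [← h1 w, map_sum]
    exact Finset.sum_congr rfl fun j _ => by rw [map_smul, smul_eq_mul]
  have s1 : ∀ (T : LTens n) (β : Model n →L[ℝ] ℝ) (g : Fin n → Model n),
      ∑ i, ∑ j, (θ i (T (θ j)) * β (f j)) • g i = ∑ i, θ i (T β) • g i := by
    intro T β g
    refine Finset.sum_congr rfl fun i _ => ?_
    rw [← Finset.sum_smul]
    congr 1
    conv_rhs => rw [← d1 β]
    simp only [map_sum, map_smul, smul_eq_mul]
    exact Finset.sum_congr rfl fun j _ => mul_comm _ _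
  ext1 β
  have e1 : ∑ i, ∑ j, (θ i (S' (θ j))) • (β (f j) • f i + β (f i) • f j) = (2 : ℝ) • S' β := by
    simp only [smul_add, smul_smul, Finset.sum_add_distrib]
    have : ∑ i, ∑ j, (θ i (S' (θ j)) * β (f i)) • f j = S' β := by
      rw [Finset.sum_comm]
      refine Eq.trans ?_ ((s1 S' β f).trans (h1 _))
      exact Finset.sum_congr rfl fun i _ => Finset.sum_congr rfl fun j _ => by
        rw [hS' (θ i) (θ j)]
    rw [s1 S' β f, h1, this, two_smul]
  have e2 : ∀ (g : Fin n → Model n), ∑ i, ∑ j, θ i (S (θ j)) • (β (f j) • g i + β (g i) • f j) =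
      ∑ i, θ i (S β) • g i + S (∑ i, β (g i) • θ i) := by
    intro g
    simp only [smul_add, smul_smul, Finset.sum_add_distrib]
    rw [s1 S β g, map_sum]
    congr 1
    refine Finset.sum_congr rfl fun i _ => ?_
    rw [map_smul]
    conv_rhs => rw [← h1 (S (θ i))]
    rw [Finset.smul_sum]
    refine Finset.sum_congr rfl fun j _ => ?_
    rw [smul_smul, hS (θ i) (θ j), mul_comm]
  have e3 : ∑ i, ∑ j, (θ' i (S (θ j)) + θ i (S (θ' j))) • (β (f j) • f i + β (f i) • f j) =
      (2 : ℝ) • (∑ i, θ' i (S β) • f i + S (∑ j, β (f j) • θ' j)) := by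
    have a1 : ∑ i, ∑ j, (θ' i (S (θ j)) * β (f j)) • f i = ∑ i, θ' i (S β) • f i := by
      refine Finset.sum_congr rfl fun i _ => ?_
      rw [← Finset.sum_smul]
      congr 1
      conv_rhs => rw [← d1 β]
      simp only [map_sum, map_smul, smul_eq_mul]
      exact Finset.sum_congr rfl fun j _ => mul_comm _ _
    have a2 : ∑ i, ∑ j, (θ i (S (θ' j)) * β (f j)) • f i = S (∑ j, β (f j) • θ' j) := by
      rw [Finset.sum_comm, map_sum]
      refine Finset.sum_congr rfl fun j _ => ?_
      rw [map_smul]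
      conv_rhs => rw [← h1 (S (θ' j))]
      rw [Finset.smul_sum]
      exact Finset.sum_congr rfl fun i _ => by rw [smul_smul, mul_comm]
    have a3 : ∑ i, ∑ j, (θ' i (S (θ j)) * β (f i)) • f j = S (∑ j, β (f j) • θ' j) := by
      rw [Finset.sum_comm, ← a2]
      exact Finset.sum_congr rfl fun i _ => Finset.sum_congr rfl fun j _ => by
        rw [hS (θ' j) (θ i)]
    have a4 : ∑ i, ∑ j, (θ i (S (θ' j)) * β (f i)) • f j = ∑ i, θ' i (S β) • f i := by
      rw [Finset.sum_comm, ← a1]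
      exact Finset.sum_congr rfl fun i _ => Finset.sum_congr rfl fun j _ => by
        rw [hS (θ j) (θ' i)]
    simp only [smul_add, smul_smul, add_mul, add_smul, Finset.sum_add_distrib]
    rw [a1, a2, a3, a4]
    module
  -- Each ordered pair contributes two terms to a symmetrised product, whence the factor 1/2. The
  -- derivatives of the coframe, produced by differentiating components, then cancel against those
  -- of the frame.
  have e0 : (∑ i, ∑ j, (((θ' i (S (θ j)) + θ i (S' (θ j)) + θ i (S (θ' j))) / 2) •
      lsp (f i) (f j) + θ i (S (θ j)) • lsp (f' i + A (f i)) (f j))) β =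
      (2⁻¹ : ℝ) • (∑ i, ∑ j, (θ i (S' (θ j))) • (β (f j) • f i + β (f i) • f j) +
        ∑ i, ∑ j, (θ' i (S (θ j)) + θ i (S (θ' j))) • (β (f j) • f i + β (f i) • f j)) +
      ∑ i, ∑ j, θ i (S (θ j)) • (β (f j) • (f' i + A (f i)) + β (f' i + A (f i)) • f j) := by
    simp only [sum_apply, add_apply, smul_apply, lsp_apply, Finset.smul_sum,
      ← Finset.sum_add_distrib]
    exact Finset.sum_congr rfl fun i _ => Finset.sum_congr rfl fun j _ => by module
  have e4 : ∑ i, θ i (S β) • A (f i) = A (S β) := by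
    conv_rhs => rw [← h1 (S β), map_sum]
    simp only [map_smul]
  have e5 : ∑ i, β (A (f i)) • θ i = β ∘L A := d1 (β ∘L A)
  rw [e0, e1, e3, e2]
  simp only [map_add, smul_add, add_smul, Finset.sum_add_distrib]
  rw [d3, d4, e4, e5, add_apply, act_apply, map_neg]
  module

end SymTensors

/-! ### Symmetric tensor fields in charts -/

section SymTransfer

open Filter Topology

variable {n : ℕ} {M : Type*} [TopologicalSpace M] [ChartedSpace (Model n) M]

/-- The components of a symmetric tensor in a chart. -/
def tmS (φ : OpenPartialHomeomorph M (Model n)) (y : M) : SymTensor n y →ₗ[ℝ] LTens n where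
  toFun s := LinearMap.toContinuousLinearMap
    { toFun := fun β : Model n →L[ℝ] ℝ => tm φ y (s.1 (β ∘L tm φ y))
      map_add' := fun β β' => by
        rw [← map_add, ← map_add]
        rfl
      map_smul' := fun c β => by
        rw [RingHom.id_apply, ← map_smul, ← map_smul]
        rfl }
  map_add' s t := by
    ext1 β
    exact map_add (tm φ y) _ _
  map_smul' c s := by
    ext1 β
    exact map_smul (tm φ y) _ _

theorem tmS_apply (φ : OpenPartialHomeomorph M (Model n)) (y : M) (s : SymTensor n y)
    (β : Model n →L[ℝ] ℝ) : tmS φ y s β = tm φ y (s.1 (β ∘L tm φ y)) := rfl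

theorem tmS_mem (φ : OpenPartialHomeomorph M (Model n)) (y : M) (s : SymTensor n y) :
    tmS φ y s ∈ lsym n := fun α β => s.2 (α ∘L tm φ y) (β ∘L tm φ y)

theorem tmS_symProd (φ : OpenPartialHomeomorph M (Model n)) (y : M) (u v : Tangent n y) :
    tmS φ y (symProd u v) = lsp (tm φ y u) (tm φ y v) := by
  ext1 β
  change tm φ y (β (tm φ y v) • u + β (tm φ y u) • v) = _
  rw [map_add, map_smul, map_smul]
  rfl

/-- The symmetric tensor field with given components in a chart. -/
def csym (φ : OpenPartialHomeomorph M (Model n)) (S : Model n → lsym n) (y : M) :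
    SymTensor n y :=
  ⟨{ toFun := fun α => ti φ y ((S (φ y)).1 (α ∘L ti φ y))
     map_add' := fun β β' => by
        rw [← map_add, ← map_add]
        rfl
     map_smul' := fun c β => by
        rw [RingHom.id_apply, ← map_smul, ← map_smul]
        rfl }, fun α β => (S (φ y)).2 (α ∘L ti φ y) (β ∘L ti φ y)⟩

/-- The components of a symmetric tensor field in a chart. -/
def srep (φ : OpenPartialHomeomorph M (Model n)) (σ : Π x : M, SymTensor n x) (p : Model n) :
    LTens n := tmS φ (φ.symm p) (σ (φ.symm p))

theorem srep_mem (φ : OpenPartialHomeomorph M (Model n)) (σ : Π x : M, SymTensor n x)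
    (p : Model n) : srep φ σ p ∈ lsym n := tmS_mem _ _ _

theorem srep_apply {φ : OpenPartialHomeomorph M (Model n)} {σ : Π x : M, SymTensor n x} {y : M}
    (hy : y ∈ φ.source) : srep φ σ (φ y) = tmS φ y (σ y) := by
  rw [srep, φ.left_inv hy]

variable [IsManifold (𝓡 n) ∞ M] {φ : OpenPartialHomeomorph M (Model n)}

theorem tmS_csym (hφ : φ ∈ IsManifold.maximalAtlas (𝓡 n) ∞ M) {y : M} (hy : y ∈ φ.source)
    (S : Model n → lsym n) : tmS φ y (csym φ S y) = S (φ y) := by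
  ext1 β
  have h : (β ∘L tm φ y) ∘L ti φ y = β := by
    ext1 w
    exact congrArg β (tm_ti hφ hy w)
  change tm φ y (ti φ y ((S (φ y)).1 ((β ∘L tm φ y) ∘L ti φ y))) = _
  rw [tm_ti hφ hy, h]

theorem eval_eq_tmS (hφ : φ ∈ IsManifold.maximalAtlas (𝓡 n) ∞ M) {y : M} (hy : y ∈ φ.source)
    (s : SymTensor n y) (α β : Cotangent n y) :
    SymTensor.eval s α β = α (ti φ y (tmS φ y s (β ∘L ti φ y))) := by
  have h : (β ∘L ti φ y) ∘L tm φ y = β := by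
    ext1 w
    exact congrArg β (ti_tm hφ hy w)
  rw [tmS_apply, ti_tm hφ hy, h]
  rfl

theorem tmS_injective (hφ : φ ∈ IsManifold.maximalAtlas (𝓡 n) ∞ M) {y : M} (hy : y ∈ φ.source) :
    Function.Injective (tmS φ y) := by
  intro s t h
  apply Subtype.ext
  apply LinearMap.ext
  intro β
  have key : ∀ s : SymTensor n y, s.1 β = ti φ y (tmS φ y s (β ∘L ti φ y)) := by
    intro s
    have h : (β ∘L ti φ y) ∘L tm φ y = β := by
      ext1 w
      exact congrArg β (ti_tm hφ hy w)
    rw [tmS_apply, ti_tm hφ hy, h]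
  rw [key, key, h]

theorem contDiffAt_srep (hφ : φ ∈ IsManifold.maximalAtlas (𝓡 n) ∞ M) {y : M} (hy : y ∈ φ.source)
    {σ : Π x : M, SymTensor n x} (hσ : SmoothSym σ) : ContDiffAt ℝ ∞ (srep φ σ) (φ y) := by
  refine contDiffAt_clm_of_apply fun β => contDiffAt_euclidean.2 fun i => ?_
  have h := contDiffAt_of_contMDiffAt hφ hy (hσ _ _ y
    (smoothFormAt_cform hφ hy (a := fun _ => pr i) contDiffAt_const)
    (smoothFormAt_cform hφ hy (a := fun _ => β) contDiffAt_const))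
  exact h

theorem contMDiffAt_eval (hφ : φ ∈ IsManifold.maximalAtlas (𝓡 n) ∞ M) {y : M}
    (hy : y ∈ φ.source) {σ : Π x : M, SymTensor n x} (hσ : ContDiffAt ℝ ∞ (srep φ σ) (φ y))
    {α β : Π x : M, Cotangent n x} (hα : SmoothFormAt α y) (hβ : SmoothFormAt β y) :
    ContMDiffAt (𝓡 n) 𝓘(ℝ, ℝ) ∞ (fun z => SymTensor.eval (σ z) (α z) (β z)) y := by
  refine contMDiffAt_of_contDiffAt hφ hy (h := fun p => frep φ α p (srep φ σ p (frep φ β p)))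
    ((contDiffAt_frep hφ hy hα).clm_apply (hσ.clm_apply (contDiffAt_frep hφ hy hβ))) ?_
  filter_upwards [eventually_source hy] with z hz
  rw [eval_eq_tmS hφ hz, frep_apply hz, srep_apply hz, frep_apply hz]
  rfl

theorem smoothSym_symProd {X Z : Π x : M, Tangent n x} (hX : SmoothVF X) (hZ : SmoothVF Z) :
    SmoothSym fun y => symProd (X y) (Z y) := by
  intro α β y hα hβ
  have h := ((contMDiffAt_form_apply hβ (hZ y)).mul (contMDiffAt_form_apply hα (hX y))).add
    ((contMDiffAt_form_apply hβ (hX y)).mul (contMDiffAt_form_apply hα (hZ y)))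
  refine h.congr_of_eventuallyEq (Eventually.of_forall fun z => ?_)
  change α z (β z (Z z) • X z + β z (X z) • Z z) = _
  rw [map_add, map_smul, map_smul]
  rfl

theorem vfAt_of_rep (hφ : φ ∈ IsManifold.maximalAtlas (𝓡 n) ∞ M) {y : M}
    (hy : y ∈ φ.source) {X : Π x : M, Tangent n x} (hX : ContDiffAt ℝ ∞ (rep φ X) (φ y)) :
    VFAt ∞ X y := by
  refine ContMDiffAt.congr_of_eventuallyEq (vfAt_cfield hφ infty_add_one_le hy hX) ?_
  filter_upwards [eventually_source hy] with z hz
  rw [cfield_rep hφ hz]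

theorem fderiv_mem_lsym {S : Model n → LTens n} {p : Model n} (hS : DifferentiableAt ℝ S p)
    (h : ∀ q, S q ∈ lsym n) (v : Model n) : fderiv ℝ S p v ∈ lsym n := by
  intro α β
  have key : ∀ α β : Model n →L[ℝ] ℝ,
      fderiv ℝ (fun q => α (S q β)) p v = α (fderiv ℝ S p v β) := by
    intro α β
    have e := α.hasFDerivAt.comp p (hS.hasFDerivAt.clm_apply (hasFDerivAt_const β p))
    have e' := congrArg (fun L => L v) e.fderiv
    refine e'.trans ?_
    simp
  rw [← key, ← key]
  congr 2
  funext q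
  exact h q α β

/-- The definition of `nablaSym` uses the frame of the preferred chart at y, whose components in φ
are not constant. `sum_frame_lsp` shows that the variation of this frame drops out. -/
theorem tmS_nablaSym (D : Connection n M) (hφ : φ ∈ IsManifold.maximalAtlas (𝓡 n) ∞ M) {y : M}
    (hy : y ∈ φ.source) {σ : Π x : M, SymTensor n x} (hσ : DifferentiableAt ℝ (srep φ σ) (φ y))
    (v : Tangent n y) : tmS φ y (nablaSym D σ y v) =
      fderiv ℝ (srep φ σ) (φ y) (tm φ y v) + act (gam D φ (φ y) (tm φ y v)) (srep φ σ (φ y)) := by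
  have sF : ∀ i : Fin n, VFAt ∞ (frame y i) y := fun i => vfAt_extend (e y i) ∞
  have eF : ∀ i : Fin n, frame y i y = e y i := fun i => FiberBundle.extend_apply_self _ _
  have eC : ∀ i : Fin n, coframe y i y = eDual y i := fun i => FiberBundle.extend_apply_self _ _
  have rF := fun i : Fin n =>
    (contDiffAt_rep hφ infty_add_one_le hy (sF i)).differentiableAt (by simp)
  have rC := fun i : Fin n => (contDiffAt_frep hφ hy (smoothFormAt_coframe y i)).differentiableAt
    (by simp)
  have f0 : ∀ i : Fin n, rep φ (frame y i) (φ y) = tm φ y (e y i) := fun i => by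
    rw [rep_apply hy, eF]
  have c0 : ∀ i : Fin n, frep φ (coframe y i) (φ y) = eDual y i ∘L ti φ y := fun i => by
    rw [frep_apply hy, eC]
  have h1 : ∀ w, ∑ i, frep φ (coframe y i) (φ y) w • rep φ (frame y i) (φ y) = w := by
    intro w
    simp only [f0, c0]
    have := congrArg (tm φ y) (sum_eDual_smul_e (ti φ y w))
    rw [map_sum, tm_ti hφ hy] at this
    simp only [map_smul] at this
    exact this
  have h2 : ∀ i j, fderiv ℝ (frep φ (coframe y i)) (φ y) (tm φ y v) (rep φ (frame y j) (φ y)) +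
      frep φ (coframe y i) (φ y) (fderiv ℝ (rep φ (frame y j)) (φ y) (tm φ y v)) = 0 := by
    intro i j
    have e1 : (fun p => frep φ (coframe y i) p (rep φ (frame y j) p)) =ᶠ[𝓝 (φ y)]
        fun _ => if i = j then 1 else 0 := by
      filter_upwards [eventually_symm hy (coframe_frame y i j)] with p hp
      rw [← hp.2]
      change coframe y i (φ.symm p) (ti φ _ (tm φ _ _)) = _
      rw [ti_tm hφ (φ.map_target hp.1)]
    have e2 := ((rC i).hasFDerivAt.clm_apply (rF j).hasFDerivAt).fderiv.symm.trans e1.fderiv_eq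
    have e3 := congrArg (fun L => L (tm φ y v)) e2
    simp only [add_apply, ContinuousLinearMap.coe_comp, Function.comp,
      ContinuousLinearMap.flip_apply] at e3
    rw [add_comm]
    refine e3.trans ?_
    simp
  have key := sum_frame_lsp h1 h2 (srep_mem φ σ (φ y)) (fderiv_mem_lsym hσ (srep_mem φ σ)
    (tm φ y v)) (gam D φ (φ y) (tm φ y v))
  rw [← key, nablaSym, map_sum]
  refine Finset.sum_congr rfl fun i _ => ?_
  rw [map_sum]
  refine Finset.sum_congr rfl fun j _ => ?_
  have m1 := mvfderiv_eq_fderiv hφ hy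
    (g := fun z => SymTensor.eval (σ z) (coframe y i z) (coframe y j z))
    (h := fun p => frep φ (coframe y i) p (srep φ σ p (frep φ (coframe y j) p)))
    ((rC i).clm_apply (hσ.clm_apply (rC j))) (by
      filter_upwards [eventually_source hy] with z hz
      rw [eval_eq_tmS hφ hz, frep_apply hz, srep_apply hz, frep_apply hz]
      rfl) v
  have m2 := ((rC i).hasFDerivAt.clm_apply (hσ.hasFDerivAt.clm_apply (rC j).hasFDerivAt)).fderiv
  have m3 := m1.trans (congrArg (fun L => L (tm φ y v)) m2)
  simp only [add_apply, ContinuousLinearMap.coe_comp, Function.comp,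
    ContinuousLinearMap.flip_apply, map_add] at m3
  have m4 : comp (σ y) i j = frep φ (coframe y i) (φ y) (srep φ σ (φ y)
      (frep φ (coframe y j) (φ y))) := by
    rw [comp, eval_eq_tmS hφ hy, srep_apply hy, c0, c0]
    rfl
  rw [map_add, map_smul, map_smul, tmS_symProd, tmS_symProd, m3, m4, ← f0, ← f0,
    tm_conn D hφ hy (k := ∞) (by simp) infty_add_one_le (sF i)]
  congr 3
  ring

end SymTransfer

/-! ### The prolonged connection on a trivial bundle -/

section Prolongation

open Filter Topology

/-- The continuous bilinear map attached to a bilinear map of finite-dimensional spaces. -/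
def clm₂ {E F G : Type*} [NormedAddCommGroup E] [NormedSpace ℝ E] [FiniteDimensional ℝ E]
    [NormedAddCommGroup F] [NormedSpace ℝ F] [FiniteDimensional ℝ F]
    [NormedAddCommGroup G] [NormedSpace ℝ G] (f : E →ₗ[ℝ] F →ₗ[ℝ] G) : E →L[ℝ] F →L[ℝ] G :=
  LinearMap.toContinuousLinearMap <|
    (LinearMap.toContinuousLinearMap (𝕜 := ℝ) (E := F) (F' := G)).toLinearMap ∘ₗ f

/-- The curvature of the connection `d + A` on a trivial bundle. -/
def fcurv {E F : Type*} [NormedAddCommGroup E] [NormedSpace ℝ E] [NormedAddCommGroup F]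
    [NormedSpace ℝ F] (A : E → E →L[ℝ] F →L[ℝ] F) (p u v : E) (s : F) : F :=
  fderiv ℝ A p u v s - fderiv ℝ A p v u s + A p u (A p v s) - A p v (A p u s)

/-- Second derivatives of s cancel by symmetry, first derivatives of s cancel in the commutator, and
derivatives of X and Y are absorbed by the bracket term. What is left is tensorial. -/
theorem fcurv_eq {E F : Type*} [NormedAddCommGroup E] [NormedSpace ℝ E] [NormedAddCommGroup F]
    [NormedSpace ℝ F] {A : E → E →L[ℝ] F →L[ℝ] F} {p : E} (hA : DifferentiableAt ℝ A p)
    {s : E → F} (hs : ContDiffAt ℝ ∞ s p) {X Y : E → E} (hX : DifferentiableAt ℝ X p)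
    (hY : DifferentiableAt ℝ Y p) :
    (fderiv ℝ (fun q => fderiv ℝ s q (Y q) + A q (Y q) (s q)) p (X p)
      + A p (X p) (fderiv ℝ s p (Y p) + A p (Y p) (s p)))
    - (fderiv ℝ (fun q => fderiv ℝ s q (X q) + A q (X q) (s q)) p (Y p)
      + A p (Y p) (fderiv ℝ s p (X p) + A p (X p) (s p)))
    - (fderiv ℝ s p (fderiv ℝ Y p (X p) - fderiv ℝ X p (Y p))
      + A p (fderiv ℝ Y p (X p) - fderiv ℝ X p (Y p)) (s p)) = fcurv A p (X p) (Y p) (s p) := by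
  have ds := hs.differentiableAt (by simp)
  have ds' : DifferentiableAt ℝ (fderiv ℝ s) p :=
    (hs.fderiv_right (m := ∞) (by simp)).differentiableAt (by simp)
  have hsym : IsSymmSndFDerivAt ℝ s p := hs.isSymmSndFDerivAt (by simp; norm_cast)
  have key : ∀ {Z : E → E} (_ : DifferentiableAt ℝ Z p) (a : E),
      fderiv ℝ (fun q => fderiv ℝ s q (Z q) + A q (Z q) (s q)) p a =
      fderiv ℝ (fderiv ℝ s) p a (Z p) + fderiv ℝ s p (fderiv ℝ Z p a) +
      (fderiv ℝ A p a (Z p) (s p) + A p (fderiv ℝ Z p a) (s p) + A p (Z p) (fderiv ℝ s p a)) := by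
    intro Z hZ a
    have e := ((ds'.hasFDerivAt.clm_apply hZ.hasFDerivAt).add
      ((hA.hasFDerivAt.clm_apply hZ.hasFDerivAt).clm_apply ds.hasFDerivAt)).fderiv
    have e' := congrArg (fun L => L a) e
    simp only [add_apply, ContinuousLinearMap.coe_comp, Function.comp,
      ContinuousLinearMap.flip_apply] at e'
    refine e'.trans ?_
    abel
  rw [key hX, key hY, hsym.eq (X p) (Y p), fcurv]
  simp only [map_add, map_sub, sub_apply]
  abel

variable {n : ℕ}

/-- The model fibre of the prolonged bundle. -/
abbrev LFib (n : ℕ) : Type := LTens n × Model n × ℝ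

instance : NormedAddCommGroup (LFib n) := Prod.normedAddCommGroup
instance : NormedSpace ℝ (LFib n) := Prod.normedSpace
instance : NormedAddCommGroup (LFib n →L[ℝ] LFib n) := ContinuousLinearMap.toNormedAddCommGroup
instance : NormedSpace ℝ (LFib n →L[ℝ] LFib n) := ContinuousLinearMap.toNormedSpace
instance : NormedAddCommGroup (Model n →L[ℝ] LFib n →L[ℝ] LFib n) :=
  ContinuousLinearMap.toNormedAddCommGroup
instance : NormedSpace ℝ (Model n →L[ℝ] LFib n →L[ℝ] LFib n) :=
  ContinuousLinearMap.toNormedSpace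

theorem lweyl_add₁ (Γ : Christoffel n) (p u u' v w : Model n) :
    lweyl Γ p (u + u') v w = lweyl Γ p u v w + lweyl Γ p u' v w := by
  simp only [lweyl, map_add, add_apply]
  module

theorem lweyl_smul₁ (Γ : Christoffel n) (p : Model n) (c : ℝ) (u v w : Model n) :
    lweyl Γ p (c • u) v w = c • lweyl Γ p u v w := by
  simp only [lweyl, map_smul, smul_apply, smul_eq_mul]
  module

theorem lweyl_add₂ (Γ : Christoffel n) (p u v v' w : Model n) :
    lweyl Γ p u (v + v') w = lweyl Γ p u v w + lweyl Γ p u v' w := by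
  simp only [lweyl, map_add, add_apply]
  module

theorem lweyl_smul₂ (Γ : Christoffel n) (p : Model n) (c : ℝ) (u v w : Model n) :
    lweyl Γ p u (c • v) w = c • lweyl Γ p u v w := by
  simp only [lweyl, map_smul, smul_apply, smul_eq_mul]
  module

theorem lnablaSch_add₁ (Γ : Christoffel n) (p u u' v w : Model n) :
    lnablaSch Γ p (u + u') v w = lnablaSch Γ p u v w + lnablaSch Γ p u' v w := by
  simp only [lnablaSch, map_add, add_apply]
  ring

theorem lnablaSch_smul₁ (Γ : Christoffel n) (p : Model n) (c : ℝ) (u v w : Model n) :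
    lnablaSch Γ p (c • u) v w = c * lnablaSch Γ p u v w := by
  simp only [lnablaSch, map_smul, smul_apply, smul_eq_mul]
  ring

theorem lnablaSch_add₂ (Γ : Christoffel n) (p u v v' w : Model n) :
    lnablaSch Γ p u (v + v') w = lnablaSch Γ p u v w + lnablaSch Γ p u v' w := by
  simp only [lnablaSch, map_add, add_apply]
  ring

theorem lnablaSch_smul₂ (Γ : Christoffel n) (p : Model n) (c : ℝ) (u v w : Model n) :
    lnablaSch Γ p u (c • v) w = c * lnablaSch Γ p u v w := by
  simp only [lnablaSch, map_smul, smul_apply, smul_eq_mul]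
  ring

/-- The contraction `W_{ac}{}^b{}_d σ^{cd}` in coordinates. -/
def wtr (Γ : Christoffel n) (p : Model n) : Model n →L[ℝ] LTens n →L[ℝ] Model n :=
  clm₂ <| LinearMap.mk₂ ℝ (fun v S => ∑ j, lweyl Γ p v (S (pr j)) (bs j))
    (fun u v S => by simp only [lweyl_add₁, Finset.sum_add_distrib])
    (fun c v S => by simp only [lweyl_smul₁, Finset.smul_sum])
    (fun v S T => by simp only [add_apply, lweyl_add₂, Finset.sum_add_distrib])
    (fun c v S => by simp only [smul_apply, lweyl_smul₂, Finset.smul_sum])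

theorem wtr_apply (Γ : Christoffel n) (p v : Model n) (S : LTens n) :
    wtr Γ p v S = ∑ j, lweyl Γ p v (S (pr j)) (bs j) := rfl

/-- The contraction `Y_{abc} σ^{bc}` in coordinates. -/
def ytr (Γ : Christoffel n) (p : Model n) : Model n →L[ℝ] LTens n →L[ℝ] ℝ :=
  clm₂ <| LinearMap.mk₂ ℝ (fun v S => ∑ j, lcotton Γ p v (S (pr j)) (bs j))
    (fun u v S => by
      simp only [lcotton, lnablaSch_add₁, lnablaSch_add₂, ← Finset.sum_add_distrib]
      exact Finset.sum_congr rfl fun j _ => by ring)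
    (fun c v S => by
      simp only [lcotton, lnablaSch_smul₁, lnablaSch_smul₂, smul_eq_mul, Finset.mul_sum]
      exact Finset.sum_congr rfl fun j _ => by ring)
    (fun v S T => by
      simp only [lcotton, add_apply, lnablaSch_add₁, lnablaSch_add₂, ← Finset.sum_add_distrib]
      exact Finset.sum_congr rfl fun j _ => by ring)
    (fun c v S => by
      simp only [lcotton, smul_apply, lnablaSch_smul₁, lnablaSch_smul₂, smul_eq_mul,
        Finset.mul_sum]
      exact Finset.sum_congr rfl fun j _ => by ring)

theorem ytr_apply (Γ : Christoffel n) (p v : Model n) (S : LTens n) :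
    ytr Γ p v S = ∑ j, lcotton Γ p v (S (pr j)) (bs j) := rfl

theorem act_add_left (A B : Model n →L[ℝ] Model n) (S : LTens n) :
    act (A + B) S = act A S + act B S := by
  ext1 β
  simp only [act_apply, add_apply, ContinuousLinearMap.comp_add, map_add]
  abel

theorem act_smul_left (c : ℝ) (A : Model n →L[ℝ] Model n) (S : LTens n) :
    act (c • A) S = c • act A S := by
  ext1 β
  simp only [act_apply, smul_apply, ContinuousLinearMap.comp_smul, map_smul, smul_add]

theorem act_add_right (A : Model n →L[ℝ] Model n) (S T : LTens n) :
    act A (S + T) = act A S + act A T := by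
  ext1 β
  simp only [act_apply, add_apply, map_add]
  abel

theorem act_smul_right (c : ℝ) (A : Model n →L[ℝ] Model n) (S : LTens n) :
    act A (c • S) = c • act A S := by
  ext1 β
  simp only [act_apply, smul_apply, map_smul, smul_add]

/-- The connection form, in coordinates, of the prolonged connection. -/
def tcon (Γ : Christoffel n) (p : Model n) : Model n →L[ℝ] LFib n →L[ℝ] LFib n :=
  clm₂ <| LinearMap.mk₂ ℝ (fun v s => (act (Γ p v) s.1 - lsp v s.2.1,
      Γ p v s.2.1 - s.2.2 • v + s.1 (lsch Γ p v) - (1 / (n : ℝ)) • wtr Γ p v s.1,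
      2 * lsch Γ p v s.2.1 - (4 / (n : ℝ)) * ytr Γ p v s.1))
    (fun u v s => by
      simp only [map_add, add_apply, act_add_left, Prod.mk_add_mk, Prod.mk.injEq]
      refine ⟨by module, by module, by ring⟩)
    (fun c v s => by
      simp only [map_smul, smul_apply, act_smul_left, Prod.smul_mk, Prod.mk.injEq, smul_eq_mul]
      refine ⟨by module, by module, by ring⟩)
    (fun v s t => by
      simp only [Prod.fst_add, Prod.snd_add, map_add, add_apply, act_add_right, Prod.mk_add_mk,
        Prod.mk.injEq]
      refine ⟨by module, by module, by ring⟩)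
    (fun c v s => by
      simp only [Prod.smul_fst, Prod.smul_snd, map_smul, smul_apply, act_smul_right,
        Prod.smul_mk, Prod.mk.injEq, smul_eq_mul]
      refine ⟨by module, by module, by ring⟩)

theorem tcon_apply (Γ : Christoffel n) (p v : Model n) (s : LFib n) : tcon Γ p v s =
    (act (Γ p v) s.1 - lsp v s.2.1,
      Γ p v s.2.1 - s.2.2 • v + s.1 (lsch Γ p v) - (1 / (n : ℝ)) • wtr Γ p v s.1,
      2 * lsch Γ p v s.2.1 - (4 / (n : ℝ)) * ytr Γ p v s.1) := rfl

theorem contDiffAt_lweyl {Γ : Christoffel n} {p : Model n} (h : ContDiffAt ℝ ∞ Γ p)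
    (u v w : Model n) : ContDiffAt ℝ ∞ (fun q => lweyl Γ q u v w) p := by
  have h1 := contDiffAt_lcurv h
  have h2 := contDiffAt_lsch h
  have c := fun u : Model n => contDiffAt_const (𝕜 := ℝ) (n := ∞) (x := p) (c := u)
  exact ((((h1.clm_apply (c u)).clm_apply (c v)).clm_apply (c w)).sub
    (((h2.clm_apply (c v)).clm_apply (c w)).smul (c u))).add
    (((h2.clm_apply (c u)).clm_apply (c w)).smul (c v))

theorem contDiffAt_lnablaSch {Γ : Christoffel n} {p : Model n} (h : ContDiffAt ℝ ∞ Γ p)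
    (u v w : Model n) : ContDiffAt ℝ ∞ (fun q => lnablaSch Γ q u v w) p := by
  have h2 := contDiffAt_lsch h
  have h3 := contDiffAt_fderiv h2
  have c := fun u : Model n => contDiffAt_const (𝕜 := ℝ) (n := ∞) (x := p) (c := u)
  exact ((((h3.clm_apply (c u)).clm_apply (c v)).clm_apply (c w)).sub
    ((h2.clm_apply ((h.clm_apply (c u)).clm_apply (c v))).clm_apply (c w))).sub
    ((h2.clm_apply (c v)).clm_apply ((h.clm_apply (c u)).clm_apply (c w)))

theorem contDiffAt_lcotton {Γ : Christoffel n} {p : Model n} (h : ContDiffAt ℝ ∞ Γ p)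
    (u v w : Model n) : ContDiffAt ℝ ∞ (fun q => lcotton Γ q u v w) p :=
  ((contDiffAt_lnablaSch h u v w).sub (contDiffAt_lnablaSch h v u w)).div_const 2

theorem contDiffAt_wtr {Γ : Christoffel n} {p : Model n} (h : ContDiffAt ℝ ∞ Γ p) :
    ContDiffAt ℝ ∞ (wtr Γ) p := by
  refine contDiffAt_clm_of_apply fun v => contDiffAt_clm_of_apply fun S => ?_
  simp only [wtr_apply]
  exact ContDiffAt.sum fun j _ => contDiffAt_lweyl h _ _ _

theorem contDiffAt_ytr {Γ : Christoffel n} {p : Model n} (h : ContDiffAt ℝ ∞ Γ p) :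
    ContDiffAt ℝ ∞ (ytr Γ) p := by
  refine contDiffAt_clm_of_apply fun v => contDiffAt_clm_of_apply fun S => ?_
  simp only [ytr_apply]
  exact ContDiffAt.sum fun j _ => contDiffAt_lcotton h _ _ _

theorem contDiffAt_act {A : Model n → Model n →L[ℝ] Model n} {S : Model n → LTens n}
    {p : Model n} (hA : ContDiffAt ℝ ∞ A p) (hS : ContDiffAt ℝ ∞ S p) :
    ContDiffAt ℝ ∞ (fun q => act (A q) (S q)) p := by
  refine contDiffAt_clm_of_apply fun β => ?_
  simp only [act_apply]
  exact (hA.clm_apply (hS.clm_apply contDiffAt_const)).add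
    (hS.clm_apply (contDiffAt_const.clm_comp hA))

theorem contDiffAt_tcon {Γ : Christoffel n} {p : Model n} (h : ContDiffAt ℝ ∞ Γ p) :
    ContDiffAt ℝ ∞ (tcon Γ) p := by
  refine contDiffAt_clm_of_apply fun v => contDiffAt_clm_of_apply fun s => ?_
  simp only [tcon_apply]
  have c : ∀ {G : Type} [NormedAddCommGroup G] [NormedSpace ℝ G] (u : G),
    ContDiffAt ℝ ∞ (fun _ : Model n => u) p := fun u => contDiffAt_const
  have h1 := h.clm_apply (c v)
  have h2 := (contDiffAt_lsch h).clm_apply (c v)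
  refine ((contDiffAt_act h1 (c s.1)).sub (c _)).prodMk (ContDiffAt.prodMk ?_ ?_)
  · exact (((h1.clm_apply (c s.2.1)).sub (c _)).add ((c s.1).clm_apply h2)).sub
      (((contDiffAt_wtr h).clm_apply (c v)).clm_apply (c s.1) |>.const_smul _)
  · exact (contDiffAt_const.mul (h2.clm_apply (c s.2.1))).sub
      (contDiffAt_const.mul (((contDiffAt_ytr h).clm_apply (c v)).clm_apply (c s.1)))

end Prolongation

/-! ### The prolonged connection in a chart -/

section ProlongationTransfer

open Filter Topology

variable {n : ℕ} {M : Type*} [TopologicalSpace M] [ChartedSpace (Model n) M]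
  {φ : OpenPartialHomeomorph M (Model n)}

/-- The components of an element of the prolonged bundle in a chart. -/
def tmF (φ : OpenPartialHomeomorph M (Model n)) (y : M) : TFibre n y →ₗ[ℝ] LFib n where
  toFun s := (tmS φ y s.1, tm φ y s.2.1, s.2.2)
  map_add' s t := by
    simp only [Prod.fst_add, Prod.snd_add, map_add, Prod.mk_add_mk]
  map_smul' c s := by
    simp only [Prod.smul_fst, Prod.smul_snd, map_smul, Prod.smul_mk, RingHom.id_apply]

theorem tmF_apply (y : M) (s : TFibre n y) : tmF φ y s = (tmS φ y s.1, tm φ y s.2.1, s.2.2) := rfl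

/-- The components of a section of the prolonged bundle in a chart. -/
def trep (φ : OpenPartialHomeomorph M (Model n)) (s : Π x : M, TFibre n x) (p : Model n) :
    LFib n := tmF φ (φ.symm p) (s (φ.symm p))

theorem trep_apply {s : Π x : M, TFibre n x} {y : M} (hy : y ∈ φ.source) :
    trep φ s (φ y) = tmF φ y (s y) := by
  rw [trep, φ.left_inv hy]

variable [IsManifold (𝓡 n) ∞ M] {D : Connection n M}

theorem tmF_injective (hφ : φ ∈ IsManifold.maximalAtlas (𝓡 n) ∞ M) {y : M} (hy : y ∈ φ.source) :
    Function.Injective (tmF φ y) := by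
  intro s t h
  simp only [tmF_apply, Prod.mk.injEq] at h
  refine Prod.ext (tmS_injective hφ hy h.1) (Prod.ext ?_ h.2.2)
  rw [← ti_tm hφ hy s.2.1, h.2.1, ti_tm hφ hy]

theorem contDiffAt_trep (hφ : φ ∈ IsManifold.maximalAtlas (𝓡 n) ∞ M) {y : M} (hy : y ∈ φ.source)
    {s : Π x : M, TFibre n x} (hs : SmoothT s) : ContDiffAt ℝ ∞ (trep φ s) (φ y) :=
  (contDiffAt_srep hφ hy hs.sym).prodMk ((contDiffAt_rep hφ infty_add_one_le hy (hs.vec y)).prodMk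
    (contDiffAt_of_contMDiffAt hφ hy (hs.fn y)))

variable [T2Space M]

/-- Expanding σ in the basis turns the double sum into the trace of f(σ ·, ·), which may be taken in
any frame by `sum_eDual_e`. -/
theorem sum_comp_smul {G : Type*} [AddCommGroup G] [Module ℝ G]
    (hφ : φ ∈ IsManifold.maximalAtlas (𝓡 n) ∞ M) {y : M} (hy : y ∈ φ.source)
    (s : SymTensor n y) (f : Tangent n y →ₗ[ℝ] Tangent n y →ₗ[ℝ] G) :
    ∑ i, ∑ j, comp s i j • f (e y i) (e y j) =
      ∑ j, f (ti φ y (tmS φ y s (pr j))) (ti φ y (bs j)) := by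
  have h1 : ∀ β, ∑ i, eDual y i (s.1 β) • e y i = s.1 β := fun β => sum_eDual_smul_e _
  have h2 := sum_eDual_e hφ hy (f ∘ₗ s.1)
  rw [Finset.sum_comm]
  refine Eq.trans ?_ (h2.trans ?_)
  · refine Finset.sum_congr rfl fun j _ => ?_
    rw [LinearMap.comp_apply]
    conv_rhs => rw [← h1 (eDual y j)]
    rw [map_sum, LinearMap.sum_apply]
    refine Finset.sum_congr rfl fun i _ => ?_
    rw [map_smul, LinearMap.smul_apply]
    rfl
  · refine Finset.sum_congr rfl fun j _ => ?_
    rw [tmS_apply, ti_tm hφ hy, LinearMap.comp_apply]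

theorem tm_sum_comp_weyl (hD : IsSpecial D) (hφ : φ ∈ IsManifold.maximalAtlas (𝓡 n) ∞ M) {y : M}
    (hy : y ∈ φ.source) (σ : SymTensor n y) (v : Tangent n y) :
    tm φ y (∑ i, ∑ j, comp σ i j • weyl D y v (e y i) (e y j)) =
      wtr (gam D φ) (φ y) (tm φ y v) (tmS φ y σ) := by
  let f : Tangent n y →ₗ[ℝ] Tangent n y →ₗ[ℝ] Model n := LinearMap.mk₂ ℝ
    (fun a b => lweyl (gam D φ) (φ y) (tm φ y v) (tm φ y a) (tm φ y b))
    (fun a a' b => by simp only [map_add, lweyl_add₂])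
    (fun c a b => by simp only [map_smul, lweyl_smul₂])
    (fun a b b' => by simp only [lweyl, map_add]; module)
    (fun c a b => by simp only [lweyl, map_smul, smul_eq_mul]; module)
  have h := sum_comp_smul hφ hy σ f
  simp only [map_sum, map_smul, tm_weyl hD hφ hy]
  refine h.trans ?_
  rw [wtr_apply]
  refine Finset.sum_congr rfl fun j _ => ?_
  change lweyl _ _ _ (tm φ y (ti φ y _)) (tm φ y (ti φ y _)) = _
  rw [tm_ti hφ hy, tm_ti hφ hy]

theorem sum_comp_cotton (hD : IsSpecial D) (hφ : φ ∈ IsManifold.maximalAtlas (𝓡 n) ∞ M) {y : M}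
    (hy : y ∈ φ.source) (σ : SymTensor n y) (v : Tangent n y) :
    ∑ i, ∑ j, comp σ i j * cotton D y v (e y i) (e y j) =
      ytr (gam D φ) (φ y) (tm φ y v) (tmS φ y σ) := by
  let f : Tangent n y →ₗ[ℝ] Tangent n y →ₗ[ℝ] ℝ := LinearMap.mk₂ ℝ
    (fun a b => lcotton (gam D φ) (φ y) (tm φ y v) (tm φ y a) (tm φ y b))
    (fun a a' b => by simp only [lcotton, map_add, lnablaSch_add₁, lnablaSch_add₂]; ring)
    (fun c a b => by
      simp only [lcotton, map_smul, lnablaSch_smul₁, lnablaSch_smul₂, smul_eq_mul]; ring)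
    (fun a b b' => by simp only [lcotton, lnablaSch, map_add]; ring)
    (fun c a b => by simp only [lcotton, lnablaSch, map_smul, smul_eq_mul]; ring)
  have h := sum_comp_smul hφ hy σ f
  simp only [cotton_eq hD hφ hy]
  refine h.trans ?_
  rw [ytr_apply]
  refine Finset.sum_congr rfl fun j _ => ?_
  change lcotton _ _ _ (tm φ y (ti φ y _)) (tm φ y (ti φ y _)) = _
  rw [tm_ti hφ hy, tm_ti hφ hy]

theorem tm_sum_comp_schouten (hD : IsSpecial D) (hφ : φ ∈ IsManifold.maximalAtlas (𝓡 n) ∞ M) {y : M}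
    (hy : y ∈ φ.source) (σ : SymTensor n y) (v : Tangent n y) :
    tm φ y (∑ i, ∑ j, (comp σ i j * schouten D y v (e y j)) • e y i) =
      tmS φ y σ (lsch (gam D φ) (φ y) (tm φ y v)) := by
  let f : Tangent n y →ₗ[ℝ] Tangent n y →ₗ[ℝ] Model n := LinearMap.mk₂ ℝ
    (fun a b => lsch (gam D φ) (φ y) (tm φ y v) (tm φ y b) • tm φ y a)
    (fun a a' b => by simp only [map_add, smul_add])
    (fun c a b => by simp only [map_smul]; module)
    (fun a b b' => by simp only [map_add]; module)
    (fun c a b => by simp only [map_smul, smul_eq_mul]; module)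
  have h := sum_comp_smul hφ hy σ f
  simp only [map_sum, map_smul, schouten_eq hD hφ hy, mul_smul]
  refine h.trans ?_
  conv_rhs => rw [← sum_apply_bs (lsch (gam D φ) (φ y) (tm φ y v))]
  rw [map_sum]
  refine Finset.sum_congr rfl fun j _ => ?_
  change lsch _ _ _ (tm φ y (ti φ y _)) • (tm φ y (ti φ y _)) = _
  rw [tm_ti hφ hy, tm_ti hφ hy, map_smul]

/-- Smoothness is asked only of the components near the given point, so that the formula also
applies to the section obtained by one covariant differentiation. -/
theorem tmF_prolonged (hD : IsSpecial D) (hφ : φ ∈ IsManifold.maximalAtlas (𝓡 n) ∞ M) {y : M}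
    (hy : y ∈ φ.source) {s : Π x : M, TFibre n x} (hs : ContDiffAt ℝ ∞ (trep φ s) (φ y))
    (v : Tangent n y) : tmF φ y (prolonged D s y v) =
      fderiv ℝ (trep φ s) (φ y) (tm φ y v) + tcon (gam D φ) (φ y) (tm φ y v) (trep φ s (φ y)) := by
  have k1 : ContDiffAt ℝ ∞ (srep φ fun z => (s z).1) (φ y) := hs.fst
  have k2 : ContDiffAt ℝ ∞ (rep φ fun z => (s z).2.1) (φ y) := hs.snd.fst
  have k3 : ContDiffAt ℝ ∞ ((fun z => (s z).2.2) ∘ φ.symm) (φ y) := hs.snd.snd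
  have d1 := k1.differentiableAt (by simp)
  have d2 := k2.differentiableAt (by simp)
  have d3 := k3.differentiableAt (by simp)
  have e0 : fderiv ℝ (trep φ s) (φ y) (tm φ y v) =
      (fderiv ℝ (srep φ fun z => (s z).1) (φ y) (tm φ y v),
        fderiv ℝ (rep φ fun z => (s z).2.1) (φ y) (tm φ y v),
        fderiv ℝ ((fun z => (s z).2.2) ∘ φ.symm) (φ y) (tm φ y v)) := by
    have := (d1.hasFDerivAt.prodMk (d2.hasFDerivAt.prodMk d3.hasFDerivAt)).fderiv
    exact congrArg (fun L => L (tm φ y v)) this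
  have f1 : (trep φ s (φ y)).1 = srep φ (fun z => (s z).1) (φ y) := rfl
  have f2 : (trep φ s (φ y)).2.1 = rep φ (fun z => (s z).2.1) (φ y) := rfl
  have f3 : (trep φ s (φ y)).2.2 = (s y).2.2 := by rw [trep_apply hy]; rfl
  have g1 : tmS φ y (s y).1 = srep φ (fun z => (s z).1) (φ y) :=
    (srep_apply (σ := fun z => (s z).1) hy).symm
  have g2 : tm φ y (s y).2.1 = rep φ (fun z => (s z).2.1) (φ y) :=
    (rep_apply (X := fun z => (s z).2.1) hy).symm
  have hw := tm_sum_comp_weyl hD hφ hy (s y).1 v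
  have hy' := sum_comp_cotton hD hφ hy (s y).1 v
  have hP := tm_sum_comp_schouten hD hφ hy (s y).1 v
  have m3 := mvfderiv_eq_fderiv hφ hy (g := fun z => (s z).2.2)
    (h := (fun z => (s z).2.2) ∘ φ.symm) d3 (by
      filter_upwards [eventually_source hy] with z hz
      exact congrArg (fun w => (s w).2.2) (φ.left_inv hz).symm) v
  have m2 := tm_conn D hφ hy (k := ∞) (by simp) infty_add_one_le (vfAt_of_rep hφ hy k2) v
  have m1 := tmS_nablaSym D hφ hy d1 v
  rw [e0, tcon_apply, tmF_apply, f1, f2, f3]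
  simp only [prolonged, Prod.mk_add_mk, Prod.mk.injEq]
  refine ⟨?_, ?_, ?_⟩
  · rw [map_sub, m1, tmS_symProd, g2, add_sub_assoc]
  · rw [map_sub, map_add, map_sub, m2, map_smul, map_smul, hw, hP, g1]
    abel
  · rw [m3, hy', schouten_eq hD hφ hy, g1, g2]
    ring

theorem trep_prolonged (hD : IsSpecial D) (hφ : φ ∈ IsManifold.maximalAtlas (𝓡 n) ∞ M) {y : M}
    (hy : y ∈ φ.source) {s : Π x : M, TFibre n x} (hs : SmoothT s) (X : Π x : M, Tangent n x) :
    trep φ (fun z => prolonged D s z (X z)) =ᶠ[𝓝 (φ y)] fun p =>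
      fderiv ℝ (trep φ s) p (rep φ X p) + tcon (gam D φ) p (rep φ X p) (trep φ s p) := by
  filter_upwards [φ.open_target.mem_nhds (φ.map_source hy)] with p hp
  have hz := φ.map_target hp
  have h := tmF_prolonged hD hφ hz (contDiffAt_trep hφ hz hs) (X (φ.symm p))
  rw [φ.right_inv hp] at h
  exact h

theorem tmF_prolonged_prolonged (hD : IsSpecial D) (hφ : φ ∈ IsManifold.maximalAtlas (𝓡 n) ∞ M)
    {y : M} (hy : y ∈ φ.source) {s : Π x : M, TFibre n x} (hs : SmoothT s)
    {Z : Π x : M, Tangent n x} (hZ : SmoothVF Z) (a : Tangent n y) :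
    tmF φ y (prolonged D (fun z => prolonged D s z (Z z)) y a) =
      fderiv ℝ (fun p => fderiv ℝ (trep φ s) p (rep φ Z p)
        + tcon (gam D φ) p (rep φ Z p) (trep φ s p)) (φ y) (tm φ y a)
      + tcon (gam D φ) (φ y) (tm φ y a) (fderiv ℝ (trep φ s) (φ y) (rep φ Z (φ y))
        + tcon (gam D φ) (φ y) (rep φ Z (φ y)) (trep φ s (φ y))) := by
  have rs := contDiffAt_trep hφ hy hs
  have rA := contDiffAt_tcon (contDiffAt_gam hD.smooth hφ (φ.map_source hy))
  have rZ := contDiffAt_rep hφ infty_add_one_le hy (hZ y)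
  have h1 := trep_prolonged hD hφ hy hs Z
  have h3 : ContDiffAt ℝ ∞ (fun p => fderiv ℝ (trep φ s) p (rep φ Z p)
      + tcon (gam D φ) p (rep φ Z p) (trep φ s p)) (φ y) :=
    ((rs.fderiv_right (m := ∞) (by simp)).clm_apply rZ).add ((rA.clm_apply rZ).clm_apply rs)
  rw [tmF_prolonged hD hφ hy (h3.congr_of_eventuallyEq h1), h1.fderiv_eq, h1.self_of_nhds]

/-- Torsion-freeness expresses the bracket through the connection, and the Christoffel terms cancel
by symmetry. -/
theorem tm_mlieBracket (hD : IsSpecial D) (hφ : φ ∈ IsManifold.maximalAtlas (𝓡 n) ∞ M) {y : M}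
    (hy : y ∈ φ.source) {X Y : Π x : M, Tangent n x} (hX : SmoothVF X) (hY : SmoothVF Y) :
    tm φ y (VectorField.mlieBracket (𝓡 n) X Y y) =
      fderiv ℝ (rep φ Y) (φ y) (rep φ X (φ y)) - fderiv ℝ (rep φ X) (φ y) (rep φ Y (φ y)) := by
  have hb := D.torsion_eq_zero_iff.1 hD.torsion_free ((hX y).mdifferentiableAt (by simp))
    ((hY y).mdifferentiableAt (by simp))
  rw [← hb, map_sub, tm_conn D hφ hy (k := ∞) (by simp) infty_add_one_le (hX y),
    tm_conn D hφ hy (k := ∞) (by simp) infty_add_one_le (hY y), ← rep_apply hy, ← rep_apply hy,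
    gam_symm hD.torsion_free hφ (φ.map_source hy)]
  abel

theorem tmF_curvature (hD : IsSpecial D) (hφ : φ ∈ IsManifold.maximalAtlas (𝓡 n) ∞ M) {y : M}
    (hy : y ∈ φ.source) {s : Π x : M, TFibre n x} (hs : SmoothT s) {X Y : Π x : M, Tangent n x}
    (hX : SmoothVF X) (hY : SmoothVF Y) :
    tmF φ y (prolonged D (fun z => prolonged D s z (Y z)) y (X y)
        - prolonged D (fun z => prolonged D s z (X z)) y (Y y)
        - prolonged D s y (VectorField.mlieBracket (𝓡 n) X Y y)) =
      fcurv (tcon (gam D φ)) (φ y) (tm φ y (X y)) (tm φ y (Y y)) (tmF φ y (s y)) := by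
  have rs := contDiffAt_trep hφ hy hs
  have rX := contDiffAt_rep hφ infty_add_one_le hy (hX y)
  have rY := contDiffAt_rep hφ infty_add_one_le hy (hY y)
  have rA := contDiffAt_tcon (contDiffAt_gam hD.smooth hφ (φ.map_source hy))
  have eX : tm φ y (X y) = rep φ X (φ y) := (rep_apply hy).symm
  have eY : tm φ y (Y y) = rep φ Y (φ y) := (rep_apply hy).symm
  have es : tmF φ y (s y) = trep φ s (φ y) := (trep_apply hy).symm
  have h := fcurv_eq (rA.differentiableAt (by simp)) rs (rX.differentiableAt (by simp))
    (rY.differentiableAt (by simp))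
  rw [eX, eY, es, ← h]
  refine (map_sub (tmF φ y) _ _).trans (congrArg₂ _ ((map_sub (tmF φ y) _ _).trans
    (congrArg₂ _ ?_ ?_)) ?_)
  · rw [tmF_prolonged_prolonged hD hφ hy hs hY, eX]
  · rw [tmF_prolonged_prolonged hD hφ hy hs hX, eY]
  · rw [tmF_prolonged hD hφ hy rs, tm_mlieBracket hD hφ hy hX hY]

end ProlongationTransfer

/-! ### Algebraic identities of the curvature tensors -/

section PointwiseAlgebra

open Filter Topology

variable {n : ℕ} {U : Set (Model n)} {Γ : Christoffel n} {p : Model n}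

theorem lcurv_antisymm (Γ : Christoffel n) (p u v w : Model n) :
    lcurv Γ p u v w = -lcurv Γ p v u w := by
  simp only [lcurv_apply]
  abel

theorem fderiv_apply₂ {E F G H : Type*} [NormedAddCommGroup E] [NormedSpace ℝ E]
    [NormedAddCommGroup F] [NormedSpace ℝ F] [NormedAddCommGroup G] [NormedSpace ℝ G]
    [NormedAddCommGroup H] [NormedSpace ℝ H] {B : E → F →L[ℝ] G →L[ℝ] H} {p : E}
    (hB : DifferentiableAt ℝ B p) (u : E) (v : F) (w : G) :
    fderiv ℝ (fun q => B q v w) p u = fderiv ℝ B p u v w := by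
  have e := ((hB.hasFDerivAt.clm_apply (hasFDerivAt_const v p)).clm_apply
    (hasFDerivAt_const w p)).fderiv
  refine (congrArg (fun L => L u) e).trans ?_
  simp

theorem LSpecial.differentiableAt (h : LSpecial U Γ) (hp : p ∈ U) : DifferentiableAt ℝ Γ p :=
  (h.smooth p hp).differentiableAt (by simp)

theorem LSpecial.fderiv_symm (h : LSpecial U Γ) (hp : p ∈ U) (u v w : Model n) :
    fderiv ℝ Γ p u v w = fderiv ℝ Γ p u w v := by
  have hd := h.differentiableAt hp
  rw [← fderiv_apply₂ hd, ← fderiv_apply₂ hd]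
  have : (fun q => Γ q v w) =ᶠ[𝓝 p] fun q => Γ q w v := by
    filter_upwards [h.isOpen.mem_nhds hp] with q hq using h.symm q hq v w
  rw [this.fderiv_eq]

/-- Since Γ is symmetric, the derivative terms and the quadratic terms cancel in pairs in the cyclic
sum. -/
theorem LSpecial.bianchi (h : LSpecial U Γ) (hp : p ∈ U) (u v w : Model n) :
    lcurv Γ p u v w + lcurv Γ p v w u + lcurv Γ p w u v = 0 := by
  simp only [lcurv_apply]
  rw [h.fderiv_symm hp u v w, h.fderiv_symm hp v w u, h.fderiv_symm hp w u v,
    h.symm p hp v w, h.symm p hp u w, h.symm p hp u v]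
  abel

/-- Contracting the Bianchi identity, the skew part of the Ricci tensor is the trace of the
curvature endomorphism, which vanishes. -/
theorem LSpecial.lric_symm (h : LSpecial U Γ) (hp : p ∈ U) (v w : Model n) :
    lric Γ p v w = lric Γ p w v := by
  have h1 : ∑ i, pr i (lcurv Γ p (bs i) v w + lcurv Γ p v w (bs i) + lcurv Γ p w (bs i) v) = 0 :=
    Finset.sum_eq_zero fun i _ => by rw [h.bianchi hp, map_zero]
  have h2 := h.trace p hp v w
  simp only [lcurv_antisymm Γ p w (bs _), map_add, map_neg, Finset.sum_add_distrib,
    Finset.sum_neg_distrib] at h1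
  rw [ltr] at h2
  rw [lric_apply, lric_apply]
  linarith

theorem LSpecial.lsch_symm (h : LSpecial U Γ) (hp : p ∈ U) (v w : Model n) :
    lsch Γ p v w = lsch Γ p w v := by
  rw [lsch_apply, lsch_apply, h.lric_symm hp]

theorem LSpecial.lsch_differentiableAt (h : LSpecial U Γ) (hp : p ∈ U) :
    DifferentiableAt ℝ (lsch Γ) p :=
  (contDiffAt_lsch (h.smooth p hp)).differentiableAt (by simp)

theorem LSpecial.lnablaSch_symm (h : LSpecial U Γ) (hp : p ∈ U) (u v w : Model n) :
    lnablaSch Γ p u v w = lnablaSch Γ p u w v := by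
  have hd := h.lsch_differentiableAt hp
  have : (fun q => lsch Γ q v w) =ᶠ[𝓝 p] fun q => lsch Γ q w v := by
    filter_upwards [h.isOpen.mem_nhds hp] with q hq using h.lsch_symm hq v w
  rw [lnablaSch, lnablaSch, ← fderiv_apply₂ hd, ← fderiv_apply₂ hd, this.fderiv_eq,
    h.lsch_symm hp _ w, h.lsch_symm hp v]
  ring

theorem lcotton_antisymm (Γ : Christoffel n) (p u v w : Model n) :
    lcotton Γ p u v w = -lcotton Γ p v u w := by
  simp only [lcotton]
  ring

theorem LSpecial.lcotton_cyclic (h : LSpecial U Γ) (hp : p ∈ U) (u v w : Model n) :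
    lcotton Γ p u v w + lcotton Γ p v w u + lcotton Γ p w u v = 0 := by
  simp only [lcotton]
  rw [h.lnablaSch_symm hp u v w, h.lnablaSch_symm hp v w u, h.lnablaSch_symm hp w u v]
  ring

theorem lweyl_antisymm (Γ : Christoffel n) (p u v w : Model n) :
    lweyl Γ p u v w = -lweyl Γ p v u w := by
  rw [lweyl, lweyl, lcurv_antisymm]
  abel

theorem LSpecial.lweyl_bianchi (h : LSpecial U Γ) (hp : p ∈ U) (u v w : Model n) :
    lweyl Γ p u v w + lweyl Γ p v w u + lweyl Γ p w u v = 0 := by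
  have hb := h.bianchi hp u v w
  simp only [lweyl]
  rw [h.lsch_symm hp w v, h.lsch_symm hp u w, h.lsch_symm hp v u, ← hb]
  abel

theorem sum_pr_bs : ∑ i : Fin n, pr i (bs i) = (n : ℝ) := by
  simp

theorem sum_pr_mul (α : Model n →L[ℝ] ℝ) (v : Model n) : ∑ i, pr i v * α (bs i) = α v := by
  conv_rhs => rw [← sum_pr_smul v, map_sum]
  simp only [map_smul, smul_eq_mul]

/-- The two Schouten terms contribute n - 1 times P, which the normalisation of P matches to the
Ricci tensor. -/
theorem sum_lweyl_left (hn : 2 ≤ n) (Γ : Christoffel n) (p v w : Model n) :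
    ∑ i, pr i (lweyl Γ p (bs i) v w) = 0 := by
  have hn' : (n : ℝ) - 1 ≠ 0 := by
    have : (2 : ℝ) ≤ n := by exact_mod_cast hn
    linarith
  have h1 : lric Γ p v w = ((n : ℝ) - 1) * lsch Γ p v w := by
    rw [lsch_apply]
    field_simp
  have h2 : ∑ i, pr i v * lsch Γ p (bs i) w = lsch Γ p v w :=
    sum_pr_mul ((lsch Γ p).flip w) v
  simp only [lweyl, map_add, map_sub, map_smul, smul_eq_mul, Finset.sum_add_distrib,
    Finset.sum_sub_distrib, ← Finset.mul_sum]
  rw [sum_pr_bs, ← lric_apply, h1]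
  simp only [mul_comm (lsch Γ p (bs _) w)]
  rw [h2]
  ring

/-- The other trace vanishes because tr R = 0 and P is symmetric; both rest on the parallel volume
form. -/
theorem LSpecial.sum_lweyl_right (h : LSpecial U Γ) (hp : p ∈ U) (u v : Model n) :
    ∑ i, pr i (lweyl Γ p u v (bs i)) = 0 := by
  have h1 := h.trace p hp u v
  rw [ltr] at h1
  simp only [lweyl, map_add, map_sub, map_smul, smul_eq_mul, Finset.sum_add_distrib,
    Finset.sum_sub_distrib, mul_comm _ (pr _ _)]
  rw [h1, sum_pr_mul, sum_pr_mul, h.lsch_symm hp]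
  ring

/-- The Weyl curvature as a family of endomorphisms. -/
def lweylE (Γ : Christoffel n) (p u v : Model n) : Model n →L[ℝ] Model n :=
  lcurv Γ p u v - (lsch Γ p v).smulRight u + (lsch Γ p u).smulRight v

theorem lweylE_apply (Γ : Christoffel n) (p u v w : Model n) :
    lweylE Γ p u v w = lweyl Γ p u v w := rfl

theorem lweyl_add₃ (Γ : Christoffel n) (p u v w w' : Model n) :
    lweyl Γ p u v (w + w') = lweyl Γ p u v w + lweyl Γ p u v w' :=
  map_add (lweylE Γ p u v) w w'

theorem lweyl_smul₃ (Γ : Christoffel n) (p : Model n) (c : ℝ) (u v w : Model n) :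
    lweyl Γ p u v (c • w) = c • lweyl Γ p u v w :=
  map_smul (lweylE Γ p u v) c w

theorem sum_lsp {G : Type*} [AddCommGroup G] [Module ℝ G]
    (f : Model n →ₗ[ℝ] Model n →ₗ[ℝ] G) (a b : Model n) :
    ∑ j, f (lsp a b (pr j)) (bs j) = f a b + f b a := by
  have h : ∀ a b : Model n, ∑ j, pr j a • f b (bs j) = f b a := by
    intro a b
    simp only [← map_smul, ← map_sum]
    rw [sum_pr_smul]
  simp only [lsp_apply, map_add, map_smul, LinearMap.add_apply, LinearMap.smul_apply,
    Finset.sum_add_distrib]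
  rw [h, h]

theorem wtr_lsp (Γ : Christoffel n) (p v a b : Model n) :
    wtr Γ p v (lsp a b) = lweyl Γ p v a b + lweyl Γ p v b a :=
  sum_lsp (LinearMap.mk₂ ℝ (fun a b => lweyl Γ p v a b) (lweyl_add₂ Γ p v)
    (fun c => lweyl_smul₂ Γ p c v) (lweyl_add₃ Γ p v) (fun c => lweyl_smul₃ Γ p c v)) a b

theorem lnablaSch_add₃ (Γ : Christoffel n) (p u v w w' : Model n) :
    lnablaSch Γ p u v (w + w') = lnablaSch Γ p u v w + lnablaSch Γ p u v w' := by
  simp only [lnablaSch, map_add]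
  ring

theorem lnablaSch_smul₃ (Γ : Christoffel n) (p : Model n) (c : ℝ) (u v w : Model n) :
    lnablaSch Γ p u v (c • w) = c * lnablaSch Γ p u v w := by
  simp only [lnablaSch, map_smul, smul_eq_mul]
  ring

theorem ytr_lsp (Γ : Christoffel n) (p v a b : Model n) :
    ytr Γ p v (lsp a b) = lcotton Γ p v a b + lcotton Γ p v b a :=
  sum_lsp (LinearMap.mk₂ ℝ (fun a b => lcotton Γ p v a b)
    (fun a a' b => by simp only [lcotton, lnablaSch_add₁, lnablaSch_add₂]; ring)
    (fun c a b => by simp only [lcotton, lnablaSch_smul₁, lnablaSch_smul₂, smul_eq_mul]; ring)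
    (fun a b b' => by simp only [lcotton, lnablaSch_add₃]; ring)
    (fun c a b => by simp only [lcotton, lnablaSch_smul₃, smul_eq_mul]; ring)) a b

/-- The Weyl curvature vanishes if its action on symmetric tensors is of the form imposed by the
first integrability condition of the metrisability equation. -/
theorem LSpecial.lweyl_eq_zero (h : LSpecial U Γ) (hn : 2 ≤ n) (hp : p ∈ U) {u v : Model n}
    (H : ∀ a b, act (lweylE Γ p u v) (lsp a b)
      + (1 / (n : ℝ)) • (lsp u (wtr Γ p v (lsp a b)) - lsp v (wtr Γ p u (lsp a b))) = 0)
    (z : Model n) :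
    lweyl Γ p u v z = 0 := by
  have hn2 : (2 : ℝ) ≤ n := by exact_mod_cast hn
  have e1 : ∀ f, act (lweylE Γ p u v) (lsp (bs f) z) (pr f) =
      pr f z • lweyl Γ p u v (bs f) + lweyl Γ p u v z + (pr f (lweyl Γ p u v z) • bs f
        + pr f (lweyl Γ p u v (bs f)) • z) := by
    intro f
    rw [act_apply, lsp_apply, lsp_apply, map_add, map_smul, map_smul]
    simp only [ContinuousLinearMap.comp_apply, lweylE_apply]
    rw [pr_bs, if_pos rfl, one_smul]
  -- Of the four terms of `e1`, the first and third each sum to W z, the second to n W z, and the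
  -- last vanishes as a trace of W.
  have e2 : ∑ f, act (lweylE Γ p u v) (lsp (bs f) z) (pr f) =
      ((n : ℝ) + 2) • lweyl Γ p u v z := by
    simp only [e1, Finset.sum_add_distrib, ← Finset.sum_smul]
    rw [h.sum_lweyl_right hp, sum_pr_smul]
    have : ∑ f, pr f z • lweyl Γ p u v (bs f) = lweyl Γ p u v z := by
      simp only [← lweylE_apply, ← map_smul, ← map_sum]
      rw [sum_pr_smul]
    rw [this, Finset.sum_const, Finset.card_univ, Fintype.card_fin]
    module
  have e3 : ∀ u v : Model n, ∑ f, lsp u (wtr Γ p v (lsp (bs f) z)) (pr f) =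
      lweyl Γ p v u z + lweyl Γ p v z u := by
    intro u v
    have a1 : ∑ f, pr f (lweyl Γ p v (bs f) z) = 0 := by
      simp only [lweyl_antisymm Γ p v (bs _), map_neg, Finset.sum_neg_distrib]
      rw [sum_lweyl_left hn, neg_zero]
    have a2 : ∑ f, pr f u • lweyl Γ p v (bs f) z = lweyl Γ p v u z := by
      have hl : ∀ a, lweyl Γ p v a z = (LinearMap.mk₂ ℝ (fun a b => lweyl Γ p v a b)
        (lweyl_add₂ Γ p v) (fun c => lweyl_smul₂ Γ p c v) (lweyl_add₃ Γ p v)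
        (fun c => lweyl_smul₃ Γ p c v)).flip z a := fun a => rfl
      simp only [hl, ← map_smul, ← map_sum]
      rw [sum_pr_smul]
    have a3 : ∑ f, pr f u • lweyl Γ p v z (bs f) = lweyl Γ p v z u := by
      simp only [← lweylE_apply, ← map_smul, ← map_sum]
      rw [sum_pr_smul]
    simp only [wtr_lsp, map_add, add_apply, lsp_apply, Finset.sum_add_distrib,
      ← Finset.sum_smul]
    rw [a1, a2, a3, h.sum_lweyl_right hp]
    module
  have e4 : ∑ f, (act (lweylE Γ p u v) (lsp (bs f) z)
      + (1 / (n : ℝ)) • (lsp u (wtr Γ p v (lsp (bs f) z)) - lsp v (wtr Γ p u (lsp (bs f) z))))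
      (pr f) = 0 := Finset.sum_eq_zero fun f _ => by
    rw [H]
    rfl
  simp only [add_apply, smul_apply, sub_apply, Finset.sum_add_distrib, ← Finset.smul_sum,
    Finset.sum_sub_distrib] at e4
  rw [e2, e3, e3] at e4
  have e5 := h.lweyl_bianchi hp u v z
  rw [lweyl_antisymm Γ p v u, lweyl_antisymm Γ p u z] at e4
  have e6 : lweyl Γ p v z u + lweyl Γ p z u v = -lweyl Γ p u v z := by
    rw [eq_neg_iff_add_eq_zero, ← e5]
    abel
  -- The Bianchi identity turns the correction terms into -3 W z, and the factor is positive since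
  -- 3/n ≤ 3/2.
  have e7 : ((n : ℝ) + 2 - 3 / n) • lweyl Γ p u v z = 0 := by
    calc ((n : ℝ) + 2 - 3 / n) • lweyl Γ p u v z = ((n : ℝ) + 2) • lweyl Γ p u v z
          + (1 / (n : ℝ)) • (-(2 : ℝ) • lweyl Γ p u v z + -lweyl Γ p u v z) := by module
      _ = 0 := by
        rw [← e6, ← e4]
        module
  refine (smul_eq_zero.1 e7).resolve_left ?_
  have h3 : 3 / (n : ℝ) ≤ 3 / 2 := div_le_div_of_nonneg_left (by norm_num) (by norm_num) hn2
  intro h0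
  linarith

end PointwiseAlgebra

/-! ### Curvature of the prolonged connection -/

section ProlongedCurvature

open Filter Topology

variable {n : ℕ} {U : Set (Model n)} {Γ : Christoffel n} {p : Model n}

/-- The action of endomorphisms on a given 2-tensor. -/
def actL (S : LTens n) : (Model n →L[ℝ] Model n) →L[ℝ] LTens n :=
  LinearMap.toContinuousLinearMap
    { toFun := fun A => act A S
      map_add' := fun A B => act_add_left A B S
      map_smul' := fun c A => act_smul_left c A S }

theorem actL_apply (S : LTens n) (A : Model n →L[ℝ] Model n) : actL S A = act A S := rfl

theorem act_sub_left (A B : Model n →L[ℝ] Model n) (S : LTens n) :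
    act (A - B) S = act A S - act B S := map_sub (actL S) A B

theorem act_sub_right (A : Model n →L[ℝ] Model n) (S T : LTens n) :
    act A (S - T) = act A S - act A T := by
  ext1 β
  simp only [act_apply, sub_apply, map_sub]
  abel

theorem act_lsp (A : Model n →L[ℝ] Model n) (u v : Model n) :
    act A (lsp u v) = lsp (A u) v + lsp u (A v) := by
  ext1 β
  simp only [act_apply, add_apply, lsp_apply, map_add, map_smul, ContinuousLinearMap.comp_apply]
  module

theorem act_act_sub (A B : Model n →L[ℝ] Model n) (S : LTens n) :
    act A (act B S) - act B (act A S) = act (A ∘L B - B ∘L A) S := by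
  ext1 β
  simp only [act_apply, sub_apply, map_add, ContinuousLinearMap.comp_apply,
    ContinuousLinearMap.comp_sub, map_sub, ContinuousLinearMap.comp_assoc]
  abel

theorem fderiv_triple {E F G H : Type*} [NormedAddCommGroup E] [NormedSpace ℝ E]
    [NormedAddCommGroup F] [NormedSpace ℝ F] [NormedAddCommGroup G] [NormedSpace ℝ G]
    [NormedAddCommGroup H] [NormedSpace ℝ H] {f : E → F} {g : E → G} {h : E → H} {p : E}
    {f' : F} {g' : G} {h' : H} {u : E} {f'' : E →L[ℝ] F} {g'' : E →L[ℝ] G} {h'' : E →L[ℝ] H}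
    (hf : HasFDerivAt f f'' p) (hg : HasFDerivAt g g'' p) (hh : HasFDerivAt h h'' p)
    (ef : f'' u = f') (eg : g'' u = g') (eh : h'' u = h') :
    fderiv ℝ (fun q => (f q, g q, h q)) p u = (f', g', h') := by
  rw [(hf.prodMk (hg.prodMk hh)).fderiv, ← ef, ← eg, ← eh]
  rfl

theorem fderiv_tcon (hΓ : ContDiffAt ℝ ∞ Γ p) (u v : Model n) (s : LFib n) :
    fderiv ℝ (tcon Γ) p u v s = (act (fderiv ℝ Γ p u v) s.1,
      fderiv ℝ Γ p u v s.2.1 + s.1 (fderiv ℝ (lsch Γ) p u v)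
        - (1 / (n : ℝ)) • fderiv ℝ (wtr Γ) p u v s.1,
      2 * fderiv ℝ (lsch Γ) p u v s.2.1 - (4 / (n : ℝ)) * fderiv ℝ (ytr Γ) p u v s.1) := by
  have d1 := (hΓ.differentiableAt (by simp)).hasFDerivAt
  have d2 := ((contDiffAt_lsch hΓ).differentiableAt (by simp)).hasFDerivAt
  have d3 := ((contDiffAt_wtr hΓ).differentiableAt (by simp)).hasFDerivAt
  have d4 := ((contDiffAt_ytr hΓ).differentiableAt (by simp)).hasFDerivAt
  have dv := hasFDerivAt_const (𝕜 := ℝ) v p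
  have c1 := hasFDerivAt_const (𝕜 := ℝ) s.1 p
  have c2 := hasFDerivAt_const (𝕜 := ℝ) s.2.1 p
  have g1 : HasFDerivAt (fun q => act (Γ q v) s.1 - lsp v s.2.1) _ p :=
    ((actL s.1).hasFDerivAt.comp p (d1.clm_apply dv)).sub_const (lsp v s.2.1)
  have g2 : HasFDerivAt (fun q => Γ q v s.2.1 - s.2.2 • v + s.1 (lsch Γ q v)
      - (1 / (n : ℝ)) • wtr Γ q v s.1) _ p :=
    ((((d1.clm_apply dv).clm_apply c2).sub_const (s.2.2 • v)).add
    (s.1.hasFDerivAt.comp p (d2.clm_apply dv))).sub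
    (((d3.clm_apply dv).clm_apply c1).const_smul (1 / (n : ℝ)))
  have g3 : HasFDerivAt (fun q => 2 * lsch Γ q v s.2.1 - (4 / (n : ℝ)) * ytr Γ q v s.1) _ p :=
    (((d2.clm_apply dv).clm_apply c2).const_mul 2).sub
    (((d4.clm_apply dv).clm_apply c1).const_mul (4 / (n : ℝ)))
  refine (fderiv_apply₂ ((contDiffAt_tcon hΓ).differentiableAt (by simp)) u v s).symm.trans ?_
  refine fderiv_triple g1 g2 g3 ?_ ?_ ?_
  · simp [actL_apply]
  · simp
  · simp

theorem lcurv_eq (Γ : Christoffel n) (p u v : Model n) : lcurv Γ p u v =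
    fderiv ℝ Γ p u v - fderiv ℝ Γ p v u + ((Γ p u) ∘L (Γ p v) - (Γ p v) ∘L (Γ p u)) := by
  ext1 w
  rw [lcurv_apply]
  simp only [add_apply, sub_apply, ContinuousLinearMap.comp_apply]
  abel

theorem act_lcurv (Γ : Christoffel n) (p u v : Model n) {S : LTens n}
    (hS : S ∈ lsym n) : act (lcurv Γ p u v) S = act (lweylE Γ p u v) S
      + lsp u (S (lsch Γ p v)) - lsp v (S (lsch Γ p u)) := by
  ext1 β
  have h1 : ∀ v u : Model n, β ∘L (lsch Γ p v).smulRight u = β u • lsch Γ p v := by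
    intro v u
    ext1 w
    simp [mul_comm]
  have h2 : ∀ v, lsch Γ p v (S β) = β (S (lsch Γ p v)) := fun v => hS _ _
  have h3 : lcurv Γ p u v = lweylE Γ p u v + (lsch Γ p v).smulRight u
      - (lsch Γ p u).smulRight v := by
    rw [lweylE]
    abel
  rw [h3, act_apply, ContinuousLinearMap.comp_sub, ContinuousLinearMap.comp_add, h1, h1]
  simp only [sub_apply, add_apply, act_apply, lsp_apply, map_sub, map_add, map_smul,
    ContinuousLinearMap.smulRight_apply, h2]
  abel

theorem tcon_fst (Γ : Christoffel n) (p v : Model n) (s : LFib n) :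
    (tcon Γ p v s).1 = act (Γ p v) s.1 - lsp v s.2.1 := rfl

theorem tcon_snd_fst (Γ : Christoffel n) (p v : Model n) (s : LFib n) : (tcon Γ p v s).2.1 =
    Γ p v s.2.1 - s.2.2 • v + s.1 (lsch Γ p v) - (1 / (n : ℝ)) • wtr Γ p v s.1 := rfl

theorem tcon_snd_snd (Γ : Christoffel n) (p v : Model n) (s : LFib n) : (tcon Γ p v s).2.2 =
    2 * lsch Γ p v s.2.1 - (4 / (n : ℝ)) * ytr Γ p v s.1 := rfl

theorem fcurv_tcon (hΓ : ContDiffAt ℝ ∞ Γ p) (u v : Model n) (s : LFib n) :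
    fcurv (tcon Γ) p u v s =
      (act (fderiv ℝ Γ p u v) s.1 - act (fderiv ℝ Γ p v u) s.1
        + (act (Γ p u) (tcon Γ p v s).1 - lsp u (tcon Γ p v s).2.1)
        - (act (Γ p v) (tcon Γ p u s).1 - lsp v (tcon Γ p u s).2.1),
      fderiv ℝ Γ p u v s.2.1 + s.1 (fderiv ℝ (lsch Γ) p u v)
          - (1 / (n : ℝ)) • fderiv ℝ (wtr Γ) p u v s.1
        - (fderiv ℝ Γ p v u s.2.1 + s.1 (fderiv ℝ (lsch Γ) p v u)
          - (1 / (n : ℝ)) • fderiv ℝ (wtr Γ) p v u s.1)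
        + (Γ p u (tcon Γ p v s).2.1 - (tcon Γ p v s).2.2 • u + (tcon Γ p v s).1 (lsch Γ p u)
          - (1 / (n : ℝ)) • wtr Γ p u (tcon Γ p v s).1)
        - (Γ p v (tcon Γ p u s).2.1 - (tcon Γ p u s).2.2 • v + (tcon Γ p u s).1 (lsch Γ p v)
          - (1 / (n : ℝ)) • wtr Γ p v (tcon Γ p u s).1),
      2 * fderiv ℝ (lsch Γ) p u v s.2.1 - (4 / (n : ℝ)) * fderiv ℝ (ytr Γ) p u v s.1
        - (2 * fderiv ℝ (lsch Γ) p v u s.2.1 - (4 / (n : ℝ)) * fderiv ℝ (ytr Γ) p v u s.1)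
        + (2 * lsch Γ p u (tcon Γ p v s).2.1 - (4 / (n : ℝ)) * ytr Γ p u (tcon Γ p v s).1)
        - (2 * lsch Γ p v (tcon Γ p u s).2.1 - (4 / (n : ℝ)) * ytr Γ p v (tcon Γ p u s).1)) := by
  rw [fcurv]
  exact congrArg₂ (· - ·) (congrArg₂ (· + ·) (congrArg₂ (· - ·) (fderiv_tcon hΓ u v s)
    (fderiv_tcon hΓ v u s)) (tcon_apply Γ p u (tcon Γ p v s))) (tcon_apply Γ p v (tcon Γ p u s))

/-- By `act_lcurv` the full curvature acts as W plus Schouten terms. The term P σ in the μ-entry of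
the connection is there to cancel the latter, and ρ drops out because u ⊙ v is symmetric; only the
Weyl correction is left over. -/
theorem LSpecial.fcurv_tcon_fst (h : LSpecial U Γ) (hp : p ∈ U) (u v : Model n) {s : LFib n}
    (hs : s.1 ∈ lsym n) : (fcurv (tcon Γ) p u v s).1 = act (lweylE Γ p u v) s.1
      + (1 / (n : ℝ)) • (lsp u (wtr Γ p v s.1) - lsp v (wtr Γ p u s.1)) := by
  have e1 := act_lcurv Γ p u v hs
  rw [lcurv_eq, act_add_left, act_sub_left, ← act_act_sub] at e1
  have e2 : act (lweylE Γ p u v) s.1 = act (fderiv ℝ Γ p u v) s.1 - act (fderiv ℝ Γ p v u) s.1 +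
      (act (Γ p u) (act (Γ p v) s.1) - act (Γ p v) (act (Γ p u) s.1))
      + lsp v (s.1 (lsch Γ p u)) - lsp u (s.1 (lsch Γ p v)) := by
    rw [e1]
    abel
  rw [fcurv_tcon (h.smooth p hp), e2]
  dsimp only
  simp only [tcon_fst, tcon_snd_fst, act_sub_right, act_lsp, map_sub, map_add, map_smul]
  rw [h.symm p hp u v, lsp_comm u v]
  module

theorem fderiv_wtr_eq_zero (hU : IsOpen U) (hp : p ∈ U)
    (hW : ∀ q ∈ U, ∀ u v w, lweyl Γ q u v w = 0) : fderiv ℝ (wtr Γ) p = 0 := by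
  have : wtr Γ =ᶠ[𝓝 p] fun _ => 0 := by
    filter_upwards [hU.mem_nhds hp] with q hq
    ext1 v; ext1 S
    rw [wtr_apply]
    exact Finset.sum_eq_zero fun j _ => hW q hq _ _ _
  rw [this.fderiv_eq]
  exact fderiv_const_apply _

theorem fderiv_ytr_eq_zero (hU : IsOpen U) (hp : p ∈ U)
    (hY : ∀ q ∈ U, ∀ u v w, lcotton Γ q u v w = 0) : fderiv ℝ (ytr Γ) p = 0 := by
  have : ytr Γ =ᶠ[𝓝 p] fun _ => 0 := by
    filter_upwards [hU.mem_nhds hp] with q hq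
    ext1 v; ext1 S
    rw [ytr_apply]
    exact Finset.sum_eq_zero fun j _ => hY q hq _ _ _
  rw [this.fderiv_eq]
  exact fderiv_const_apply _

/-- The exterior covariant derivative of the Schouten tensor is twice the Cotton–York tensor. -/
theorem LSpecial.two_lcotton (h : LSpecial U Γ) (hp : p ∈ U) (u v w : Model n) :
    2 * lcotton Γ p u v w = fderiv ℝ (lsch Γ) p u v w - fderiv ℝ (lsch Γ) p v u w
      + lsch Γ p u (Γ p v w) - lsch Γ p v (Γ p u w) := by
  rw [lcotton, lnablaSch, lnablaSch, h.symm p hp v u]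
  ring

/-- Vanishing is assumed on an open set because the connection form contains W and Y and is
differentiated. The μ-entry then reduces to σ contracted with Y plus W acting on μ, and the ρ-entry
to Y on μ plus a term that cancels by the symmetry of σ. -/
theorem LSpecial.fcurv_tcon_eq_zero (h : LSpecial U Γ) (hp : p ∈ U)
    (hW : ∀ q ∈ U, ∀ u v w, lweyl Γ q u v w = 0) (hY : ∀ q ∈ U, ∀ u v w, lcotton Γ q u v w = 0)
    (u v : Model n) {s : LFib n} (hs : s.1 ∈ lsym n) : fcurv (tcon Γ) p u v s = 0 := by
  have w0 : ∀ v S, wtr Γ p v S = 0 := fun v S => by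
    rw [wtr_apply]
    exact Finset.sum_eq_zero fun j _ => hW p hp _ _ _
  have y0 : ∀ v S, ytr Γ p v S = 0 := fun v S => by
    rw [ytr_apply]
    exact Finset.sum_eq_zero fun j _ => hY p hp _ _ _
  have y1 := fun w => (h.two_lcotton hp u v w).symm.trans (by rw [hY p hp, mul_zero])
  refine Prod.ext ?_ (Prod.ext ?_ ?_)
  · rw [h.fcurv_tcon_fst hp u v hs, w0, w0]
    have : lweylE Γ p u v = 0 := by
      ext1 w
      exact hW p hp u v w
    rw [this]
    simp [act]
  · rw [fcurv_tcon (h.smooth p hp), fderiv_wtr_eq_zero h.isOpen hp hW]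
    have e1 : s.1 (fderiv ℝ (lsch Γ) p u v) - s.1 (fderiv ℝ (lsch Γ) p v u)
        + s.1 (lsch Γ p u ∘L Γ p v) - s.1 (lsch Γ p v ∘L Γ p u) = 0 := by
      rw [← map_sub, ← map_add, ← map_sub]
      refine (congrArg s.1 ?_).trans (map_zero s.1)
      ext1 w
      exact y1 w
    have e2 := hW p hp u v s.2.1
    rw [lweyl, lcurv_apply] at e2
    dsimp only
    simp only [w0, tcon_fst, tcon_snd_fst, tcon_snd_snd, y0]
    simp only [sub_apply, act_apply, lsp_apply, map_sub, map_add, map_smul, zero_apply,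
      smul_zero, mul_zero, sub_zero]
    rw [h.lsch_symm hp v u, h.symm p hp v u]
    change _ = (0 : Model n)
    linear_combination (norm := module) e1 + e2
  · rw [fcurv_tcon (h.smooth p hp), fderiv_ytr_eq_zero h.isOpen hp hY]
    have e1 := y1 s.2.1
    have e2 := hs (lsch Γ p u) (lsch Γ p v)
    dsimp only
    simp only [w0, tcon_fst, tcon_snd_fst, y0]
    simp only [map_sub, map_add, map_smul, zero_apply, smul_zero, mul_zero, sub_zero, smul_eq_mul]
    rw [h.lsch_symm hp v u]
    change _ = (0 : ℝ)
    linear_combination 2 * e1 + 2 * e2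

/-- The exterior derivative of 2P contributes 4Y. The correction -(4/n) Yσ is applied to -v ⊙ w and
-u ⊙ w, and the cyclic identity collects those terms into (12/n) Y. -/
theorem LSpecial.fcurv_tcon_snd_snd (h : LSpecial U Γ) (hp : p ∈ U) (u v w : Model n) :
    (fcurv (tcon Γ) p u v (0, w, 0)).2.2 = (4 + 12 / (n : ℝ)) * lcotton Γ p u v w := by
  rw [fcurv_tcon (h.smooth p hp)]
  have a0 : ∀ A : Model n →L[ℝ] Model n, act A 0 = 0 := fun A => by simp [act]
  dsimp only
  simp only [tcon_fst, tcon_snd_fst, a0, map_zero, zero_sub, map_neg, ytr_lsp]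
  simp only [zero_apply, zero_smul, sub_zero, smul_zero, add_zero, mul_zero]
  have e1 := h.two_lcotton hp u v w
  have e2 := h.lcotton_cyclic hp u w v
  rw [lcotton_antisymm Γ p v u w]
  rw [lcotton_antisymm Γ p w v, lcotton_antisymm Γ p v u w] at e2
  linear_combination -2 * e1 + 4 / (n : ℝ) * e2

theorem LSpecial.lcotton_eq_zero (h : LSpecial U Γ) (hp : p ∈ U) (hn : 2 ≤ n) {u v m : Model n}
    (H : (fcurv (tcon Γ) p u v (0, m, 0)).2.2 = 0) : lcotton Γ p u v m = 0 := by
  have hn0 : (0 : ℝ) < n := by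
    have : 0 < n := by omega
    exact_mod_cast this
  rw [h.fcurv_tcon_snd_snd hp] at H
  exact (mul_eq_zero.1 H).resolve_left (by positivity)

end ProlongedCurvature

/-! ### Vanishing of the prolonged curvature and the tensors W, Y -/

section ProlongedFlat

open Filter Topology

variable {n : ℕ} {M : Type*} [TopologicalSpace M] [ChartedSpace (Model n) M]
  [IsManifold (𝓡 n) ∞ M] {φ : OpenPartialHomeomorph M (Model n)} {D : Connection n M}

/-- The Weyl and Cotton–York tensors vanish identically. -/
def WeylFlat (D : Connection n M) : Prop :=
  ∀ (x : M) (u v w : Tangent n x), weyl D x u v w = 0 ∧ cotton D x u v w = 0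

/-- The Weyl and Cotton–York tensors vanish identically in coordinates. -/
def LWeylFlat (U : Set (Model n)) (Γ : Christoffel n) : Prop :=
  ∀ p ∈ U, ∀ u v w, lweyl Γ p u v w = 0 ∧ lcotton Γ p u v w = 0

variable [T2Space M]

theorem WeylFlat.chart (hD : IsSpecial D) (hφ : φ ∈ IsManifold.maximalAtlas (𝓡 n) ∞ M)
    (h : WeylFlat D) : LWeylFlat φ.target (gam D φ) := by
  intro p hp u v w
  have hy := φ.map_target hp
  have h1 := h (φ.symm p) (ti φ _ u) (ti φ _ v) (ti φ _ w)
  have h2 := tm_weyl hD hφ hy (ti φ _ u) (ti φ _ v) (ti φ _ w)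
  have h3 := cotton_eq hD hφ hy (ti φ _ u) (ti φ _ v) (ti φ _ w)
  rw [h1.1, map_zero, tm_ti hφ hy, tm_ti hφ hy, tm_ti hφ hy, φ.right_inv hp] at h2
  rw [h1.2, tm_ti hφ hy, tm_ti hφ hy, tm_ti hφ hy, φ.right_inv hp] at h3
  exact ⟨h2.symm, h3.symm⟩

theorem weylFlat_of_charts (hD : IsSpecial D)
    (h : ∀ y : M, ∃ φ ∈ IsManifold.maximalAtlas (𝓡 n) ∞ M, y ∈ φ.source ∧
      LWeylFlat φ.target (gam D φ)) : WeylFlat D := by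
  intro y u v w
  obtain ⟨φ, hφ, hy, hf⟩ := h y
  obtain ⟨h1, h2⟩ := hf _ (φ.map_source hy) (tm φ y u) (tm φ y v) (tm φ y w)
  refine ⟨?_, by rw [cotton_eq hD hφ hy, h2]⟩
  rw [← ti_tm hφ hy (weyl D y u v w), tm_weyl hD hφ hy, h1, map_zero]

theorem smoothT_symProd {X Z V : Π x : M, Tangent n x} (hX : SmoothVF X) (hZ : SmoothVF Z)
    (hV : SmoothVF V) : SmoothT fun x : M => (symProd (X x) (Z x), V x, (0 : ℝ)) :=
  ⟨smoothSym_symProd hX hZ, hV, contMDiff_const⟩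

/-- Sections whose σ-entry is a symmetric product of two global vector fields suffice as tests; this
avoids extending arbitrary tensors. -/
theorem fcurv_eq_zero_of_prolonged (hD : IsSpecial D) (H : ProlongedCurvatureVanishes D)
    (hφ : φ ∈ IsManifold.maximalAtlas (𝓡 n) ∞ M) {p : Model n} (hp : p ∈ φ.target)
    (u v a b c : Model n) : fcurv (tcon (gam D φ)) p u v (lsp a b, c, 0) = 0 := by
  have hy := φ.map_target hp
  have ex := fun w => exists_smoothVF_cfield hφ hy w
  choose X hX hXe using ex
  have hv : ∀ w, tm φ (φ.symm p) (X w (φ.symm p)) = w := fun w => by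
    rw [(hXe w).self_of_nhds, cfield, tm_ti hφ hy]
  have hs := smoothT_symProd (hX a) (hX b) (hX c)
  have h := tmF_curvature hD hφ hy hs (hX u) (hX v)
  rw [H (X u) (X v) (hX u) (hX v) _ hs (φ.symm p), map_zero, φ.right_inv hp, hv, hv, tmF_apply,
    tmS_symProd, hv, hv, hv] at h
  exact h.symm

/-- Forwards, W is read off from the sections (a ⊙ b, 0, 0) and Y from (0, w, 0). Backwards, `tmF`
is injective on fibres and the coordinate curvature vanishes. -/
theorem prolongedCurvatureVanishes_iff (hn : 2 ≤ n) (hD : IsSpecial D) :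
    ProlongedCurvatureVanishes D ↔ WeylFlat D := by
  constructor
  · intro H
    refine weylFlat_of_charts hD fun y => ⟨chartAt (Model n) y,
      IsManifold.chart_mem_maximalAtlas y, mem_chart_source _ y, ?_⟩
    have hφ : chartAt (Model n) y ∈ IsManifold.maximalAtlas (𝓡 n) ∞ M :=
      IsManifold.chart_mem_maximalAtlas y
    have hL := lspecial_gam hD hφ
    intro p hp u v w
    have key := fun a b c => fcurv_eq_zero_of_prolonged hD H hφ hp u v a b c
    refine ⟨hL.lweyl_eq_zero hn hp (fun a b => ?_) w, hL.lcotton_eq_zero hp hn ?_⟩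
    · rw [← hL.fcurv_tcon_fst hp u v (s := (lsp a b, 0, 0)) (lsp_mem a b), key]
      rfl
    · have h0 : lsp (0 : Model n) 0 = 0 := by rw [map_zero]
      rw [← h0, key]
      rfl
  · intro h X Y hX hY s hs y
    have hφ : chartAt (Model n) y ∈ IsManifold.maximalAtlas (𝓡 n) ∞ M :=
      IsManifold.chart_mem_maximalAtlas y
    have hy := mem_chart_source (Model n) y
    have hf := h.chart hD hφ
    refine tmF_injective hφ hy ?_
    rw [tmF_curvature hD hφ hy hs hX hY, map_zero]
    exact (lspecial_gam hD hφ).fcurv_tcon_eq_zero ((chartAt (Model n) y).map_source hy)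
      (fun q hq u v w => (hf q hq u v w).1) (fun q hq u v w => (hf q hq u v w).2) _ _
      (tmS_mem _ _ _)

end ProlongedFlat

/-! ### Flat projective structures have W = Y = 0 -/

section FlatModelCharts

open Filter Topology

variable {n : ℕ} {U : Set (Model n)} {Γ : Christoffel n}

theorem sum_pr_bs_self : ∑ i : Fin n, pr i (bs i) = (n : ℝ) := by
  simp

/-- For Γ built from θ the curvature is explicit; once θ is known to be closed, P = θ ⊗ θ - dθ with
dθ the full derivative, so that W = 0. Then Y = 0 follows from the symmetry of the second derivative
of θ. -/
theorem LSpecial.lweylFlat_of_proj (h : LSpecial U Γ) (hn : 2 ≤ n)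
    {θ : Model n → Model n →L[ℝ] ℝ} (hθ : ∀ p ∈ U, ContDiffAt ℝ ∞ θ p)
    (hΓ : ∀ p ∈ U, ∀ v w, Γ p v w = θ p v • w + θ p w • v) : LWeylFlat U Γ := by
  have hn1 : (n : ℝ) - 1 ≠ 0 := by
    have : (2 : ℝ) ≤ n := by exact_mod_cast hn
    linarith
  have hθd : ∀ p ∈ U, DifferentiableAt ℝ θ p := fun p hp => (hθ p hp).differentiableAt (by simp)
  have hθd' : ∀ p ∈ U, DifferentiableAt ℝ (fderiv ℝ θ) p := fun p hp =>
    (contDiffAt_fderiv (hθ p hp)).differentiableAt (by simp)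
  have dθ : ∀ p ∈ U, ∀ u v, fderiv ℝ (fun q => θ q v) p u = fderiv ℝ θ p u v := by
    intro p hp u v
    have := ((hθd p hp).hasFDerivAt.clm_apply (hasFDerivAt_const v p)).fderiv
    have e := congrArg (fun L => L u) this
    simpa using e
  have dΓ : ∀ p ∈ U, ∀ u v w, fderiv ℝ Γ p u v w =
      fderiv ℝ θ p u v • w + fderiv ℝ θ p u w • v := by
    intro p hp u v w
    rw [← fderiv_apply₂ (h.differentiableAt hp)]
    have he : (fun q => Γ q v w) =ᶠ[𝓝 p] fun q => θ q v • w + θ q w • v := by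
      filter_upwards [h.isOpen.mem_nhds hp] with q hq using hΓ q hq v w
    have h1 : ∀ v, DifferentiableAt ℝ (fun q => θ q v) p := fun v =>
      (hθd p hp).clm_apply (differentiableAt_const v)
    rw [he.fderiv_eq, fderiv_fun_add ((h1 v).smul_const w) ((h1 w).smul_const v),
      fderiv_smul_const (h1 v), fderiv_smul_const (h1 w)]
    simp only [add_apply, ContinuousLinearMap.smulRight_apply, dθ p hp]
  have hR0 : ∀ p ∈ U, ∀ u v w, lcurv Γ p u v w =
      (fderiv ℝ θ p u v - fderiv ℝ θ p v u) • w
        + (θ p v * θ p w - fderiv ℝ θ p v w) • u - (θ p u * θ p w - fderiv ℝ θ p u w) • v := by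
    intro p hp u v w
    rw [lcurv_apply, dΓ p hp, dΓ p hp]
    simp only [hΓ p hp, map_add, map_smul, smul_eq_mul]
    module
  have hsym : ∀ p ∈ U, ∀ u v, fderiv ℝ θ p u v = fderiv ℝ θ p v u := by
    intro p hp u v
    have ht := h.trace p hp u v
    simp only [ltr, hR0 p hp, map_add, map_sub, map_smul, smul_eq_mul, Finset.sum_add_distrib,
      Finset.sum_sub_distrib, ← Finset.mul_sum, sum_pr_bs_self] at ht
    have e1 : ∑ i : Fin n, (θ p v * θ p (bs i) - fderiv ℝ θ p v (bs i)) * pr i u =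
        θ p v * θ p u - fderiv ℝ θ p v u := by
      conv_rhs => rw [← sum_pr_smul u]
      simp only [map_sum, map_smul, smul_eq_mul, Finset.mul_sum, ← Finset.sum_sub_distrib]
      exact Finset.sum_congr rfl fun i _ => by ring
    have e2 : ∑ i : Fin n, (θ p u * θ p (bs i) - fderiv ℝ θ p u (bs i)) * pr i v =
        θ p u * θ p v - fderiv ℝ θ p u v := by
      conv_rhs => rw [← sum_pr_smul v]
      simp only [map_sum, map_smul, smul_eq_mul, Finset.mul_sum, ← Finset.sum_sub_distrib]
      exact Finset.sum_congr rfl fun i _ => by ring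
    rw [e1, e2] at ht
    -- The trace of the curvature is n + 1 times the exterior derivative of θ, so the parallel
    -- volume form makes θ closed.
    have hz : ((n : ℝ) + 1) * (fderiv ℝ θ p u v - fderiv ℝ θ p v u) = 0 := by
      linear_combination ht
    have := (mul_eq_zero.1 hz).resolve_left (by positivity)
    linarith
  have hR : ∀ p ∈ U, ∀ u v w, lcurv Γ p u v w =
      (θ p v * θ p w - fderiv ℝ θ p v w) • u - (θ p u * θ p w - fderiv ℝ θ p u w) • v := by
    intro p hp u v w
    rw [hR0 p hp, hsym p hp u v, sub_self, zero_smul, zero_add]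
  have hP : ∀ p ∈ U, ∀ v w, lsch Γ p v w = θ p v * θ p w - fderiv ℝ θ p v w := by
    intro p hp v w
    rw [lsch_apply, lric_apply, div_eq_iff hn1]
    simp only [hR p hp, map_sub, map_smul, smul_eq_mul, Finset.sum_sub_distrib, ← Finset.mul_sum,
      sum_pr_bs_self]
    have e1 : ∑ i : Fin n, (θ p (bs i) * θ p w - fderiv ℝ θ p (bs i) w) * pr i v =
        θ p v * θ p w - fderiv ℝ θ p v w := by
      rw [hsym p hp v w]
      conv_rhs => rw [← sum_pr_smul v]
      simp only [map_sum, map_smul, smul_eq_mul, Finset.sum_mul, ← Finset.sum_sub_distrib]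
      exact Finset.sum_congr rfl fun i _ => by rw [hsym p hp (bs i) w]; ring
    rw [e1]
    ring
  intro p hp u v w
  refine ⟨by rw [lweyl, hR p hp, hP p hp, hP p hp]; module, ?_⟩
  have dP : ∀ u v w, fderiv ℝ (lsch Γ) p u v w = fderiv ℝ θ p u v * θ p w
      + θ p v * fderiv ℝ θ p u w - fderiv ℝ (fderiv ℝ θ) p u v w := by
    intro u v w
    rw [← fderiv_apply₂ (h.lsch_differentiableAt hp)]
    have he : (fun q => lsch Γ q v w) =ᶠ[𝓝 p] fun q => θ q v * θ q w - fderiv ℝ θ q v w := by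
      filter_upwards [h.isOpen.mem_nhds hp] with q hq using hP q hq v w
    have h1 : ∀ v, DifferentiableAt ℝ (fun q => θ q v) p := fun v =>
      (hθd p hp).clm_apply (differentiableAt_const v)
    have h2 : DifferentiableAt ℝ (fun q => fderiv ℝ θ q v w) p :=
      ((hθd' p hp).clm_apply (differentiableAt_const v)).clm_apply (differentiableAt_const w)
    rw [he.fderiv_eq, fderiv_fun_sub ((h1 v).fun_mul (h1 w)) h2, fderiv_fun_mul (h1 v) (h1 w),
      sub_apply,
      fderiv_apply₂ (hθd' p hp)]
    simp only [add_apply, smul_apply, smul_eq_mul, dθ p hp]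
    ring
  have hs2 : fderiv ℝ (fderiv ℝ θ) p u v = fderiv ℝ (fderiv ℝ θ) p v u :=
    ((hθ p hp).isSymmSndFDerivAt (by simp; norm_cast)) u v
  have h2 := h.two_lcotton hp u v w
  rw [dP, dP, hs2, hP p hp, hP p hp] at h2
  simp only [hΓ p hp, map_add, map_smul, smul_eq_mul] at h2
  rw [hsym p hp u v] at h2
  linear_combination h2 / 2

variable {M : Type*} [TopologicalSpace M] [ChartedSpace (Model n) M]
  [IsManifold (𝓡 n) ∞ M] {φ : OpenPartialHomeomorph M (Model n)} {D : Connection n M}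

theorem tm_chartConnection (hφ : φ ∈ IsManifold.maximalAtlas (𝓡 n) ∞ M) {y : M}
    (hy : y ∈ φ.source) {X : Π x : M, Tangent n x} (hX : VFAt ∞ X y) (v : Tangent n y) :
    tm φ y (chartConnection φ X y v) = fderiv ℝ (rep φ X) (φ y) (tm φ y v) := by
  have h1 := mvfderiv_eq_fderiv hφ hy
    ((contDiffAt_rep hφ infty_add_one_le hy hX).differentiableAt (by simp))
    (g := fun z => mfderiv (𝓡 n) (𝓡 n) φ z (X z)) (by
      filter_upwards [eventually_source hy] with z hz using (rep_apply hz).symm) v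
  rw [← h1]
  exact tm_ti hφ hy _

variable [T2Space M]

/-- The coordinate connection has zero Christoffel symbols, so those of D are the difference tensor
with the sign of Υ reversed. -/
theorem gam_of_projEquivOn (hφ : φ ∈ IsManifold.maximalAtlas (𝓡 n) ∞ M)
    {Υ : Π x : M, Cotangent n x} (H : ∀ X : Π x : M, Tangent n x, SmoothVF X → ∀ x ∈ φ.source,
      ∀ v : Tangent n x, chartConnection φ X x v = D X x v + Υ x v • X x + Υ x (X x) • v)
    {p : Model n} (hp : p ∈ φ.target) (v w : Model n) :
    gam D φ p v w = (-frep φ Υ p) v • w + (-frep φ Υ p) w • v := by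
  have hy := φ.map_target hp
  obtain ⟨X, hX, hXe⟩ := exists_smoothVF_cfield hφ hy w
  have hXy : VFAt ∞ X (φ.symm p) := hX _
  have h := congrArg (tm φ (φ.symm p)) (H X hX _ hy (ti φ _ v))
  have e0 : X (φ.symm p) = ti φ (φ.symm p) w := hXe.self_of_nhds
  have h1 := tm_conn D hφ hy (k := ∞) (by simp) infty_add_one_le hXy (ti φ _ v)
  rw [tm_chartConnection hφ hy hXy, map_add, map_add, map_smul, map_smul, h1, e0,
    tm_ti hφ hy, tm_ti hφ hy, rep_apply hy, e0, tm_ti hφ hy, φ.right_inv hp] at h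
  have e1 : ∀ v, frep φ Υ p v = Υ (φ.symm p) (ti φ (φ.symm p) v) := fun v => rfl
  rw [neg_apply, neg_apply, e1, e1]
  linear_combination (norm := module) -h

theorem IsProjFlat.weylFlat (hn : 2 ≤ n) (hD : IsSpecial D) (H : IsProjFlat D) : WeylFlat D := by
  refine weylFlat_of_charts hD fun y => ?_
  obtain ⟨φ, hφ, hy, Υ, hΥ, h⟩ := H y
  refine ⟨φ, hφ, hy, (lspecial_gam hD hφ).lweylFlat_of_proj hn (θ := fun p => -frep φ Υ p)
    (fun p hp => ?_) fun p hp => gam_of_projEquivOn hφ h hp⟩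
  have h1 := contDiffAt_frep hφ (φ.map_target hp) (hΥ _ (φ.map_target hp))
  rw [φ.right_inv hp] at h1
  exact h1.neg

end FlatModelCharts

/-! ### The system ∇_a ∇_b f + P_ab f = 0 -/

section ProjectiveCoordinates

open Filter Topology Metric

variable {n : ℕ} {U : Set (Model n)} {Γ : Christoffel n} {G : Type} [NormedAddCommGroup G]
  [NormedSpace ℝ G] [FiniteDimensional ℝ G]

/-- The fibre of the bundle of 1-jets of `G`-valued functions on the model space. -/
abbrev JFib (n : ℕ) (G : Type) [NormedAddCommGroup G] [NormedSpace ℝ G] : Type :=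
  G × (Model n →L[ℝ] G)

instance : NormedAddCommGroup (Model n →L[ℝ] G) := ContinuousLinearMap.toNormedAddCommGroup
instance : NormedSpace ℝ (Model n →L[ℝ] G) := ContinuousLinearMap.toNormedSpace
instance : NormedAddCommGroup (JFib n G) := Prod.normedAddCommGroup
instance : NormedSpace ℝ (JFib n G) := Prod.normedSpace
instance : FiniteDimensional ℝ (Model n →L[ℝ] G) :=
  (LinearMap.toContinuousLinearMap (𝕜 := ℝ) (E := Model n) (F' := G)).finiteDimensional
instance : FiniteDimensional ℝ (JFib n G) := Module.Finite.prod
instance : NormedAddCommGroup (JFib n G →L[ℝ] JFib n G) :=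
  ContinuousLinearMap.toNormedAddCommGroup
instance : NormedSpace ℝ (JFib n G →L[ℝ] JFib n G) := ContinuousLinearMap.toNormedSpace
instance : NormedAddCommGroup (Model n →L[ℝ] JFib n G →L[ℝ] JFib n G) :=
  ContinuousLinearMap.toNormedAddCommGroup
instance : NormedSpace ℝ (Model n →L[ℝ] JFib n G →L[ℝ] JFib n G) :=
  ContinuousLinearMap.toNormedSpace

/-- The linear system, in first-order form, `∇_a ∇_b f + P_{ab} f = 0`. -/
def jcon (G : Type) [NormedAddCommGroup G] [NormedSpace ℝ G] [FiniteDimensional ℝ G]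
    (Γ : Christoffel n) (p : Model n) : Model n →L[ℝ] JFib n G →L[ℝ] JFib n G :=
  clm₂ <| LinearMap.mk₂ ℝ
    (fun u s => (s.2 u, s.2 ∘L Γ p u - (lsch Γ p u).smulRight s.1))
    (fun u v s => by
      refine Prod.ext (map_add _ _ _) (ContinuousLinearMap.ext fun w => ?_)
      simp only [map_add, Prod.mk_add_mk, sub_apply, add_apply, ContinuousLinearMap.comp_apply,
        ContinuousLinearMap.smulRight_apply]
      module)
    (fun c u s => by
      refine Prod.ext (map_smul _ _ _) (ContinuousLinearMap.ext fun w => ?_)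
      simp only [map_smul, Prod.smul_mk, sub_apply, smul_apply, ContinuousLinearMap.comp_apply,
        ContinuousLinearMap.smulRight_apply, smul_eq_mul]
      module)
    (fun u s t => by
      refine Prod.ext rfl (ContinuousLinearMap.ext fun w => ?_)
      simp only [Prod.fst_add, Prod.snd_add, Prod.mk_add_mk, sub_apply, add_apply,
        ContinuousLinearMap.comp_apply, ContinuousLinearMap.smulRight_apply]
      module)
    (fun c u s => by
      refine Prod.ext rfl (ContinuousLinearMap.ext fun w => ?_)
      simp only [Prod.smul_fst, Prod.smul_snd, Prod.smul_mk, sub_apply, smul_apply,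
        ContinuousLinearMap.comp_apply, ContinuousLinearMap.smulRight_apply]
      module)

theorem contDiffAt_jcon {p : Model n} (h : ContDiffAt ℝ ∞ Γ p) :
    ContDiffAt ℝ ∞ (jcon G Γ) p := by
  refine contDiffAt_clm_of_apply fun u => contDiffAt_clm_of_apply fun s => ?_
  refine (contDiffAt_const (c := s.2 u)).prodMk (contDiffAt_clm_of_apply fun w => ?_)
  have c := fun u : Model n => contDiffAt_const (𝕜 := ℝ) (n := ∞) (x := p) (c := u)
  exact ((contDiffAt_const (c := s.2)).clm_apply ((h.clm_apply (c u)).clm_apply (c w))).sub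
    ((((contDiffAt_lsch h).clm_apply (c u)).clm_apply (c w)).smul contDiffAt_const)

theorem fderiv_jcon {p : Model n} (h : ContDiffAt ℝ ∞ Γ p) (u v w : Model n) (s : JFib n G) :
    (fderiv ℝ (jcon G Γ) p u v s).1 = 0 ∧ (fderiv ℝ (jcon G Γ) p u v s).2 w =
      s.2 (fderiv ℝ Γ p u v w) - fderiv ℝ (lsch Γ) p u v w • s.1 := by
  have hd : DifferentiableAt ℝ (jcon G Γ) p := (contDiffAt_jcon h).differentiableAt (by simp)
  have e0 : HasFDerivAt (fun q => jcon G Γ q v s) _ p :=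
    (hd.hasFDerivAt.clm_apply (hasFDerivAt_const v p)).clm_apply (hasFDerivAt_const s p)
  have e1 := fderiv_apply₂ hd u v s
  have hd0 : DifferentiableAt ℝ (fun q => jcon G Γ q v s) p := e0.differentiableAt
  constructor
  · have h1 := (hd0.hasFDerivAt.fst).fderiv
    have h2 : fderiv ℝ (fun q => (jcon G Γ q v s).1) p = 0 :=
      (hasFDerivAt_const (s.2 v) p).fderiv
    have h3 := congrArg (fun L => L u) (h2.symm.trans h1)
    rw [← e1]
    exact h3.symm
  · have h1 := ((hd0.hasFDerivAt.snd).clm_apply (hasFDerivAt_const w p)).fderiv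
    have d1 := ((h.differentiableAt (by simp)).hasFDerivAt.clm_apply
      (hasFDerivAt_const v p)).clm_apply (hasFDerivAt_const w p)
    have d2 := (((contDiffAt_lsch h).differentiableAt (by simp)).hasFDerivAt.clm_apply
      (hasFDerivAt_const v p)).clm_apply (hasFDerivAt_const w p)
    have h2 := ((s.2.hasFDerivAt.comp p d1).sub (d2.smul_const s.1)).fderiv
    have h3 := congrArg (fun L => L u) (h1.symm.trans h2)
    rw [← e1]
    simp at h3
    exact h3

/-- The integrability condition of the first-order system has function part 0 by symmetry of Γ and
P, and derivative part W paired with the derivative plus 2Y times the function. Hence W = Y = 0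
makes `exists_parallel_section` applicable. -/
theorem exists_affine_solution (h : LSpecial U Γ) (hf : LWeylFlat U Γ) {p₀ : Model n}
    (hp₀ : p₀ ∈ U) : ∃ r > 0, ball p₀ r ⊆ U ∧ ∀ (f₀ : G) (A₀ : Model n →L[ℝ] G),
      ∃ g : Model n → G, g p₀ = f₀ ∧ fderiv ℝ g p₀ = A₀ ∧ ∀ p ∈ ball p₀ r, ContDiffAt ℝ ∞ g p ∧
        ∀ u v, fderiv ℝ (fderiv ℝ g) p u v = fderiv ℝ g p (Γ p u v) - lsch Γ p u v • g p := by
  obtain ⟨r, hr, hrU, H⟩ := exists_parallel_section (F := JFib n G) h.isOpen hp₀ (B := jcon G Γ)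
    (fun p hp => contDiffAt_jcon (h.smooth p hp)) (by
      intro p hp u v s
      refine Prod.ext ?_ (ContinuousLinearMap.ext fun w => ?_)
      · rw [Prod.fst_add, Prod.fst_add, (fderiv_jcon (h.smooth p hp) u v 0 s).1,
          (fderiv_jcon (h.smooth p hp) v u 0 s).1]
        change 0 + (s.2 (Γ p u v) - lsch Γ p u v • s.1) = 0 + (s.2 (Γ p v u) - lsch Γ p v u • s.1)
        rw [h.symm p hp u v, h.lsch_symm hp u v]
      · rw [Prod.snd_add, Prod.snd_add, add_apply, add_apply,
          (fderiv_jcon (h.smooth p hp) u v w s).2, (fderiv_jcon (h.smooth p hp) v u w s).2]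
        change _ + ((s.2 (Γ p u (Γ p v w)) - lsch Γ p u (Γ p v w) • s.1) - lsch Γ p v w • s.2 u) =
          _ + ((s.2 (Γ p v (Γ p u w)) - lsch Γ p v (Γ p u w) • s.1) - lsch Γ p u w • s.2 v)
        have h1 := (hf p hp u v w).1
        have h2 := h.two_lcotton hp u v w
        rw [(hf p hp u v w).2] at h2
        rw [lweyl, lcurv_apply] at h1
        have h3 := congrArg s.2 h1
        simp only [map_add, map_sub, map_smul, map_zero] at h3
        have h4 := congrArg (fun c : ℝ => c • s.1) h2
        simp only [mul_zero, zero_smul, add_smul, sub_smul] at h4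
        linear_combination (norm := module) h3 + h4)
  refine ⟨r, hr, hrU, fun f₀ A₀ => ?_⟩
  obtain ⟨s, hs0, hs⟩ := H (f₀, A₀)
  have hsm := contDiffAt_parallel_section isOpen_ball
    (fun p hp => contDiffAt_jcon (G := G) (h.smooth p (hrU hp))) hs
  have hd : ∀ p ∈ ball p₀ r, fderiv ℝ (fun q => (s q).1) p = (s p).2 := by
    intro p hp
    rw [(hs p hp).fst.fderiv]
    rfl
  refine ⟨fun p => (s p).1, congrArg Prod.fst hs0, ?_, fun p hp => ⟨(hsm p hp).fst, fun u v => ?_⟩⟩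
  · rw [hd p₀ (mem_ball_self hr), hs0]
  · have he : fderiv ℝ (fun q => (s q).1) =ᶠ[𝓝 p] fun q => (s q).2 := by
      filter_upwards [isOpen_ball.mem_nhds hp] with q hq using hd q hq
    rw [he.fderiv_eq, hd p hp, (hs p hp).snd.fderiv]
    rfl

theorem fderiv_fderiv_smul {E : Type*} [NormedAddCommGroup E] [NormedSpace ℝ E] {H : Type*}
    [NormedAddCommGroup H] [NormedSpace ℝ H] {f : E → ℝ} {g : E → H} {p : E}
    (hf : ContDiffAt ℝ ∞ f p) (hg : ContDiffAt ℝ ∞ g p) (u v : E) :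
    fderiv ℝ (fderiv ℝ fun q => f q • g q) p u v = fderiv ℝ (fderiv ℝ f) p u v • g p
      + fderiv ℝ f p u • fderiv ℝ g p v + fderiv ℝ f p v • fderiv ℝ g p u
      + f p • fderiv ℝ (fderiv ℝ g) p u v := by
  have hf1 : ContDiffAt ℝ 1 f p := hf.of_le (by simp)
  have hg1 : ContDiffAt ℝ 1 g p := hg.of_le (by simp)
  have he : (fun q => fderiv ℝ (fun q => f q • g q) q v) =ᶠ[𝓝 p]
      fun q => f q • fderiv ℝ g q v + fderiv ℝ f q v • g q := by
    filter_upwards [hf1.eventually (by simp), hg1.eventually (by simp)] with q h1 h2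
    rw [fderiv_fun_smul (h1.differentiableAt (by simp)) (h2.differentiableAt (by simp))]
    rfl
  have df := hf.differentiableAt (n := ∞) (by simp)
  have dg := hg.differentiableAt (n := ∞) (by simp)
  have df' := (contDiffAt_fderiv hf).differentiableAt (n := ∞) (by simp)
  have dg' := (contDiffAt_fderiv hg).differentiableAt (n := ∞) (by simp)
  have hF : DifferentiableAt ℝ (fderiv ℝ fun q => f q • g q) p :=
    (contDiffAt_fderiv (hf.smul hg)).differentiableAt (n := ∞) (by simp)
  have e1 := (hF.hasFDerivAt.clm_apply (hasFDerivAt_const v p)).fderiv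
  have e2 := ((df.hasFDerivAt.smul (dg'.hasFDerivAt.clm_apply (hasFDerivAt_const v p))).add
    ((df'.hasFDerivAt.clm_apply (hasFDerivAt_const v p)).smul dg.hasFDerivAt)).fderiv
  have e3 := congrArg (fun L => L u) ((e1.symm.trans he.fderiv_eq).trans e2)
  simp at e3
  rw [e3]
  module

end ProjectiveCoordinates

/-! ### Charts of a flat projective structure -/

section ProjectiveCharts

open Filter Topology Metric

variable {n : ℕ} {U : Set (Model n)} {Γ : Christoffel n}

/-- A smooth map with invertible derivative at a point restricts to a smooth coordinate change
near that point. -/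
theorem exists_coordinate_change (hU : IsOpen U) {Φ : Model n → Model n}
    (hΦ : ∀ p ∈ U, ContDiffAt ℝ ∞ Φ p) {p₀ : Model n} (hp₀ : p₀ ∈ U)
    (h₀ : fderiv ℝ Φ p₀ = ContinuousLinearMap.id ℝ (Model n)) :
    ∃ e ∈ contDiffGroupoid ∞ (𝓡 n), p₀ ∈ e.source ∧ e.source ⊆ U ∧ (e : Model n → Model n) = Φ := by
  have h1 : HasFDerivAt Φ ((ContinuousLinearEquiv.refl ℝ (Model n) :
      Model n ≃L[ℝ] Model n) : Model n →L[ℝ] Model n) p₀ := by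
    have := ((hΦ p₀ hp₀).differentiableAt (by simp)).hasFDerivAt
    rwa [h₀] at this
  let e₀ := (hΦ p₀ hp₀).toOpenPartialHomeomorph Φ h1 (by simp)
  have hc : ∀ᶠ p in 𝓝 p₀, fderiv ℝ Φ p ∈
      range ((↑) : (Model n ≃L[ℝ] Model n) → Model n →L[ℝ] Model n) := by
    have hcont : ContinuousAt (fderiv ℝ Φ) p₀ := (contDiffAt_fderiv (hΦ p₀ hp₀)).continuousAt
    refine hcont.eventually ?_
    rw [h₀]
    exact (ContinuousLinearEquiv.refl ℝ (Model n)).nhds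
  -- The derivative stays invertible on an open S; restricting to S makes the inverse smooth on its
  -- whole domain, as membership in the groupoid demands.
  obtain ⟨S, hS, hSo, hS0⟩ := _root_.eventually_nhds_iff.1 (hc.and (hU.mem_nhds hp₀))
  have hsrc : ∀ p ∈ (e₀.restr S).source, p ∈ S := fun p hp => by
    rw [OpenPartialHomeomorph.restr_source, hSo.interior_eq] at hp
    exact hp.2
  have hsm : ContDiffOn ℝ ∞ Φ (e₀.restr S).source := fun p hp =>
    (hΦ p (hS p (hsrc p hp)).2).contDiffWithinAt
  have hsm' : ContDiffOn ℝ ∞ (e₀.restr S).symm (e₀.restr S).target := by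
    intro q hq
    have hq' := (e₀.restr S).map_target hq
    obtain ⟨⟨L, hL⟩, hqU⟩ := hS _ (hsrc _ hq')
    have hd := ((hΦ _ hqU).differentiableAt (by simp)).hasFDerivAt
    rw [← hL] at hd
    exact ((e₀.restr S).contDiffAt_symm hq hd (hΦ _ hqU)).contDiffWithinAt
  refine ⟨e₀.restr S, ?_, ?_, fun p hp => (hS p (hsrc p hp)).2, rfl⟩
  · rw [contDiffGroupoid, mem_groupoid_of_pregroupoid]
    constructor
    · change ContDiffOn ℝ ∞ Φ ((e₀.restr S).source ∩ range id)
      rw [range_id, inter_univ]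
      exact hsm
    · change ContDiffOn ℝ ∞ (e₀.restr S).symm ((e₀.restr S).target ∩ range id)
      rw [range_id, inter_univ]
      exact hsm'
  · rw [OpenPartialHomeomorph.restr_source, hSo.interior_eq]
    exact ⟨(hΦ p₀ hp₀).mem_toOpenPartialHomeomorph_source h1 (by simp), hS0⟩

/-- Φ = g / f is the affine chart of the projective space in which (f, g) are homogeneous
coordinates. As f and g solve the same equation, the terms with P cancel and only a = -df / f
disturbs dΦ ∘ Γ. -/
theorem exists_projective_coordinates (h : LSpecial U Γ) (hf : LWeylFlat U Γ) {p₀ : Model n}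
    (hp₀ : p₀ ∈ U) : ∃ V, IsOpen V ∧ p₀ ∈ V ∧ V ⊆ U ∧ ∃ (Φ : Model n → Model n)
      (a : Model n → Model n →L[ℝ] ℝ), fderiv ℝ Φ p₀ = ContinuousLinearMap.id ℝ (Model n) ∧
      ∀ p ∈ V, ContDiffAt ℝ ∞ Φ p ∧ ContDiffAt ℝ ∞ a p ∧ ∀ u v,
        fderiv ℝ (fderiv ℝ Φ) p u v = fderiv ℝ Φ p (Γ p u v + a p u • v + a p v • u) := by
  obtain ⟨r, hr, hrU, H⟩ := exists_affine_solution (G := ℝ) h hf hp₀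
  obtain ⟨r', hr', -, H'⟩ := exists_affine_solution (G := Model n) h hf hp₀
  obtain ⟨f, hf0, hf1, hfs⟩ := H 1 0
  obtain ⟨g, hg0, hg1, hgs⟩ := H' 0 (ContinuousLinearMap.id ℝ (Model n))
  have hfc : ContinuousOn f (ball p₀ r) := fun p hp =>
    (hfs p hp).1.continuousAt.continuousWithinAt
  have hVo : IsOpen (ball p₀ r ∩ f ⁻¹' {0}ᶜ) :=
    hfc.isOpen_inter_preimage isOpen_ball isOpen_compl_singleton
  have hΦ : ∀ p ∈ (ball p₀ r ∩ f ⁻¹' {0}ᶜ) ∩ ball p₀ r',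
      ContDiffAt ℝ ∞ (fun q => (f q)⁻¹ • g q) p := fun p hp =>
    ((hfs p hp.1.1).1.inv hp.1.2).smul (hgs p hp.2).1
  have hp0 : p₀ ∈ (ball p₀ r ∩ f ⁻¹' {0}ᶜ) ∩ ball p₀ r' :=
    ⟨⟨mem_ball_self hr, by simp [hf0]⟩, mem_ball_self hr'⟩
  refine ⟨(ball p₀ r ∩ f ⁻¹' {0}ᶜ) ∩ ball p₀ r', hVo.inter isOpen_ball, hp0,
    fun p hp => hrU hp.1.1, fun q => (f q)⁻¹ • g q, fun q => -((f q)⁻¹ • fderiv ℝ f q), ?_,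
    fun p hp => ⟨hΦ p hp, ?_, fun u v => ?_⟩⟩
  · have d1 : DifferentiableAt ℝ (fun q => (f q)⁻¹) p₀ :=
      (((hfs p₀ hp0.1.1).1.inv hp0.1.2)).differentiableAt (by simp)
    rw [fderiv_fun_smul d1 ((hgs p₀ hp0.2).1.differentiableAt (by simp)), hf0, hg0, hg1]
    ext1 v
    simp
  · exact (((hfs p hp.1.1).1.inv hp.1.2).smul (contDiffAt_fderiv (hfs p hp.1.1).1)).neg
  · have hs := hΦ p hp
    have hf0 : f p ≠ 0 := hp.1.2
    -- Differentiating the product g = f Φ twice avoids the second derivative of 1 / f.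
    have he : g =ᶠ[𝓝 p] fun q => f q • (f q)⁻¹ • g q := by
      filter_upwards [hVo.mem_nhds hp.1] with q hq
      rw [smul_smul, mul_inv_cancel₀ hq.2, one_smul]
    have e1 := (hgs p hp.2).2 u v
    have e2 := (hfs p hp.1.1).2 u v
    rw [he.fderiv.fderiv_eq, he.fderiv_eq, fderiv_fderiv_smul (hfs p hp.1.1).1 hs, e2,
      fderiv_fun_smul ((hfs p hp.1.1).1.differentiableAt (by simp)) (hs.differentiableAt (by simp))]
      at e1
    generalize fderiv ℝ (fderiv ℝ fun q => (f q)⁻¹ • g q) p u v = L at e1 ⊢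
    have e3 : g p = f p • (f p)⁻¹ • g p := he.self_of_nhds
    generalize fderiv ℝ (fun q => (f q)⁻¹ • g q) p = T at e1 ⊢
    have e4 : f p • L = f p • T (Γ p u v) - fderiv ℝ f p u • T v - fderiv ℝ f p v • T u := by
      generalize (f p)⁻¹ • g p = z at e1 e3
      rw [e3] at e1
      simp only [add_apply, smul_apply, ContinuousLinearMap.smulRight_apply, smul_eq_mul] at e1
      linear_combination (norm := module) e1
    have e5 := congrArg (fun x => (f p)⁻¹ • x) e4
    simp only [smul_smul, inv_mul_cancel₀ hf0, one_smul, smul_sub] at e5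
    rw [e5]
    simp only [map_add, map_smul, neg_apply, smul_apply, smul_eq_mul]
    module

variable {M : Type*} [TopologicalSpace M] [ChartedSpace (Model n) M]
  [IsManifold (𝓡 n) ∞ M] {φ : OpenPartialHomeomorph M (Model n)} {D : Connection n M}

theorem trans_mem_maximalAtlas (hφ : φ ∈ IsManifold.maximalAtlas (𝓡 n) ∞ M)
    {e : OpenPartialHomeomorph (Model n) (Model n)} (he : e ∈ contDiffGroupoid ∞ (𝓡 n)) :
    φ.trans e ∈ IsManifold.maximalAtlas (𝓡 n) ∞ M := by
  rw [IsManifold.mem_maximalAtlas_iff] at hφ ⊢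
  intro e' he'
  obtain ⟨h1, h2⟩ := hφ e' he'
  constructor
  · have := (contDiffGroupoid ∞ (𝓡 n)).trans ((contDiffGroupoid ∞ (𝓡 n)).symm he) h1
    rwa [OpenPartialHomeomorph.trans_symm_eq_symm_trans_symm, OpenPartialHomeomorph.trans_assoc]
  · have := (contDiffGroupoid ∞ (𝓡 n)).trans h2 he
    rwa [OpenPartialHomeomorph.trans_assoc] at this

theorem tm_trans (hφ : φ ∈ IsManifold.maximalAtlas (𝓡 n) ∞ M)
    {e : OpenPartialHomeomorph (Model n) (Model n)} {y : M} (hy : y ∈ φ.source)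
    (he : DifferentiableAt ℝ e (φ y)) (v : Tangent n y) :
    tm (φ.trans e) y v = fderiv ℝ e (φ y) (tm φ y v) := by
  have h := mfderiv_comp_apply (I := 𝓡 n) (I' := 𝓡 n) (I'' := 𝓡 n) y (g := e) (f := φ)
    he.mdifferentiableAt ((chart_contMDiffAt hφ hy).mdifferentiableAt (by simp)) v
  rw [mfderiv_eq_fderiv] at h
  exact h

/-- In the chart e ∘ φ the components of X are de applied to those in φ. Differentiating them and
inserting the second-order equation for e gives exactly the projective change by the 1-form a. -/
theorem WeylFlat.isProjFlat [T2Space M] (hD : IsSpecial D) (H : WeylFlat D) : IsProjFlat D := by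
  intro y
  have hφ : chartAt (Model n) y ∈ IsManifold.maximalAtlas (𝓡 n) ∞ M :=
    IsManifold.chart_mem_maximalAtlas y
  have hy := mem_chart_source (Model n) y
  set φ := chartAt (Model n) y
  obtain ⟨V, hV, hyV, hVU, Φ, a, hΦ0, hΦ⟩ := exists_projective_coordinates (lspecial_gam hD hφ)
    (H.chart hD hφ) (φ.map_source hy)
  obtain ⟨e, he, hye, heV, rfl⟩ := exists_coordinate_change hV (fun p hp => (hΦ p hp).1)
    hyV hΦ0
  have hψ := trans_mem_maximalAtlas hφ he
  refine ⟨φ.trans e, hψ, ⟨hy, hye⟩, cform φ a, fun x hx => ?_, fun X hX x hx v => ?_⟩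
  · exact smoothFormAt_cform hφ hx.1 (hΦ _ (heV hx.2)).2.1
  · have hx1 : x ∈ φ.source := hx.1
    have hx2 : φ x ∈ e.source := hx.2
    obtain ⟨s1, s2, s3⟩ := hΦ _ (heV hx2)
    have hXx : VFAt ∞ X x := hX x
    have hr := (contDiffAt_rep hφ infty_add_one_le hx1 hXx).differentiableAt (by simp)
    have hrψ := (contDiffAt_rep hψ infty_add_one_le hx hXx).differentiableAt (by simp)
    have ht : ∀ w, tm (φ.trans e) x w = fderiv ℝ e (φ x) (tm φ x w) := fun w =>
      tm_trans hφ hx1 (s1.differentiableAt (by simp)) w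
    have hinj : Function.Injective (tm (φ.trans e) x) :=
      Function.LeftInverse.injective (ti_tm hψ hx)
    refine hinj ?_
    rw [tm_chartConnection hψ hx hXx, ht, ht, map_add (tm φ x), map_add (tm φ x),
      map_smul (tm φ x), map_smul (tm φ x),
      tm_conn D hφ hx1 (k := ∞) (by simp) infty_add_one_le hXx v]
    have hee : (fun q => rep (φ.trans e) X (e q)) =ᶠ[𝓝 (φ x)]
        fun q => fderiv ℝ e q (rep φ X q) := by
      filter_upwards [e.open_source.mem_nhds hx2, φ.open_target.mem_nhds (φ.map_source hx1)]
        with q hq hq'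
      have hz := φ.map_target hq'
      have hq1 : φ (φ.symm q) = q := φ.right_inv hq'
      have hzψ : φ.symm q ∈ (φ.trans e).source := ⟨hz, by
        change φ (φ.symm q) ∈ e.source
        rwa [hq1]⟩
      have h1 := rep_apply (φ := φ.trans e) (X := X) hzψ
      change rep (φ.trans e) X (e (φ (φ.symm q))) = _ at h1
      rw [hq1] at h1
      rw [h1, tm_trans hφ hz (by rw [hq1]; exact ((hΦ q (heV hq)).1.differentiableAt (by simp))),
        hq1]
      rfl
    have e1 := (HasFDerivAt.comp (φ x) (g := rep (φ.trans e) X) (f := e) hrψ.hasFDerivAt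
      (s1.differentiableAt (by simp)).hasFDerivAt).fderiv
    have e2 := (((contDiffAt_fderiv s1).differentiableAt (by simp)).hasFDerivAt.clm_apply
      hr.hasFDerivAt).fderiv
    have e3 := congrArg (fun L => L (tm φ x v)) ((e1.symm.trans hee.fderiv_eq).trans e2)
    simp only [add_apply, ContinuousLinearMap.coe_comp, Function.comp,
      ContinuousLinearMap.flip_apply] at e3
    refine e3.trans ?_
    have eX : tm φ x (X x) = rep φ X (φ x) := (rep_apply hx1).symm
    have c1 : cform φ a x v = a (φ x) (tm φ x v) := rfl
    have c2 : cform φ a x (X x) = a (φ x) (tm φ x (X x)) := rfl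
    rw [c1, c2, eX, s3]
    simp only [map_add, map_smul]
    abel

theorem isProjFlat_iff [T2Space M] (hn : 2 ≤ n) (hD : IsSpecial D) :
    IsProjFlat D ↔ WeylFlat D :=
  ⟨fun H => H.weylFlat hn hD, fun H => H.isProjFlat hD⟩

end ProjectiveCharts

/-! ### Solutions as sections of the prolonged bundle -/

section LocalSolutions

open Filter Topology

theorem fcurv_eq_of_deriv {E F : Type*} [NormedAddCommGroup E] [NormedSpace ℝ E]
    [NormedAddCommGroup F] [NormedSpace ℝ F] {A : E → E →L[ℝ] F →L[ℝ] F} {p : E}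
    (hA : DifferentiableAt ℝ A p) {s : E → F} (hs : ContDiffAt ℝ ∞ s p) {P : E → E → F}
    (hP : ∀ v q, P v q = fderiv ℝ s q v + A q v (s q)) (u v : E) :
    fcurv A p u v (s p) =
      fderiv ℝ (P v) p u - fderiv ℝ (P u) p v - A p v (P u p) + A p u (P v p) := by
  have h := fcurv_eq hA hs (differentiableAt_const u) (differentiableAt_const v)
  simp only [fderiv_fun_const, Pi.zero_apply, zero_apply, sub_self, map_zero, add_zero,
    sub_zero] at h
  rw [funext (hP u), funext (hP v), ← h]
  abel

variable {n : ℕ} {U : Set (Model n)} {Γ : Christoffel n} {S : Model n → LTens n}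
  {m : Model n → Model n} {p : Model n}

/-- Smooth solutions, in coordinates, of the metrisability equation. -/
structure LSol (U : Set (Model n)) (Γ : Christoffel n) (S : Model n → LTens n)
    (m : Model n → Model n) : Prop where
  mem : ∀ p, S p ∈ lsym n
  smooth : ∀ p ∈ U, ContDiffAt ℝ ∞ S p
  smooth' : ∀ p ∈ U, ContDiffAt ℝ ∞ m p
  eqn : ∀ p ∈ U, ∀ v, fderiv ℝ S p v + act (Γ p v) (S p) = lsp v (m p)

/-- The endomorphism `∇_a μ^b + P_{ac} σ^{bc}` in coordinates. -/
def lxi (Γ : Christoffel n) (S : Model n → LTens n) (m : Model n → Model n) (p : Model n) :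
    Model n →L[ℝ] Model n := fderiv ℝ m p + (Γ p).flip (m p) + S p ∘L lsch Γ p

theorem lxi_apply (Γ : Christoffel n) (S : Model n → LTens n) (m : Model n → Model n)
    (p v : Model n) : lxi Γ S m p v = fderiv ℝ m p v + Γ p v (m p) + S p (lsch Γ p v) := rfl

/-- The function `ρ` attached to a solution, in coordinates. -/
def lrho (Γ : Christoffel n) (S : Model n → LTens n) (m : Model n → Model n) (p : Model n) : ℝ :=
  ltr (lxi Γ S m p) / n

/-- The section of the prolonged bundle attached to a solution, in coordinates. -/
def lpro (Γ : Christoffel n) (S : Model n → LTens n) (m : Model n → Model n) (p : Model n) :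
    LFib n := (S p, m p, lrho Γ S m p)

theorem LSol.contDiffAt_lrho (hs : LSol U Γ S m) (h : LSpecial U Γ) (hp : p ∈ U) :
    ContDiffAt ℝ ∞ (lrho Γ S m) p := by
  refine ContDiffAt.div_const (ContDiffAt.sum fun i _ => ?_) _
  have h1 := contDiffAt_fderiv (hs.smooth' p hp)
  have h2 := h.smooth p hp
  have h3 := contDiffAt_lsch h2
  have c : ContDiffAt ℝ ∞ (fun _ : Model n => bs i) p := contDiffAt_const
  exact (contDiffAt_const (c := pr i)).clm_apply (((h1.clm_apply c).add
    ((h2.clm_apply c).clm_apply (hs.smooth' p hp))).add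
    ((hs.smooth p hp).clm_apply (h3.clm_apply c)))

theorem LSol.contDiffAt_lpro (hs : LSol U Γ S m) (h : LSpecial U Γ) (hp : p ∈ U) :
    ContDiffAt ℝ ∞ (lpro Γ S m) p :=
  (hs.smooth p hp).prodMk ((hs.smooth' p hp).prodMk (hs.contDiffAt_lrho h hp))

/-- The covariant derivative of the section attached to a solution. -/
def ldpro (Γ : Christoffel n) (S : Model n → LTens n) (m : Model n → Model n) (v p : Model n) :
    LFib n := fderiv ℝ (lpro Γ S m) p v + tcon Γ p v (lpro Γ S m p)

theorem LSol.contDiffAt_ldpro (hs : LSol U Γ S m) (h : LSpecial U Γ) (hp : p ∈ U) (v : Model n) :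
    ContDiffAt ℝ ∞ (ldpro Γ S m v) p :=
  ((contDiffAt_fderiv (hs.contDiffAt_lpro h hp)).clm_apply contDiffAt_const).add
    (((contDiffAt_tcon (h.smooth p hp)).clm_apply contDiffAt_const).clm_apply
      (hs.contDiffAt_lpro h hp))

theorem LSol.hasFDerivAt_lpro (hs : LSol U Γ S m) (h : LSpecial U Γ) (hp : p ∈ U) :
    HasFDerivAt (lpro Γ S m) ((fderiv ℝ S p).prod
      ((fderiv ℝ m p).prod (fderiv ℝ (lrho Γ S m) p))) p :=
  (((hs.smooth p hp).differentiableAt (by simp)).hasFDerivAt).prodMk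
    ((((hs.smooth' p hp).differentiableAt (by simp)).hasFDerivAt).prodMk
      (((hs.contDiffAt_lrho h hp).differentiableAt (by simp)).hasFDerivAt))

theorem LSol.ldpro_fst (hs : LSol U Γ S m) (h : LSpecial U Γ) (hp : p ∈ U) (v : Model n) :
    (ldpro Γ S m v p).1 = 0 := by
  rw [ldpro, (hs.hasFDerivAt_lpro h hp).fderiv]
  change fderiv ℝ S p v + (act (Γ p v) (S p) - lsp v (m p)) = 0
  rw [← hs.eqn p hp v]
  abel

/-- In this form the μ-entry is trace-free by the choice of ρ, since the Weyl term has no trace by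
`LSpecial.sum_wtr`. -/
theorem LSol.ldpro_snd_fst_eq (hs : LSol U Γ S m) (h : LSpecial U Γ) (hp : p ∈ U) (v : Model n) :
    (ldpro Γ S m v p).2.1 =
      lxi Γ S m p v - lrho Γ S m p • v - (1 / (n : ℝ)) • wtr Γ p v (S p) := by
  rw [ldpro, (hs.hasFDerivAt_lpro h hp).fderiv, lxi_apply]
  change fderiv ℝ m p v + (Γ p v (m p) - lrho Γ S m p • v + S p (lsch Γ p v)
    - (1 / (n : ℝ)) • wtr Γ p v (S p)) = _
  abel

theorem LSol.fcurv_lpro (hs : LSol U Γ S m) (h : LSpecial U Γ) (hp : p ∈ U) (u v : Model n) :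
    fcurv (tcon Γ) p u v (lpro Γ S m p) = fderiv ℝ (ldpro Γ S m v) p u
      - fderiv ℝ (ldpro Γ S m u) p v - tcon Γ p v (ldpro Γ S m u p)
      + tcon Γ p u (ldpro Γ S m v p) :=
  fcurv_eq_of_deriv ((contDiffAt_tcon (h.smooth p hp)).differentiableAt (by simp))
    (hs.contDiffAt_lpro h hp) (P := ldpro Γ S m) (fun _ _ => rfl) u v

theorem fderiv_fst_apply {E F G : Type*} [NormedAddCommGroup E] [NormedSpace ℝ E]
    [NormedAddCommGroup F] [NormedSpace ℝ F] [NormedAddCommGroup G] [NormedSpace ℝ G]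
    {f : E → F × G} {p : E} (hf : DifferentiableAt ℝ f p) (u : E) :
    (fderiv ℝ f p u).1 = fderiv ℝ (fun q => (f q).1) p u := by
  rw [hf.hasFDerivAt.fst.fderiv]
  rfl

theorem fderiv_snd_apply {E F G : Type*} [NormedAddCommGroup E] [NormedSpace ℝ E]
    [NormedAddCommGroup F] [NormedSpace ℝ F] [NormedAddCommGroup G] [NormedSpace ℝ G]
    {f : E → F × G} {p : E} (hf : DifferentiableAt ℝ f p) (u : E) :
    (fderiv ℝ f p u).2 = fderiv ℝ (fun q => (f q).2) p u := by
  rw [hf.hasFDerivAt.snd.fderiv]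
  rfl

theorem sum_swap_of_mem_lsym {G : Type*} [AddCommGroup G] [Module ℝ G] {T : LTens n}
    (hT : T ∈ lsym n) (f : Model n →ₗ[ℝ] Model n →ₗ[ℝ] G) :
    ∑ j, f (bs j) (T (pr j)) = ∑ j, f (T (pr j)) (bs j) := by
  have h1 : ∀ j, f (bs j) (T (pr j)) = ∑ k, pr k (T (pr j)) • f (bs j) (bs k) := fun j => by
    conv_lhs => rw [← sum_pr_smul (T (pr j)), map_sum]
    simp only [map_smul]
  have h2 : ∀ j, f (T (pr j)) (bs j) = ∑ k, pr k (T (pr j)) • f (bs k) (bs j) := fun j => by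
    conv_lhs => rw [← sum_pr_smul (T (pr j)), map_sum]
    simp only [map_smul, LinearMap.sum_apply, LinearMap.smul_apply]
  simp only [h1, h2]
  rw [Finset.sum_comm]
  exact Finset.sum_congr rfl fun j _ => Finset.sum_congr rfl fun k _ => by
    rw [hT (pr j) (pr k)]

theorem sum_lsp_bs (A : Model n → Model n) (v : Model n) :
    ∑ j, (lsp v (A (bs j)) (pr j) - lsp (bs j) (A v) (pr j)) =
      (∑ j, pr j (A (bs j))) • v + ∑ j, pr j v • A (bs j) - ((n : ℝ) + 1) • A v := by
  have h1 : ∀ j : Fin n, lsp (bs j) (A v) (pr j) = pr j (A v) • bs j + A v := fun j => by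
    rw [lsp_apply, pr_bs, if_pos rfl, one_smul]
  simp only [h1, lsp_apply, Finset.sum_sub_distrib, Finset.sum_add_distrib, ← Finset.sum_smul]
  rw [sum_pr_smul, Finset.sum_const, Finset.card_univ, Fintype.card_fin]
  module

theorem LSpecial.sum_wtr (hn : 2 ≤ n) (T : LTens n) :
    ∑ j, pr j (wtr Γ p (bs j) T) = 0 := by
  simp only [wtr_apply, map_sum]
  rw [Finset.sum_comm]
  exact Finset.sum_eq_zero fun k _ => sum_lweyl_left hn Γ p _ _

/-- This explains the coefficient 1/n of the Weyl term in the connection: the action of W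
contributes -Wσ to the contraction, and the correction contributes (1/n) n Wσ. -/
theorem LSpecial.sum_fcurv_tcon_fst (h : LSpecial U Γ) (hn : 2 ≤ n) (hp : p ∈ U) (v : Model n)
    {s : LFib n} (hs : s.1 ∈ lsym n) : ∑ j, (fcurv (tcon Γ) p (bs j) v s).1 (pr j) = 0 := by
  have hn0 : (n : ℝ) ≠ 0 := by
    have : n ≠ 0 := by omega
    exact_mod_cast this
  have e1 : ∀ j : Fin n, (fcurv (tcon Γ) p (bs j) v s).1 (pr j) =
      act (lweylE Γ p (bs j) v) s.1 (pr j) - (1 / (n : ℝ)) • (lsp v (wtr Γ p (bs j) s.1) (pr j)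
        - lsp (bs j) (wtr Γ p v s.1) (pr j)) := fun j => by
    rw [h.fcurv_tcon_fst hp _ _ hs]
    simp only [add_apply, smul_apply, sub_apply]
    module
  have e3 : ∑ j : Fin n, s.1 (pr j ∘L lweylE Γ p (bs j) v) = 0 := by
    rw [← map_sum]
    refine (congrArg s.1 ?_).trans (map_zero s.1)
    ext1 w
    rw [sum_apply]
    exact sum_lweyl_left hn Γ p v w
  have e4 : ∑ j : Fin n, lweylE Γ p (bs j) v (s.1 (pr j)) = -wtr Γ p v s.1 := by
    have := sum_swap_of_mem_lsym hs (LinearMap.mk₂ ℝ (fun a b => lweyl Γ p a v b)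
      (fun a a' b => lweyl_add₁ Γ p a a' v b) (fun c a b => lweyl_smul₁ Γ p c a v b)
      (fun a b b' => lweyl_add₃ Γ p a v b b') (fun c a b => lweyl_smul₃ Γ p c a v b))
    refine this.trans ?_
    rw [wtr_apply, ← Finset.sum_neg_distrib]
    exact Finset.sum_congr rfl fun j _ => lweyl_antisymm Γ p _ _ _
  have e5 := sum_lsp_bs (fun x => wtr Γ p x s.1) v
  have e6 : ∑ j, pr j v • wtr Γ p (bs j) s.1 = wtr Γ p v s.1 := by
    conv_rhs => rw [← sum_pr_smul v, map_sum, sum_apply]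
    simp only [map_smul, smul_apply]
  simp only [LSpecial.sum_wtr hn, e6] at e5
  simp only [e1, Finset.sum_sub_distrib, act_apply, Finset.sum_add_distrib,
    ← Finset.smul_sum] at e5 ⊢
  rw [e3, e4, e5]
  rw [show -wtr Γ p v s.1 + 0 - (1 / (n : ℝ)) • ((0 : ℝ) • v + wtr Γ p v s.1
    - ((n : ℝ) + 1) • wtr Γ p v s.1) = (-1 + 1 / (n : ℝ) * n) • wtr Γ p v s.1 by module]
  rw [one_div, inv_mul_cancel₀ hn0]
  simp

/-- Let A be the μ-entry as a function of the direction. As the σ-entry vanishes identically, the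
σ-entry of the curvature is v ⊙ A(u) - u ⊙ A(v). Its contraction is zero by
`LSpecial.sum_fcurv_tcon_fst` and equals (tr A) v - n A(v), with tr A = 0. -/
theorem LSol.ldpro_snd_fst (hs : LSol U Γ S m) (h : LSpecial U Γ) (hn : 2 ≤ n) (hp : p ∈ U)
    (v : Model n) : (ldpro Γ S m v p).2.1 = 0 := by
  have hn0 : (n : ℝ) ≠ 0 := by
    have : n ≠ 0 := by omega
    exact_mod_cast this
  have d0 : ∀ u v, (fderiv ℝ (ldpro Γ S m v) p u).1 = 0 := fun u v => by
    rw [fderiv_fst_apply ((hs.contDiffAt_ldpro h hp v).differentiableAt (by simp))]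
    have : (fun q => (ldpro Γ S m v q).1) =ᶠ[𝓝 p] fun _ => 0 := by
      filter_upwards [h.isOpen.mem_nhds hp] with q hq using hs.ldpro_fst h hq v
    rw [this.fderiv_eq, fderiv_fun_const]
    rfl
  have a0 : ∀ A : Model n →L[ℝ] Model n, act A 0 = 0 := fun A => by simp [act]
  have e1 : ∀ u, (fcurv (tcon Γ) p u v (lpro Γ S m p)).1 =
      lsp v (ldpro Γ S m u p).2.1 - lsp u (ldpro Γ S m v p).2.1 := by
    intro u
    have e := congrArg Prod.fst (hs.fcurv_lpro h hp u v)
    refine e.trans ?_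
    rw [Prod.fst_add, Prod.fst_sub, Prod.fst_sub, d0, d0, tcon_fst, tcon_fst, hs.ldpro_fst h hp,
      hs.ldpro_fst h hp, a0, a0]
    abel
  have e2 := h.sum_fcurv_tcon_fst hn hp v (s := lpro Γ S m p) (hs.mem p)
  simp only [e1, sub_apply] at e2
  rw [sum_lsp_bs (fun x => (ldpro Γ S m x p).2.1) v] at e2
  have e3 : ∑ j : Fin n, pr j (ldpro Γ S m (bs j) p).2.1 = 0 := by
    simp only [hs.ldpro_snd_fst_eq h hp, map_sub, map_smul, smul_eq_mul, Finset.sum_sub_distrib,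
      ← Finset.mul_sum, sum_pr_bs_self, LSpecial.sum_wtr hn]
    rw [lrho, ltr, div_mul_cancel₀ _ hn0]
    ring
  have e4 : ∑ j, pr j v • (ldpro Γ S m (bs j) p).2.1 = (ldpro Γ S m v p).2.1 := by
    simp only [ldpro, Prod.snd_add, Prod.fst_add]
    let L : Model n →ₗ[ℝ] Model n := (LinearMap.fst ℝ (Model n) ℝ) ∘ₗ
      (LinearMap.snd ℝ (LTens n) (Model n × ℝ)) ∘ₗ
      (fderiv ℝ (lpro Γ S m) p + (tcon Γ p).flip (lpro Γ S m p)).toLinearMap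
    change ∑ j, pr j v • L (bs j) = L v
    conv_rhs => rw [← sum_pr_smul v, map_sum]
    simp only [map_smul]
  rw [e3, e4] at e2
  have e5 : (n : ℝ) • (ldpro Γ S m v p).2.1 = 0 := by
    linear_combination (norm := module) -e2
  exact (smul_eq_zero.1 e5).resolve_left hn0

/-- With the first two entries zero, the μ-entry of the curvature is τ(u) v - τ(v) u, where τ is the
ρ-entry; its trace over v is (n - 1) τ(u). Thus τ is algebraic in the section. -/
theorem LSol.ldpro_snd_snd (hs : LSol U Γ S m) (h : LSpecial U Γ) (hn : 2 ≤ n) (hp : p ∈ U)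
    (u : Model n) : ((n : ℝ) - 1) * (ldpro Γ S m u p).2.2 =
      ∑ j, pr j (fcurv (tcon Γ) p u (bs j) (lpro Γ S m p)).2.1 := by
  have d0 : ∀ u v, (fderiv ℝ (ldpro Γ S m v) p u).2.1 = 0 := fun u v => by
    have hd := (hs.contDiffAt_ldpro h hp v).differentiableAt (n := ∞) (by simp)
    rw [fderiv_snd_apply hd, fderiv_fst_apply hd.snd]
    have : (fun q => (ldpro Γ S m v q).2.1) =ᶠ[𝓝 p] fun _ => 0 := by
      filter_upwards [h.isOpen.mem_nhds hp] with q hq using hs.ldpro_snd_fst h hn hq v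
    rw [this.fderiv_eq, fderiv_fun_const]
    rfl
  have e1 : ∀ u v, (fcurv (tcon Γ) p u v (lpro Γ S m p)).2.1 =
      (ldpro Γ S m u p).2.2 • v - (ldpro Γ S m v p).2.2 • u := by
    intro u v
    have e := congrArg (fun s : LFib n => s.2.1) (hs.fcurv_lpro h hp u v)
    refine e.trans ?_
    simp only [Prod.snd_add, Prod.snd_sub, Prod.fst_add, Prod.fst_sub]
    rw [d0, d0, tcon_snd_fst, tcon_snd_fst, hs.ldpro_fst h hp,
      hs.ldpro_fst h hp, hs.ldpro_snd_fst h hn hp, hs.ldpro_snd_fst h hn hp]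
    simp only [map_zero, zero_apply, smul_zero]
    abel
  have e4 : ∑ j, pr j u * (ldpro Γ S m (bs j) p).2.2 = (ldpro Γ S m u p).2.2 := by
    let L : Model n →ₗ[ℝ] ℝ := (LinearMap.snd ℝ (Model n) ℝ) ∘ₗ
      (LinearMap.snd ℝ (LTens n) (Model n × ℝ)) ∘ₗ
      (fderiv ℝ (lpro Γ S m) p + (tcon Γ p).flip (lpro Γ S m p)).toLinearMap
    change ∑ j, pr j u * L (bs j) = L u
    conv_rhs => rw [← sum_pr_smul u, map_sum]
    simp only [map_smul, smul_eq_mul]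
  simp only [e1, map_sub, map_smul, smul_eq_mul, Finset.sum_sub_distrib, ← Finset.mul_sum,
    sum_pr_bs_self]
  conv_rhs => rw [Finset.sum_congr rfl fun j _ => mul_comm _ _, e4]
  ring

end LocalSolutions

/-! ### A norm bound for the curvature -/

section CurvatureBound

variable {E F : Type*} [NormedAddCommGroup E] [NormedSpace ℝ E] [NormedAddCommGroup F]
  [NormedSpace ℝ F]

local instance normedGroupEnd : NormedAddCommGroup (F →L[ℝ] F) :=
  ContinuousLinearMap.toNormedAddCommGroup
local instance normedSpaceEnd : NormedSpace ℝ (F →L[ℝ] F) := ContinuousLinearMap.toNormedSpace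
local instance normedGroupForm : NormedAddCommGroup (E →L[ℝ] F →L[ℝ] F) :=
  ContinuousLinearMap.toNormedAddCommGroup
local instance normedSpaceForm : NormedSpace ℝ (E →L[ℝ] F →L[ℝ] F) :=
  ContinuousLinearMap.toNormedSpace
local instance normedGroupForm₂ : NormedAddCommGroup (E →L[ℝ] E →L[ℝ] F →L[ℝ] F) :=
  ContinuousLinearMap.toNormedAddCommGroup

theorem norm_fcurv_le {A : E → E →L[ℝ] F →L[ℝ] F} {p : E} {K L : ℝ}
    (hK : ‖A p‖ ≤ K) (hL : ‖fderiv ℝ A p‖ ≤ L) (u v : E) (s : F) :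
    ‖fcurv A p u v s‖ ≤ 2 * (L + K ^ 2) * ‖u‖ * ‖v‖ * ‖s‖ := by
  have hK0 : 0 ≤ K := (norm_nonneg _).trans hK
  have hL0 : 0 ≤ L := (norm_nonneg _).trans hL
  have h1 : ∀ u v, ‖fderiv ℝ A p u v s‖ ≤ L * ‖u‖ * ‖v‖ * ‖s‖ := fun u v =>
    (((fderiv ℝ A p u v).le_opNorm s).trans (by
      gcongr
      refine ((fderiv ℝ A p u).le_opNorm v).trans ?_
      gcongr
      exact (fderiv ℝ A p).le_of_opNorm_le hL u))
  have h2 : ∀ v s, ‖A p v s‖ ≤ K * ‖v‖ * ‖s‖ := fun v s =>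
    ((A p v).le_opNorm s).trans (by
      gcongr
      exact (A p).le_of_opNorm_le hK v)
  have h3 : ∀ u v, ‖A p u (A p v s)‖ ≤ K ^ 2 * ‖u‖ * ‖v‖ * ‖s‖ := fun u v => by
    refine (h2 u _).trans ?_
    calc K * ‖u‖ * ‖A p v s‖ ≤ K * ‖u‖ * (K * ‖v‖ * ‖s‖) := by gcongr; exact h2 v s
      _ = _ := by ring
  rw [fcurv]
  have e1 := norm_sub_le (fderiv ℝ A p u v s - fderiv ℝ A p v u s + A p u (A p v s))
    (A p v (A p u s))
  have e2 := norm_add_le (fderiv ℝ A p u v s - fderiv ℝ A p v u s) (A p u (A p v s))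
  have e3 := norm_sub_le (fderiv ℝ A p u v s) (fderiv ℝ A p v u s)
  have e4 := h1 u v
  have e5 := h1 v u
  have e6 := h3 u v
  have e7 := h3 v u
  linarith

end CurvatureBound

/-! ### Local uniqueness of solutions -/

section LocalUniqueness

open Filter Topology Metric

variable {n : ℕ} {U : Set (Model n)} {Γ : Christoffel n} {S : Model n → LTens n}
  {m : Model n → Model n} {p : Model n}

/-- The derivative of the section is its covariant derivative, which is only a ρ-entry bounded by
the curvature, minus the connection form. The system is therefore closed even without parallelism.
-/
theorem LSol.norm_fderiv_lpro_le (hs : LSol U Γ S m) (h : LSpecial U Γ) (hn : 2 ≤ n) (hp : p ∈ U)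
    {K L : ℝ} (hK : ‖tcon Γ p‖ ≤ K) (hL : ‖fderiv ℝ (tcon Γ) p‖ ≤ L) (u : Model n) :
    ‖fderiv ℝ (lpro Γ S m) p u‖ ≤ (K + n * (2 * (L + K ^ 2))) * ‖u‖ * ‖lpro Γ S m p‖ := by
  have hn1 : (1 : ℝ) ≤ (n : ℝ) - 1 := by
    have : (2 : ℝ) ≤ n := by exact_mod_cast hn
    linarith
  have h1 : ‖tcon Γ p u (lpro Γ S m p)‖ ≤ K * ‖u‖ * ‖lpro Γ S m p‖ :=
    ((tcon Γ p u).le_opNorm _).trans (by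
      gcongr
      exact (tcon Γ p).le_of_opNorm_le hK u)
  have h2 : ‖ldpro Γ S m u p‖ = |(ldpro Γ S m u p).2.2| := by
    have : ldpro Γ S m u p = (0, 0, (ldpro Γ S m u p).2.2) :=
      Prod.ext (hs.ldpro_fst h hp u) (Prod.ext (hs.ldpro_snd_fst h hn hp u) rfl)
    rw [this, Prod.norm_mk, Prod.norm_mk]
    simp
  have h3 : |(ldpro Γ S m u p).2.2| ≤ n * (2 * (L + K ^ 2)) * ‖u‖ * ‖lpro Γ S m p‖ := by
    have e1 : |(ldpro Γ S m u p).2.2| ≤ |((n : ℝ) - 1) * (ldpro Γ S m u p).2.2| := by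
      rw [abs_mul, abs_of_nonneg (by linarith : (0 : ℝ) ≤ (n : ℝ) - 1)]
      exact le_mul_of_one_le_left (abs_nonneg _) hn1
    refine e1.trans ?_
    rw [hs.ldpro_snd_snd h hn hp]
    refine (Finset.abs_sum_le_sum_abs _ _).trans ?_
    have e2 : ∀ j : Fin n, |pr j (fcurv (tcon Γ) p u (bs j) (lpro Γ S m p)).2.1| ≤
        2 * (L + K ^ 2) * ‖u‖ * ‖lpro Γ S m p‖ := fun j => by
      have f1 := norm_fcurv_le hK hL u (bs j) (lpro Γ S m p)
      have f2 : ‖(fcurv (tcon Γ) p u (bs j) (lpro Γ S m p)).2.1‖ ≤ _ :=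
        (norm_fst_le _).trans ((norm_snd_le _).trans f1)
      have f3 : ‖(bs j : Model n)‖ = 1 := by simp [bs]
      rw [f3, mul_one] at f2
      exact (PiLp.norm_apply_le _ j).trans f2
    refine (Finset.sum_le_sum fun j _ => e2 j).trans (le_of_eq ?_)
    rw [Finset.sum_const, Finset.card_univ, Fintype.card_fin, nsmul_eq_mul]
    ring
  have h4 : fderiv ℝ (lpro Γ S m) p u = ldpro Γ S m u p - tcon Γ p u (lpro Γ S m p) := by
    rw [ldpro]
    abel
  rw [h4]
  refine (norm_sub_le _ _).trans ?_
  rw [h2]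
  linarith

/-- Grönwall along segments. The radius depends on Γ alone and q may be any point of the ball, both
of which the closedness argument in `evalSol_injective` uses. -/
theorem exists_unique_ball (h : LSpecial U Γ) (hn : 2 ≤ n) {p₀ : Model n} (hp₀ : p₀ ∈ U) :
    ∃ r > 0, ball p₀ r ⊆ U ∧ ∀ S m, LSol U Γ S m → ∀ q ∈ ball p₀ r, lpro Γ S m q = 0 →
      ∀ p ∈ ball p₀ r, lpro Γ S m p = 0 := by
  have c1 := contDiffAt_tcon (h.smooth p₀ hp₀)
  have ev1 : ∀ᶠ p in 𝓝 p₀, ‖tcon Γ p‖ < ‖tcon Γ p₀‖ + 1 :=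
    c1.continuousAt.norm.eventually (gt_mem_nhds (lt_add_one _))
  have ev2 : ∀ᶠ p in 𝓝 p₀, ‖fderiv ℝ (tcon Γ) p‖ < ‖fderiv ℝ (tcon Γ) p₀‖ + 1 :=
    (contDiffAt_fderiv c1).continuousAt.norm.eventually (gt_mem_nhds (lt_add_one _))
  obtain ⟨r, hr, hball⟩ := Metric.eventually_nhds_iff_ball.1
    (ev1.and (ev2.and (h.isOpen.mem_nhds hp₀)))
  refine ⟨r, hr, fun p hp => (hball p hp).2.2, fun S m hs q hq hq0 p hp => ?_⟩
  have hseg : ∀ t ∈ Icc (0 : ℝ) 1, q + t • (p - q) ∈ ball p₀ r := fun t ht =>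
    (convex_ball p₀ r).add_smul_sub_mem hq hp ht
  have hline : ∀ t : ℝ, HasDerivAt (fun t : ℝ => q + t • (p - q)) (p - q) t := fun t => by
    simpa using ((hasDerivAt_id t).smul_const (p - q)).const_add q
  have hd : ∀ t ∈ Icc (0 : ℝ) 1, HasDerivAt (fun t : ℝ => lpro Γ S m (q + t • (p - q)))
      (fderiv ℝ (lpro Γ S m) (q + t • (p - q)) (p - q)) t := fun t ht =>
    HasFDerivAt.comp_hasDerivAt (f := fun t : ℝ => q + t • (p - q)) t
      ((hs.contDiffAt_lpro h (hball _ (hseg t ht)).2.2).differentiableAt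
        (by simp)).hasFDerivAt (hline t)
  have key := eq_zero_of_abs_deriv_le_mul_abs_self_of_eq_zero_right
    (f := fun t : ℝ => lpro Γ S m (q + t • (p - q)))
    (f' := fun t => fderiv ℝ (lpro Γ S m) (q + t • (p - q)) (p - q))
    (K := (‖tcon Γ p₀‖ + 1 + n * (2 * (‖fderiv ℝ (tcon Γ) p₀‖ + 1 + (‖tcon Γ p₀‖ + 1) ^ 2)))
      * ‖p - q‖)
    (a := 0) (b := 1) (fun t ht => (hd t ht).continuousAt.continuousWithinAt)
    (fun t ht => (hd t (Ico_subset_Icc_self ht)).hasDerivWithinAt)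
    (by simpa using hq0) (fun t ht => by
      have ht' := hball _ (hseg t (Ico_subset_Icc_self ht))
      exact hs.norm_fderiv_lpro_le h hn ht'.2.2 ht'.1.le ht'.2.1.le _)
  have := key 1 (by simp)
  simpa using this

end LocalUniqueness

/-! ### Evaluation of solutions at a point -/

section Evaluation

open Filter Topology Metric

variable {n : ℕ} {M : Type*} [TopologicalSpace M] [ChartedSpace (Model n) M]
  [IsManifold (𝓡 n) ∞ M] {φ : OpenPartialHomeomorph M (Model n)} {D : Connection n M}

theorem lsp_right_injective (m : Model n) (h : ∀ v, lsp v m = 0) : m = 0 := by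
  have h1 := sum_lsp_bs (fun _ => m) (0 : Model n)
  rw [Finset.sum_congr rfl fun j _ => by
    rw [h (bs j), h (0 : Model n), sub_self], Finset.sum_const_zero] at h1
  have h4 : ((n : ℝ) + 1) • m = (∑ j : Fin n, pr j m) • (0 : Model n) +
      ∑ j : Fin n, pr j (0 : Model n) • m := by
    linear_combination (norm := module) h1
  have h5 : ((n : ℝ) + 1) • m = 0 := by simpa using h4
  exact (smul_eq_zero.1 h5).resolve_left (by positivity)

/-- The vector field `μ` attached to a solution. -/
def solVec (σ : solutions D) : Π x : M, Tangent n x := σ.2.2.choose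

theorem solVec_smooth (σ : solutions D) : SmoothVF (solVec σ) := σ.2.2.choose_spec.1

theorem nablaSym_sol (σ : solutions D) (x : M) (v : Tangent n x) :
    nablaSym D σ.1 x v = symProd v (solVec σ x) := σ.2.2.choose_spec.2 x v

/-- Hence μ is determined by σ, so the chosen `solVec` depends linearly on the solution. -/
theorem symProd_right_injective {x : M} {m m' : Tangent n x}
    (h : ∀ v : Tangent n x, symProd v m = symProd v m') : m = m' := by
  have hφ : chartAt (Model n) x ∈ IsManifold.maximalAtlas (𝓡 n) ∞ M :=
    IsManifold.chart_mem_maximalAtlas x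
  have hx := mem_chart_source (Model n) x
  have h1 : tm (chartAt (Model n) x) x m - tm (chartAt (Model n) x) x m' = 0 := by
    refine lsp_right_injective _ fun v => ?_
    have h2 := congrArg (tmS (chartAt (Model n) x) x) (h (ti (chartAt (Model n) x) x v))
    rw [tmS_symProd, tmS_symProd, tm_ti hφ hx] at h2
    rw [map_sub, h2, sub_self]
  rw [← ti_tm hφ hx m, sub_eq_zero.1 h1, ti_tm hφ hx]

theorem solVec_add (σ τ : solutions D) : solVec (σ + τ) = solVec σ + solVec τ := by
  funext x
  refine symProd_right_injective fun v => ?_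
  rw [← nablaSym_sol, Pi.add_apply, symProd_add_right, ← nablaSym_sol, ← nablaSym_sol]
  exact nablaSym_add D σ.2.1 τ.2.1 x v

theorem solVec_smul (c : ℝ) (σ : solutions D) : solVec (c • σ) = c • solVec σ := by
  funext x
  refine symProd_right_injective fun v => ?_
  rw [← nablaSym_sol, Pi.smul_apply, symProd_smul_right, ← nablaSym_sol]
  exact nablaSym_smul D σ.2.1 c x v

variable [T2Space M]

theorem lsol_of_isSolution (hφ : φ ∈ IsManifold.maximalAtlas (𝓡 n) ∞ M)
    {σ : Π x : M, SymTensor n x} (hσ : SmoothSym σ) {μ : Π x : M, Tangent n x}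
    (hμ : SmoothVF μ) (h : ∀ (x : M) (v : Tangent n x), nablaSym D σ x v = symProd v (μ x)) :
    LSol φ.target (gam D φ) (srep φ σ) (rep φ μ) := by
  have aux : ∀ p ∈ φ.target, ContDiffAt ℝ ∞ (srep φ σ) p ∧ ContDiffAt ℝ ∞ (rep φ μ) p := by
    intro p hp
    have h1 := contDiffAt_srep hφ (φ.map_target hp) hσ
    have h2 := contDiffAt_rep hφ infty_add_one_le (φ.map_target hp) (hμ (φ.symm p))
    rw [φ.right_inv hp] at h1 h2
    exact ⟨h1, h2⟩
  refine ⟨srep_mem φ σ, fun p hp => (aux p hp).1, fun p hp => (aux p hp).2, fun p hp v => ?_⟩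
  have hy := φ.map_target hp
  have h1 := tmS_nablaSym D hφ hy (σ := σ) (by
    rw [φ.right_inv hp]
    exact (aux p hp).1.differentiableAt (by simp)) (ti φ _ v)
  rw [h, tmS_symProd, tm_ti hφ hy, φ.right_inv hp] at h1
  exact h1.symm

theorem lsol_sol (hφ : φ ∈ IsManifold.maximalAtlas (𝓡 n) ∞ M) (σ : solutions D) :
    LSol φ.target (gam D φ) (srep φ σ.1) (rep φ (solVec σ)) :=
  lsol_of_isSolution hφ σ.2.1 (solVec_smooth σ) (nablaSym_sol σ)

/-- The initial data at a point of a solution. -/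
def evalSol (D : Connection n M) (hφ : φ ∈ IsManifold.maximalAtlas (𝓡 n) ∞ M) {p : Model n}
    (hp : p ∈ φ.target) : solutions D →ₗ[ℝ] lsym n × Model n × ℝ where
  toFun σ := (⟨srep φ σ.1 p, srep_mem φ σ.1 p⟩, rep φ (solVec σ) p,
    lrho (gam D φ) (srep φ σ.1) (rep φ (solVec σ)) p)
  map_add' σ τ := by
    have e1 : srep φ (σ + τ).1 = fun q => srep φ σ.1 q + srep φ τ.1 q :=
      funext fun q => map_add (tmS φ (φ.symm q)) _ _
    have e2 : rep φ (solVec (σ + τ)) = fun q => rep φ (solVec σ) q + rep φ (solVec τ) q := by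
      rw [solVec_add]
      exact funext fun q => map_add (tm φ (φ.symm q)) _ _
    have d1 := ((lsol_sol hφ σ).smooth' p hp).differentiableAt (n := ∞) (by simp)
    have d2 := ((lsol_sol hφ τ).smooth' p hp).differentiableAt (n := ∞) (by simp)
    refine Prod.ext (Subtype.ext (congrFun e1 p)) (Prod.ext (congrFun e2 p) ?_)
    change lrho _ _ _ p = lrho _ _ _ p + lrho _ _ _ p
    rw [e1, e2]
    simp only [lrho, ltr, lxi_apply, ← add_div, ← Finset.sum_add_distrib]
    congr 1
    refine Finset.sum_congr rfl fun i _ => ?_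
    rw [fderiv_fun_add d1 d2]
    simp only [map_add, add_apply]
    ring
  map_smul' c σ := by
    have e1 : srep φ (c • σ).1 = fun q => c • srep φ σ.1 q :=
      funext fun q => map_smul (tmS φ (φ.symm q)) _ _
    have e2 : rep φ (solVec (c • σ)) = fun q => c • rep φ (solVec σ) q := by
      rw [solVec_smul]
      exact funext fun q => map_smul (tm φ (φ.symm q)) _ _
    have d1 := ((lsol_sol hφ σ).smooth' p hp).differentiableAt (n := ∞) (by simp)
    refine Prod.ext (Subtype.ext (congrFun e1 p)) (Prod.ext (congrFun e2 p) ?_)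
    change lrho _ _ _ p = c • lrho _ _ _ p
    rw [e1, e2]
    simp only [lrho, ltr, lxi_apply, smul_eq_mul, ← mul_div_assoc, Finset.mul_sum]
    congr 1
    refine Finset.sum_congr rfl fun i _ => ?_
    rw [fderiv_fun_const_smul d1]
    simp only [map_add, map_smul, smul_apply, smul_eq_mul]
    ring

theorem evalSol_eq_zero_iff (hφ : φ ∈ IsManifold.maximalAtlas (𝓡 n) ∞ M) {p : Model n}
    (hp : p ∈ φ.target) (σ : solutions D) : evalSol D hφ hp σ = 0 ↔
      lpro (gam D φ) (srep φ σ.1) (rep φ (solVec σ)) p = 0 := by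
  constructor
  · intro h
    exact Prod.ext (congrArg (fun s : lsym n × Model n × ℝ => s.1.1) h)
      (congrArg (fun s : lsym n × Model n × ℝ => s.2) h)
  · intro h
    exact Prod.ext (Subtype.ext (congrArg Prod.fst h)) (congrArg (fun s : LFib n => s.2) h)

theorem lpro_eq_zero_of_eventually (hφ : φ ∈ IsManifold.maximalAtlas (𝓡 n) ∞ M) {z : M}
    (hz : z ∈ φ.source) (σ : solutions D) (h : ∀ᶠ y in 𝓝 z, σ.1 y = 0) :
    lpro (gam D φ) (srep φ σ.1) (rep φ (solVec σ)) (φ z) = 0 := by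
  have hs := lsol_sol hφ σ
  have e1 : ∀ᶠ p in 𝓝 (φ z), p ∈ φ.target ∧ srep φ σ.1 p = 0 := by
    filter_upwards [eventually_symm hz h] with p hp
    refine ⟨hp.1, ?_⟩
    rw [srep, hp.2, map_zero]
  have e2 : ∀ᶠ p in 𝓝 (φ z), rep φ (solVec σ) p = 0 := by
    filter_upwards [e1.eventually_nhds] with p hp
    refine lsp_right_injective _ fun v => ?_
    have e3 : srep φ σ.1 =ᶠ[𝓝 p] fun _ => 0 := hp.mono fun q hq => hq.2
    rw [← hs.eqn p hp.self_of_nhds.1 v, hp.self_of_nhds.2, e3.fderiv_eq, fderiv_fun_const]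
    simp [act]
  have e3 : rep φ (solVec σ) =ᶠ[𝓝 (φ z)] fun _ => 0 := e2
  refine Prod.ext e1.self_of_nhds.2 (Prod.ext e2.self_of_nhds ?_)
  change lrho _ _ _ (φ z) = 0
  simp only [lrho, ltr, lxi_apply]
  rw [e1.self_of_nhds.2, e2.self_of_nhds, e3.fderiv_eq, fderiv_fun_const]
  simp

theorem eventually_eq_zero_of_lpro (hφ : φ ∈ IsManifold.maximalAtlas (𝓡 n) ∞ M) {y : M}
    (hy : y ∈ φ.source) (σ : solutions D)
    (h : ∀ᶠ p in 𝓝 (φ y), lpro (gam D φ) (srep φ σ.1) (rep φ (solVec σ)) p = 0) :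
    ∀ᶠ z in 𝓝 y, σ.1 z = 0 := by
  filter_upwards [eventually_source hy, eventually_chart hy h] with z hz hz'
  refine tmS_injective hφ hz ?_
  rw [map_zero, ← srep_apply hz]
  exact congrArg Prod.fst hz'

/-- The set of points near which σ vanishes is open, and nonempty by local uniqueness at p. It is
closed: a uniqueness ball around a point of its closure contains a point of the set, where the whole
section is zero. -/
theorem evalSol_injective [ConnectedSpace M] (hn : 2 ≤ n) (hD : IsSpecial D)
    (hφ : φ ∈ IsManifold.maximalAtlas (𝓡 n) ∞ M) {p : Model n} (hp : p ∈ φ.target) :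
    Function.Injective (evalSol D hφ hp) := by
  refine (injective_iff_map_eq_zero _).2 fun σ hσ => ?_
  rw [evalSol_eq_zero_iff] at hσ
  let Z : Set M := {x | ∀ᶠ y in 𝓝 x, σ.1 y = 0}
  have hZo : IsOpen Z := isOpen_iff_mem_nhds.2 fun x hx => hx.eventually_nhds
  have hZne : Z.Nonempty := by
    obtain ⟨r, hr, -, H⟩ := exists_unique_ball (lspecial_gam hD hφ) hn hp
    refine ⟨φ.symm p, eventually_eq_zero_of_lpro hφ (φ.map_target hp) σ ?_⟩
    rw [φ.right_inv hp]
    filter_upwards [ball_mem_nhds p hr] with q hq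
    exact H _ _ (lsol_sol hφ σ) p (mem_ball_self hr) hσ q hq
  have hZc : IsClosed Z := by
    refine isClosed_of_closure_subset fun x hx => ?_
    have hψ : chartAt (Model n) x ∈ IsManifold.maximalAtlas (𝓡 n) ∞ M :=
      IsManifold.chart_mem_maximalAtlas x
    have hxs := mem_chart_source (Model n) x
    obtain ⟨r, hr, -, H⟩ := exists_unique_ball (lspecial_gam hD hψ) hn
      ((chartAt (Model n) x).map_source hxs)
    have hev : ∀ᶠ z in 𝓝 x, chartAt (Model n) x z ∈ ball (chartAt (Model n) x x) r ∧
        z ∈ (chartAt (Model n) x).source :=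
      (eventually_chart hxs (ball_mem_nhds _ hr)).and (eventually_source hxs)
    obtain ⟨z, hz, hzZ⟩ := mem_closure_iff_nhds.1 hx _ hev
    refine eventually_eq_zero_of_lpro hψ hxs σ ?_
    filter_upwards [ball_mem_nhds _ hr] with q hq
    exact H _ _ (lsol_sol hψ σ) _ hz.1 (lpro_eq_zero_of_eventually hψ hz.2 σ hzZ) q hq
  have hZ : Z = univ := IsClopen.eq_univ ⟨hZc, hZo⟩ hZne
  refine Subtype.ext (funext fun x => ?_)
  have hx : ∀ᶠ y in 𝓝 x, σ.1 y = 0 := (hZ ▸ mem_univ x : x ∈ Z)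
  exact hx.self_of_nhds

end Evaluation

/-! ### Maximal mobility forces W = Y = 0 -/

section MaximalMobility

open Filter Topology Metric

variable {n : ℕ} {U : Set (Model n)} {Γ : Christoffel n} {S : Model n → LTens n}
  {m : Model n → Model n} {p : Model n}

/-- The exterior covariant derivative of the Schouten tensor, as a linear form. -/
def lcottonE (Γ : Christoffel n) (p u v : Model n) : Model n →L[ℝ] ℝ :=
  fderiv ℝ (lsch Γ) p u v - fderiv ℝ (lsch Γ) p v u + lsch Γ p u ∘L Γ p v - lsch Γ p v ∘L Γ p u

theorem LSpecial.lcottonE_apply (h : LSpecial U Γ) (hp : p ∈ U) (u v w : Model n) :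
    lcottonE Γ p u v w = 2 * lcotton Γ p u v w := (h.two_lcotton hp u v w).symm

theorem wtr_eq_zero (hW : ∀ u v w, lweyl Γ p u v w = 0) (v : Model n) (T : LTens n) :
    wtr Γ p v T = 0 := by
  rw [wtr_apply]
  exact Finset.sum_eq_zero fun j _ => hW _ _ _

theorem LSpecial.fcurv_tcon_snd_fst (h : LSpecial U Γ) (hp : p ∈ U)
    (hW : ∀ q ∈ U, ∀ u v w, lweyl Γ q u v w = 0) (u v : Model n) (s : LFib n) :
    (fcurv (tcon Γ) p u v s).2.1 = s.1 (lcottonE Γ p u v)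
      + (4 / (n : ℝ)) • (ytr Γ p v s.1 • u - ytr Γ p u s.1 • v) := by
  have w0 := wtr_eq_zero (hW p hp)
  rw [fcurv_tcon (h.smooth p hp), fderiv_wtr_eq_zero h.isOpen hp hW]
  have e2 := hW p hp u v s.2.1
  rw [lweyl, lcurv_apply] at e2
  dsimp only
  simp only [w0, tcon_fst, tcon_snd_fst, tcon_snd_snd, lcottonE]
  simp only [sub_apply, act_apply, lsp_apply, map_sub, map_add, map_smul, zero_apply,
    smul_zero, sub_zero]
  rw [h.lsch_symm hp v u, h.symm p hp v u]
  linear_combination (norm := module) e2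

/-- The bilinear form `Y_{abc} u^a` in coordinates. -/
def lcottonB (Γ : Christoffel n) (p u : Model n) : Model n →ₗ[ℝ] Model n →ₗ[ℝ] ℝ :=
  LinearMap.mk₂ ℝ (fun a b => lcotton Γ p u a b)
    (fun a a' b => by simp only [lcotton, lnablaSch_add₁, lnablaSch_add₂]; ring)
    (fun c a b => by simp only [lcotton, lnablaSch_smul₁, lnablaSch_smul₂, smul_eq_mul]; ring)
    (fun a b b' => by simp only [lcotton, lnablaSch_add₃]; ring)
    (fun c a b => by simp only [lcotton, lnablaSch_smul₃, smul_eq_mul]; ring)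

/-- The summand 2 comes from the exterior derivative 2Y of P contracted with σ, and 1 - n from
tracing the two terms of the (4/n) correction. -/
theorem LSpecial.sum_fcurv_tcon_snd_fst (h : LSpecial U Γ) (hp : p ∈ U)
    (hW : ∀ q ∈ U, ∀ u v w, lweyl Γ q u v w = 0) (u : Model n) {s : LFib n} (hs : s.1 ∈ lsym n) :
    ∑ j, pr j (fcurv (tcon Γ) p u (bs j) s).2.1 =
      (2 + 4 / (n : ℝ) * (1 - n)) * ytr Γ p u s.1 := by
  have e1 : ∀ j, pr j (s.1 (lcottonE Γ p u (bs j))) = 2 * lcotton Γ p u (bs j) (s.1 (pr j)) :=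
    fun j => by rw [hs, h.lcottonE_apply hp]
  have e2 : ∑ j, lcotton Γ p u (bs j) (s.1 (pr j)) = ytr Γ p u s.1 :=
    sum_swap_of_mem_lsym hs (lcottonB Γ p u)
  have e3 : ∑ j, ytr Γ p (bs j) s.1 * pr j u = ytr Γ p u s.1 := by
    conv_rhs => rw [← sum_pr_smul u, map_sum, sum_apply]
    exact Finset.sum_congr rfl fun j _ => by rw [map_smul, smul_apply, smul_eq_mul, mul_comm]
  simp only [h.fcurv_tcon_snd_fst hp hW, map_add, e1, map_smul, map_sub, smul_eq_mul,
    Finset.sum_add_distrib, ← Finset.mul_sum, Finset.sum_sub_distrib, e2, e3, sum_pr_bs_self]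
  ring

theorem LSol.ldpro_snd_snd_eq (hs : LSol U Γ S m) (h : LSpecial U Γ) (hn : 2 ≤ n) (hp : p ∈ U)
    (hW : ∀ q ∈ U, ∀ u v w, lweyl Γ q u v w = 0) (u : Model n) :
    (ldpro Γ S m u p).2.2 = (2 / ((n : ℝ) - 1) - 4 / n) * ytr Γ p u (S p) := by
  have hn1 : (n : ℝ) - 1 ≠ 0 := by
    have : (2 : ℝ) ≤ n := by exact_mod_cast hn
    linarith
  have e := hs.ldpro_snd_snd h hn hp u
  rw [h.sum_fcurv_tcon_snd_fst hp hW u (s := lpro Γ S m p) (hs.mem p)] at e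
  change _ = _ * ytr Γ p u (S p) at e
  have e2 : ((n : ℝ) - 1) * (2 / ((n : ℝ) - 1)) = 2 := mul_div_cancel₀ 2 hn1
  refine mul_left_cancel₀ hn1 ?_
  linear_combination e - ytr Γ p u (S p) * e2

/-- At p the section is (0, μ, 0) and its covariant derivative vanishes. The ρ-entry of the
curvature identity equates (4 + 12/n) Y with the skew derivative of c Yσ; there dσ is u ⊙ μ, and the
cyclic identity gives -3c Y. The total coefficient 4 + 6/(n - 1) is positive. -/
theorem LSol.lcotton_eq_zero (hs : LSol U Γ S m) (h : LSpecial U Γ) (hn : 2 ≤ n) (hp : p ∈ U)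
    (hW : ∀ q ∈ U, ∀ u v w, lweyl Γ q u v w = 0) (hS : S p = 0) (hρ : lrho Γ S m p = 0)
    (u v : Model n) : lcotton Γ p u v (m p) = 0 := by
  have hn1 : (0 : ℝ) < (n : ℝ) - 1 := by
    have : (2 : ℝ) ≤ n := by exact_mod_cast hn
    linarith
  set c : ℝ := 2 / ((n : ℝ) - 1) - 4 / n with hc
  have e0 : lpro Γ S m p = (0, m p, 0) := by rw [lpro, hS, hρ]
  have d1 : ∀ u v, (fderiv ℝ (ldpro Γ S m v) p u).2.2 =
      c * (lcotton Γ p v u (m p) + lcotton Γ p v (m p) u) := fun u v => by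
    have hd := (hs.contDiffAt_ldpro h hp v).differentiableAt (n := ∞) (by simp)
    have hdS := ((hs.smooth p hp).differentiableAt (by simp)).hasFDerivAt
    have hdy : DifferentiableAt ℝ (fun q => ytr Γ q v) p :=
      ((contDiffAt_ytr (h.smooth p hp)).clm_apply contDiffAt_const).differentiableAt
        (n := ∞) (by simp)
    rw [fderiv_snd_apply hd, fderiv_snd_apply hd.snd]
    have he : (fun q => (ldpro Γ S m v q).2.2) =ᶠ[𝓝 p] fun q => c * ytr Γ q v (S q) := by
      filter_upwards [h.isOpen.mem_nhds hp] with q hq using hs.ldpro_snd_snd_eq h hn hq hW v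
    have e1 := ((hdy.hasFDerivAt.clm_apply hdS).const_mul c).fderiv
    have e2 := congrArg (fun L => L u) (he.fderiv_eq.trans e1)
    have e3 : fderiv ℝ S p u = lsp u (m p) := by
      have := hs.eqn p hp u
      rw [hS] at this
      rw [← this]
      simp [act]
    simp only [smul_apply, ContinuousLinearMap.coe_comp, Function.comp, hS, map_zero, add_zero,
      e3, ytr_lsp, smul_eq_mul] at e2
    exact e2
  have e1 : ∀ u, ldpro Γ S m u p = 0 := fun u => by
    refine Prod.ext (hs.ldpro_fst h hp u) (Prod.ext (hs.ldpro_snd_fst h hn hp u) ?_)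
    rw [hs.ldpro_snd_snd_eq h hn hp hW, hS, map_zero, mul_zero]
    rfl
  have e := congrArg (fun s : LFib n => s.2.2) (hs.fcurv_lpro h hp u v)
  rw [e1, e1, map_zero, map_zero, e0] at e
  have e3 := (h.fcurv_tcon_snd_snd hp u v (m p)).symm.trans e
  simp only [Prod.snd_sub, sub_zero, add_zero] at e3
  rw [d1, d1] at e3
  have e4 := h.lcotton_cyclic hp u (m p) v
  rw [lcotton_antisymm Γ p v u (m p)] at e3 e4
  rw [lcotton_antisymm Γ p (m p) v] at e4
  have e5 : (4 + 6 / ((n : ℝ) - 1)) * lcotton Γ p u v (m p) = 0 := by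
    rw [hc] at e3
    linear_combination e3 - c * e4
  exact (mul_eq_zero.1 e5).resolve_left (by positivity)

/-- The σ-entry of the curvature identity involves only the σ- and μ-entries of the covariant
derivative, both zero. -/
theorem LSol.fcurv_lpro_fst (hs : LSol U Γ S m) (h : LSpecial U Γ) (hn : 2 ≤ n) (hp : p ∈ U)
    (u v : Model n) : (fcurv (tcon Γ) p u v (lpro Γ S m p)).1 = 0 := by
  have d0 : ∀ u v, (fderiv ℝ (ldpro Γ S m v) p u).1 = 0 := fun u v => by
    rw [fderiv_fst_apply ((hs.contDiffAt_ldpro h hp v).differentiableAt (by simp))]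
    have : (fun q => (ldpro Γ S m v q).1) =ᶠ[𝓝 p] fun _ => 0 := by
      filter_upwards [h.isOpen.mem_nhds hp] with q hq using hs.ldpro_fst h hq v
    rw [this.fderiv_eq, fderiv_fun_const]
    rfl
  have a0 : ∀ A : Model n →L[ℝ] Model n, act A 0 = 0 := fun A => by simp [act]
  refine (congrArg Prod.fst (hs.fcurv_lpro h hp u v)).trans ?_
  rw [Prod.fst_add, Prod.fst_sub, Prod.fst_sub, d0, d0, tcon_fst, tcon_fst, hs.ldpro_fst h hp,
    hs.ldpro_fst h hp, a0, a0, hs.ldpro_snd_fst h hn hp, hs.ldpro_snd_fst h hn hp, map_zero,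
    map_zero]
  abel

/-- The components of symmetric tensors. -/
def symEquiv (n : ℕ) : lsym n ≃ₗ[ℝ] (Sym2 (Fin n) → ℝ) :=
  LinearEquiv.ofBijective
    { toFun := fun S s => Sym2.lift ⟨fun i j => pr i (S.1 (pr j)), fun i j => S.2 _ _⟩ s
      map_add' := fun S T => by
        funext s
        induction s using Sym2.ind with
        | _ i j => exact map_add (pr i) _ _
      map_smul' := fun c S => by
        funext s
        induction s using Sym2.ind with
        | _ i j => exact map_smul (pr i) _ _ }
    (by
      constructor
      · refine (injective_iff_map_eq_zero _).2 fun S hS => Subtype.ext ?_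
        have h1 : ∀ i j : Fin n, pr i (S.1 (pr j)) = 0 := fun i j => congrFun hS s(i, j)
        ext1 β
        rw [← sum_apply_bs β, map_sum]
        refine Finset.sum_eq_zero fun j _ => ?_
        rw [map_smul, ← sum_pr_smul (S.1 (pr j))]
        simp only [h1, zero_smul, Finset.sum_const_zero, smul_zero]
      · intro f
        -- The factor 1/2 compensates the two equal contributions of ordered pairs and of the
        -- symmetrised product.
        let T : LTens n := ∑ i, ∑ j, (f s(i, j) / 2) • lsp (bs i) (bs j)
        have hT : T ∈ lsym n := Submodule.sum_mem _ fun i _ => Submodule.sum_mem _ fun j _ =>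
          Submodule.smul_mem _ _ (lsp_mem _ _)
        refine ⟨⟨T, hT⟩, funext fun s => ?_⟩
        induction s using Sym2.ind with
        | _ k l =>
          change pr k ((∑ i : Fin n, ∑ j : Fin n, (f s(i, j) / 2) • lsp (bs i) (bs j)) (pr l)) = _
          simp only [sum_apply, smul_apply, lsp_apply, map_sum, map_smul, map_add, pr_bs,
            smul_eq_mul, mul_ite, mul_one, mul_zero, mul_add, Finset.sum_add_distrib,
            Finset.sum_ite_eq, Finset.mem_univ, if_true]
          rw [Sym2.eq_swap (a := l)]
          simp)

theorem finrank_lsym (n : ℕ) : Module.finrank ℝ (lsym n) = (n + 1) * n / 2 := by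
  rw [(symEquiv n).finrank_eq, Module.finrank_fintype_fun_eq_card, Sym2.card, Fintype.card_fin,
    Nat.choose_two_right]
  simp

instance : FiniteDimensional ℝ (lsym n) := (symEquiv n).symm.finiteDimensional

theorem finrank_initial (n : ℕ) :
    Module.finrank ℝ (lsym n × Model n × ℝ) = (n + 1) * (n + 2) / 2 := by
  rw [Module.finrank_prod, Module.finrank_prod, finrank_lsym, finrank_euclideanSpace,
    Fintype.card_fin, Module.finrank_self,
    show (n + 1) * (n + 2) = (n + 1) * n + 2 * (n + 1) by ring,
    Nat.add_mul_div_left _ _ (by norm_num)]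

variable {M : Type*} [TopologicalSpace M] [ChartedSpace (Model n) M]
  [IsManifold (𝓡 n) ∞ M] {φ : OpenPartialHomeomorph M (Model n)} {D : Connection n M} [T2Space M]

theorem finite_solutions [ConnectedSpace M] (hn : 2 ≤ n) (hD : IsSpecial D) :
    Module.Finite ℝ (solutions D) ∧ mobility D ≤ (n + 1) * (n + 2) / 2 := by
  have x := Classical.arbitrary M
  have hφ : chartAt (Model n) x ∈ IsManifold.maximalAtlas (𝓡 n) ∞ M :=
    IsManifold.chart_mem_maximalAtlas x
  have hinj := evalSol_injective hn hD hφ ((chartAt (Model n) x).map_source (mem_chart_source _ x))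
  refine ⟨Module.Finite.of_injective _ hinj, ?_⟩
  rw [← finrank_initial]
  exact LinearMap.finrank_le_finrank_of_injective hinj

theorem evalSol_surjective [ConnectedSpace M] (hn : 2 ≤ n) (hD : IsSpecial D)
    (hmax : mobility D = (n + 1) * (n + 2) / 2)
    (hφ : φ ∈ IsManifold.maximalAtlas (𝓡 n) ∞ M) {p : Model n} (hp : p ∈ φ.target) :
    Function.Surjective (evalSol D hφ hp) := by
  have := (finite_solutions hn hD).1
  have e : Module.finrank ℝ (solutions D) = Module.finrank ℝ (lsym n × Model n × ℝ) :=
    hmax.trans (finrank_initial n).symm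
  rw [← LinearMap.range_eq_top]
  exact Submodule.eq_top_of_finrank_eq
    ((LinearMap.finrank_range_of_inj (evalSol_injective hn hD hφ hp)).trans e)

/-- Surjectivity of evaluation is used at every point of the chart: W must vanish on an open set
before the formula for the ρ-entry can be differentiated to obtain Y. -/
theorem weylFlat_of_mobility [ConnectedSpace M] (hn : 2 ≤ n) (hD : IsSpecial D)
    (hmax : mobility D = (n + 1) * (n + 2) / 2) : WeylFlat D := by
  refine weylFlat_of_charts hD fun y => ?_
  have hφ : chartAt (Model n) y ∈ IsManifold.maximalAtlas (𝓡 n) ∞ M :=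
    IsManifold.chart_mem_maximalAtlas y
  set φ := chartAt (Model n) y
  have hL := lspecial_gam hD hφ
  have ex : ∀ p ∈ φ.target, ∀ (T : lsym n) (w : Model n), ∃ σ : solutions D,
      srep φ σ.1 p = T ∧ rep φ (solVec σ) p = w ∧
        lrho (gam D φ) (srep φ σ.1) (rep φ (solVec σ)) p = 0 := by
    intro p hp T w
    obtain ⟨σ, hσ⟩ := evalSol_surjective hn hD hmax hφ hp (T, w, 0)
    exact ⟨σ, congrArg (fun s => s.1.1) hσ, congrArg (fun s => s.2.1) hσ,
      congrArg (fun s => s.2.2) hσ⟩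
  have hW : ∀ p ∈ φ.target, ∀ u v w, lweyl (gam D φ) p u v w = 0 := by
    intro p hp u v w
    refine hL.lweyl_eq_zero hn hp (fun a b => ?_) w
    obtain ⟨σ, h1, -, -⟩ := ex p hp ⟨lsp a b, lsp_mem a b⟩ 0
    have hs := lsol_sol hφ σ
    have e := (hL.fcurv_tcon_fst hp u v (s := lpro (gam D φ) (srep φ σ.1) (rep φ (solVec σ)) p)
      (hs.mem p)).symm.trans (hs.fcurv_lpro_fst hL hn hp u v)
    have e1 : (lpro (gam D φ) (srep φ σ.1) (rep φ (solVec σ)) p).1 = lsp a b := h1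
    rwa [e1] at e
  refine ⟨φ, hφ, mem_chart_source _ y, fun p hp u v w => ⟨hW p hp u v w, ?_⟩⟩
  obtain ⟨σ, h1, h2, h3⟩ := ex p hp 0 w
  rw [← h2]
  exact (lsol_sol hφ σ).lcotton_eq_zero hL hn hp hW h1 h3 u v

end MaximalMobility

/-! ### The flat connection on ℝⁿ -/

section FlatModel

open Filter Topology Metric

variable {n : ℕ}

theorem contDiffAt_of_vfAt {X : Π x : Model n, Tangent n x} {k : ℕ∞ω} {x : Model n}
    (h : VFAt k X x) : ContDiffAt ℝ k (E := Model n) (F := Model n) X x := by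
  have h' := (contMDiffAt_section x).1 h
  exact contMDiffAt_iff_contDiffAt.1 (by simpa using h')

/-- The standard chart of the model space. -/
abbrev stdChart (n : ℕ) : OpenPartialHomeomorph (Model n) (Model n) :=
  OpenPartialHomeomorph.refl (Model n)

theorem stdChart_mem : stdChart n ∈ IsManifold.maximalAtlas (𝓡 n) ∞ (Model n) :=
  (contDiffGroupoid ∞ (𝓡 n)).id_mem_maximalAtlas

theorem tm_stdChart (y : Model n) (v : Tangent n y) : tm (stdChart n) y v = v := by
  change mfderiv (𝓡 n) (𝓡 n) id y v = v
  rw [mfderiv_id]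
  rfl

theorem rep_stdChart (X : Π x : Model n, Tangent n x) : rep (stdChart n) X = X :=
  funext fun p => tm_stdChart p _

theorem gam_flatConnection : gam (flatConnection n) (stdChart n) = fun _ => 0 := by
  funext p
  ext1 v
  ext1 w
  have h := gam_eq (flatConnection n) stdChart_mem (y := p) (mem_univ p) v w
  rw [tm_stdChart] at h
  refine h.trans ?_
  have hc : (cfield (stdChart n) fun _ => w : Π x : Model n, Tangent n x) = fun _ => w := by
    rw [← rep_stdChart (cfield (stdChart n) fun _ => w)]
    exact funext fun q => rep_cfield stdChart_mem (mem_univ q) _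
  rw [hc]
  change fderiv ℝ (fun _ : Model n => w) p _ = 0
  rw [fderiv_fun_const]
  rfl

/-- The determinant as a continuous multilinear map. -/
def detForm (n : ℕ) : ContinuousMultilinearMap ℝ (fun _ : Fin n => Model n) ℝ where
  toMultilinearMap := (EuclideanSpace.basisFun (Fin n) ℝ).toBasis.det.toMultilinearMap
  cont := by
    change Continuous fun v : Fin n → Model n => (EuclideanSpace.basisFun (Fin n) ℝ).toBasis.det v
    simp only [Module.Basis.det_apply]
    refine Continuous.matrix_det (continuous_matrix fun i j => ?_)
    simp only [Module.Basis.toMatrix_apply, OrthonormalBasis.coe_toBasis_repr_apply,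
      EuclideanSpace.basisFun_repr]
    fun_prop

theorem fderiv_multilinear (f : ContinuousMultilinearMap ℝ (fun _ : Fin n => Model n) ℝ)
    {X : Fin n → Model n → Model n} {x : Model n} (hX : ∀ i, DifferentiableAt ℝ (X i) x)
    (v : Model n) : fderiv ℝ (fun y => f fun i => X i y) x v =
      ∑ i, f (Function.update (fun j => X j x) i (fderiv ℝ (X i) x v)) := by
  have h1 := ((f.hasFDerivAt (fun i => X i x)).comp x
    (differentiableAt_pi.2 hX).hasFDerivAt).fderiv
  refine (congrArg (fun L => L v) h1).trans ?_
  rw [ContinuousLinearMap.comp_apply, ContinuousMultilinearMap.linearDeriv_apply, fderiv_pi hX]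
  rfl

/-- For the constant determinant form, parallelism is the Leibniz rule for a multilinear map. -/
theorem isParallelVolume_flat : IsParallelVolume (flatConnection n) fun _ : Model n =>
    (EuclideanSpace.basisFun (Fin n) ℝ).toBasis.det := by
  have hX' : ∀ X : Fin n → Π x : Model n, Tangent n x, (∀ i, SmoothVF (X i)) →
      ContDiff ℝ ∞ (fun x : Model n => fun i => (X i x : Model n)) := fun X hX =>
    contDiff_pi.2 fun i => contDiff_iff_contDiffAt.2 fun x => contDiffAt_of_vfAt (hX i x)
  refine ⟨fun x => (EuclideanSpace.basisFun (Fin n) ℝ).toBasis.det_ne_zero, fun X hX => ?_,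
    fun X hX x v => ?_⟩
  · exact ((detForm n).contDiff.comp (hX' X hX)).contMDiff
  · have h3 : mvfderiv (𝓡 n) (fun y => (EuclideanSpace.basisFun (Fin n) ℝ).toBasis.det
        fun i => X i y) x v = fderiv ℝ (fun y : Model n => detForm n fun i => X i y) x v := by
      rw [mvfderiv, mfderiv_eq_fderiv]
      rfl
    exact h3.trans (fderiv_multilinear (detForm n) (X := fun i y => X i y) (fun i =>
      (contDiffAt_of_vfAt (hX i x)).differentiableAt (by simp)) v)

theorem isSpecial_flatConnection : IsSpecial (flatConnection n) := by
  refine ⟨⟨fun {σ} hσ => ?_⟩, ?_, _, isParallelVolume_flat⟩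
  · intro x _
    refine ContMDiffAt.contMDiffWithinAt ?_
    rw [contMDiffAt_hom_bundle]
    refine ⟨contMDiffAt_id, ?_⟩
    have h1 : ContDiffAt ℝ (∞ + 1) (E := Model n) (F := Model n) σ x :=
      contDiffAt_of_vfAt ((hσ x (mem_univ x)).contMDiffAt univ_mem)
    have h2 : ContDiffAt ℝ ∞ (fderiv ℝ (E := Model n) (F := Model n) σ) x :=
      h1.fderiv_right (m := ∞) le_rfl
    exact h2.contMDiffAt.congr_of_eventuallyEq (Eventually.of_forall fun y =>
      inCoordinates_tangent_bundle_core_model_space (I := 𝓡 n) (I' := 𝓡 n) x y x y _)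
  · rw [CovariantDerivative.torsion_eq_zero_iff]
    intro X Y x hX hY
    refine Eq.trans ?_ ((congrFun (VectorField.mlieBracketWithin_univ (I := 𝓡 n) (V := X)
      (W := Y)).symm x).trans (congrFun (VectorField.mlieBracketWithin_eq_lieBracketWithin
      (V := X) (W := Y) (s := univ)) x)).symm
    exact (congrFun (VectorField.lieBracketWithin_univ (𝕜 := ℝ) (E := Model n) (V := X)
      (W := Y)) x).symm

theorem lrho_zero (hn : n ≠ 0) {S : Model n → LTens n} {m : Model n → Model n} {p : Model n}
    {r : ℝ} (hm : ∀ v, fderiv ℝ m p v = r • v) : lrho (fun _ => 0) S m p = r := by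
  have h1 : ∀ v, lsch (fun _ => 0 : Christoffel n) p v = 0 := fun v => by
    ext1 w
    rw [lsch_apply, lric_apply]
    simp [lcurv_apply]
  have hn0 : (n : ℝ) ≠ 0 := by exact_mod_cast hn
  rw [lrho, ltr]
  simp only [lxi_apply, hm, h1, zero_apply, map_zero, add_zero, map_smul, smul_eq_mul,
    ← Finset.mul_sum, sum_pr_bs_self]
  exact mul_div_cancel_right₀ r hn0

/-- Over flat space the equations dρ = 0, dμ = ρ dx, dσ = dx ⊙ μ integrate to polynomials of degree
at most two. -/
theorem evalSol_flat_surjective (hn : n ≠ 0) :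
    Function.Surjective (evalSol (flatConnection n) stdChart_mem (mem_univ (0 : Model n))) := by
  rintro ⟨T, w, r⟩
  -- The coefficient r/2 appears because x ⊙ x is 2 x ⊗ x, with derivative 2 v ⊙ x in the direction
  -- v.
  let S : Model n → lsym n := fun x =>
    ⟨T.1 + lsp x w + (r / 2) • lsp x x, add_mem (add_mem T.2 (lsp_mem x w))
      ((lsym n).smul_mem _ (lsp_mem x x))⟩
  let m : Model n → Model n := fun x => w + r • x
  have hSd : ∀ x v, fderiv ℝ (fun x => (S x).1) x v = lsp v (m x) := by
    intro x v
    have h1 := (((hasFDerivAt_const T.1 x).add ((lsp.flip w).hasFDerivAt (x := x))).add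
      ((lsp.hasFDerivAt.clm_apply (hasFDerivAt_id x)).const_smul (r / 2))).fderiv
    refine (congrArg (fun L => L v) h1).trans ?_
    change 0 + lsp v w + (r / 2) • (lsp x v + lsp v x) = lsp v (w + r • x)
    rw [lsp_comm x v, map_add, map_smul]
    module
  have hSs : ContDiff ℝ ∞ fun x : Model n => ((S x).1 : LTens n) := by
    have c1 : ContDiff ℝ ∞ fun x : Model n => lsp x w := (lsp.flip w).contDiff
    have c2 : ContDiff ℝ ∞ fun x : Model n => lsp x x :=
      (lsp (n := n)).contDiff.clm_apply contDiff_id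
    exact (contDiff_const.add c1).add (c2.const_smul (r / 2))
  have hmd : ∀ x v, fderiv ℝ m x v = r • v := by
    intro x v
    have h1 := (((hasFDerivAt_id (𝕜 := ℝ) x).const_smul r).const_add w).fderiv
    exact congrArg (fun L => L v) h1
  have hms : ContDiff ℝ ∞ m := contDiff_const.add (contDiff_id.const_smul r)
  let σ : Π x : Model n, SymTensor n x := csym (stdChart n) S
  have hσ : srep (stdChart n) σ = fun x => (S x).1 := by
    funext p
    rw [show p = stdChart n p from rfl, srep_apply (mem_univ p)]
    exact tmS_csym stdChart_mem (mem_univ p) S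
  have hσs : SmoothSym σ := fun α β x hα hβ =>
    contMDiffAt_eval stdChart_mem (mem_univ x) (by rw [hσ]; exact hSs.contDiffAt) hα hβ
  let μ : Π x : Model n, Tangent n x := m
  have hμr : rep (stdChart n) μ = m := rep_stdChart μ
  have hμ : SmoothVF μ := fun x =>
    vfAt_of_rep stdChart_mem (mem_univ x) (by rw [hμr]; exact hms.contDiffAt)
  have heq : ∀ (x : Model n) (v : Tangent n x),
      nablaSym (flatConnection n) σ x v = symProd v (μ x) := by
    intro x v
    refine tmS_injective stdChart_mem (mem_univ x) ?_
    refine (tmS_nablaSym (flatConnection n) stdChart_mem (mem_univ x)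
      (by rw [hσ]; exact hSs.contDiffAt.differentiableAt (by simp)) v).trans
      (Eq.trans ?_ (tmS_symProd (stdChart n) x v (μ x)).symm)
    rw [tm_stdChart, tm_stdChart, hσ, gam_flatConnection]
    refine (congrArg₂ (· + ·) (hSd x v) ?_).trans (add_zero _)
    have h0 := act_smul_left (0 : ℝ) (0 : Model n →L[ℝ] Model n) (S x).1
    rw [zero_smul, zero_smul] at h0
    exact h0
  let τ : solutions (flatConnection n) := ⟨σ, hσs, μ, hμ, heq⟩
  have hτ : rep (stdChart n) (solVec τ) = m :=
    (congrArg (rep (stdChart n)) (funext fun x => symProd_right_injective fun v =>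
      (nablaSym_sol τ x v).symm.trans (heq x v))).trans hμr
  refine ⟨τ, Prod.ext (Subtype.ext ?_) (Prod.ext ?_ ?_)⟩
  · refine (congrFun hσ 0).trans ?_
    simp [S]
  · refine (congrFun hτ 0).trans ?_
    simp [m]
  · change lrho (gam (flatConnection n) (stdChart n)) (srep (stdChart n) σ)
      (rep (stdChart n) (solVec τ)) 0 = r
    rw [hτ, gam_flatConnection]
    exact lrho_zero hn (hmd 0)

theorem mobility_flatConnection (hn : 2 ≤ n) :
    mobility (flatConnection n) = (n + 1) * (n + 2) / 2 := by
  refine le_antisymm (finite_solutions hn isSpecial_flatConnection).2 ?_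
  have := (finite_solutions hn (isSpecial_flatConnection (n := n))).1
  rw [← finrank_initial]
  exact LinearMap.finrank_le_finrank_of_surjective (evalSol_flat_surjective (by omega))

end FlatModel

end ProjGeom
end

theorem mainTheorem6 {n : ℕ} (hn : 2 ≤ n) {M : Type*} [TopologicalSpace M]
    [ChartedSpace (ProjGeom.Model n) M] [IsManifold (𝓡 n) ∞ M] [T2Space M]
    [SecondCountableTopology M] (D : ProjGeom.Connection n M) (hD : ProjGeom.IsSpecial D) :
    (ProjGeom.ProlongedCurvatureVanishes D ↔ ProjGeom.IsProjFlat D) ∧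
    (ConnectedSpace M →
      Module.Finite ℝ (ProjGeom.solutions D) ∧
      ProjGeom.mobility D ≤ (n + 1) * (n + 2) / 2 ∧
      (ProjGeom.mobility D = (n + 1) * (n + 2) / 2 → ProjGeom.IsProjFlat D)) ∧
    (ProjGeom.IsSpecial (ProjGeom.flatConnection n) ∧
      ProjGeom.mobility (ProjGeom.flatConnection n) = (n + 1) * (n + 2) / 2) :=
  ⟨(ProjGeom.prolongedCurvatureVanishes_iff hn hD).trans (ProjGeom.isProjFlat_iff hn hD).symm,
    fun _ => ⟨(ProjGeom.finite_solutions hn hD).1, (ProjGeom.finite_solutions hn hD).2,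
      fun h => (ProjGeom.isProjFlat_iff hn hD).2 (ProjGeom.weylFlat_of_mobility hn hD h)⟩,
    ProjGeom.isSpecial_flatConnection, ProjGeom.mobility_flatConnection hn⟩
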